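/- **Setting.** Let $p:(0,1)\to(0,\tfrac12)$ be continuous and non-decreasing. Let $n\ge 2$, $\delta=1/n$, and let a target $\theta$ be uniform on $\{1,\dots,n\}$. At each time $t=1,2,\dots$ an agent queries a set $S_t\subseteq\{1,\dots,n\}$ that depends on the past observations (and possibly on private randomness), and observes $Y_t=\mathbf 1(\theta\in S_t)\oplus Z_t$, where, given the past and $\theta$, $Z_t\sim\mathrm{Bern}(p(\delta|S_t|))$. A strategy consists of the choice of the query sets, a stopping time $\tau$ and a declared bin $\hat\theta$; it has reliability $\varepsilon$ if $\mathbb P(\tau<\infty,\ \hat\theta=\theta)\ge 1-\varepsilon$. Logarithms are natural, $D(P\|Q)=\sum_x P(x)\log\frac{P(x)}{Q(x)}$, $I(q,a)$ is the mutual information between an input $X\sim\mathrm{Bern}(q)$ and the output of a binary symmetric channel with crossover probability $a$, $C_1(a)=D(\mathrm{Bern}(a)\|\mathrm{Bern}(1-a))$, and $p_{\min}=\inf_{0<x<1}p(x)=\lim_{\delta\to0}p(\delta)$. **sortPM.** Let $\pi(t)$ be the posterior of $\theta$ after $t$ observations, with entries sorted in descending order $\pi^\downarrow_1(t)\ge\dots\ge\pi^\downarrow_n(t)$.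 Sorted posterior matching (sortPM) queries at time $t+1$ the $k^*$ most likely bins, where $k^*\in\{1,\dots,n\}$ minimizes $\bigl|\sum_{j\le k}\pi^\downarrow_j(t)-\tfrac12\bigr|$ over $k$; it stops at the first $t\ge1$ with $\max_i\pi_i(t)>1-\varepsilon$ and declares a most likely bin. All ties may be broken in any way depending on the current posterior. Let $\tau_{\varepsilon,\delta}$ be its stopping time, and $$K_s=\max\Bigl\{\tfrac12 D\bigl(\tfrac14B_1+\tfrac34B_0\,\big\|\,B_0\bigr),\ \tfrac18 D\bigl(B_1\,\big\|\,\tfrac34B_1+\tfrac14B_0\bigr)\Bigr\},\quad B_1=\mathrm{Bern}(1-p(\tfrac12)),\ B_0=\mathrm{Bern}(p(\tfrac12)).$$ **Theorem.** (i) $K_s>0$. (ii) There is a function $g(\delta,\varepsilon)$, depending only on $p$, with $g(\delta,\varepsilon)=o(\log\frac1{\delta\varepsilon})$ as $\frac1{\delta\varepsilon}\to\infty$, such that for all $n=1/\delta\ge2$ and $0<\varepsilon<1$, sortPM has reliability $\varepsilon$, and for every $\alpha<1$ with $\alpha>(e\log\frac1{\delta\varepsilon})^{-K_s}$, $$\mathbb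 E[\tau_{\varepsilon,\delta}]\le\frac{\log(1/\delta)}{I(1/2,p(\alpha))}+\frac{\log(1/\varepsilon)}{C_1(p(\delta))}+g(\delta,\varepsilon).$$ (iii) (Optimal rate.) For every $\varepsilon\in(0,1)$, $\liminf_{\delta\to0}\log(1/\delta)/\mathbb E[\tau_{\varepsilon,\delta}]\ge I(1/2,p_{\min})$. Conversely, for every $R>I(1/2,p_{\min})$ there is $\varepsilon_0\in(0,1)$ such that for all sufficiently large $n=1/\delta$, every strategy of reliability $\varepsilon_0$ satisfies $\log(1/\delta)/\mathbb E[\tau]\le R$. (iv) (Optimal reliability.) For every $n=1/\delta\ge2$, $\liminf_{\varepsilon\to0}\log(1/\varepsilon)/\mathbb E[\tau_{\varepsilon,\delta}]\ge C_1(p(\delta))$. Conversely, for every $E>C_1(p(\delta))$ and all sufficiently small $\varepsilon>0$, every strategy of reliability $\varepsilon$ satisfies $\log(1/\varepsilon)/\mathbb E[\tau]\le E$. (The statements about sortPM in (iii) and (iv) hold uniformly over all ways of breaking ties.) -/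

import Mathlib

open MeasureTheory Filter Topology
open scoped ENNReal

noncomputable section

namespace NoisySearch

/-! ### Information quantities (natural logarithm) -/

/-- `D(P ‖ Q) = ∑ₓ P(x) log (P(x) / Q(x))`, for mass functions on a finite set
(it is only used when `Q` vanishes nowhere). -/
def KL {X : Type} [Fintype X] (P Q : X → ℝ) : ℝ := ∑ x, P x * Real.log (P x / Q x)

/-- The mass function of `Bern(a)`; `true` is the outcome `1`. -/
def bern (a : ℝ) (y : Bool) : ℝ := if y then a else 1 - a

/-- The mass function `w P + (1 - w) Q`. -/
def mix (w : ℝ) (P Q : Bool → ℝ) (y : Bool) : ℝ := w * P y + (1 - w) * Q y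

/-- The mutual information `I(X;Y)` of a joint mass function. -/
def mutualInfo {X Y : Type} [Fintype X] [Fintype Y] (J : X → Y → ℝ) : ℝ :=
  ∑ x, ∑ y, J x y * Real.log (J x y / ((∑ y', J x y') * ∑ x', J x' y))

/-- The transition mass function of the binary symmetric channel with crossover probability `a`:
input `x`, output `y`. -/
def bsc (a : ℝ) (x y : Bool) : ℝ := if y = x then 1 - a else a

/-- `I(q, a)`: the mutual information between an input `X ∼ Bern(q)` and the output of a binary
symmetric channel with crossover probability `a`. -/
def infoBSC (q a : ℝ) : ℝ := mutualInfo fun x y => bern q x * bsc a x y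

/-- `C₁(a) = D(Bern(a) ‖ Bern(1 - a))`. -/
def C1 (a : ℝ) : ℝ := KL (bern a) (bern (1 - a))

/-! ### The noise profile -/

/-- `p` restricts to a continuous non-decreasing function `(0,1) → (0,1/2)`.  Its values outside
`(0,1)` are irrelevant. -/
structure IsNoiseProfile (p : ℝ → ℝ) : Prop where
  mem : ∀ x ∈ Set.Ioo (0 : ℝ) 1, p x ∈ Set.Ioo (0 : ℝ) (1 / 2)
  cont : ContinuousOn p (Set.Ioo 0 1)
  mono : MonotoneOn p (Set.Ioo 0 1)

/-- `p_min`: the infimum of the noise profile over `(0,1)`.  For a non-decreasing profile it is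
the limit, as the resolution `δ` tends to `0`, of the smallest available noise level `p(δ)`. -/
def pMin (p : ℝ → ℝ) : ℝ := sInf (p '' Set.Ioo 0 1)

/-- The constant `K_s`, with `B₁ = Bern(1 - p(1/2))` and `B₀ = Bern(p(1/2))`. -/
def Ks (p : ℝ → ℝ) : ℝ :=
  max
    (1 / 2 * KL (mix (1 / 4) (bern (1 - p (1 / 2))) (bern (p (1 / 2)))) (bern (p (1 / 2))))
    (1 / 8 * KL (bern (1 - p (1 / 2)))
      (mix (3 / 4) (bern (1 - p (1 / 2))) (bern (p (1 / 2)))))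

/-! ### Search strategies

There are `n = 1/δ` bins, indexed by `Fin n`.  A list of Booleans is a history of observations,
the most recent one first. -/

/-- A sequential, possibly randomized, search strategy on `n` bins: private randomness `w`
(uniform on `[0,1]`) and the past observations determine the next query set, whether the search
is over, and the declared bin.  Querying no bin or all bins is allowed; the noise level is then
outside the range of the profile, but such an observation is independent of the target. -/
structure Strategy (n : ℕ) where
  query : unitInterval → List Bool → Finset (Fin n)
  halt : unitInterval → List Bool → Prop
  estimate : unitInterval → List Bool → Fin n
  measurable_query : ∀ h S, MeasurableSet {w | query w h = S}
  measurable_halt : ∀ h, MeasurableSet {w | halt w h}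
  measurable_estimate : ∀ h i, MeasurableSet {w | estimate w h = i}

/-- The sample space: the target bin `θ`, the private randomness of the agent, and the source
`(U_t)` of the measurement noise. -/
abbrev Sample (n : ℕ) : Type := Fin n × unitInterval × (ℕ → unitInterval)

/-- `θ` is uniform on the bins, the private randomness and all `U_t` are uniform on `[0,1]`, and
everything is independent. -/
def law (n : ℕ) : Measure (Sample n) :=
  (ProbabilityTheory.uniformOn (Set.univ : Set (Fin n))).prod
    ((volume : Measure unitInterval).prod
      (Measure.infinitePi fun _ : ℕ => (volume : Measure unitInterval)))

/-- Noise level `p(δ|S|)` of the query set `S`, with `δ = 1/n`. -/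
def noiseLevel (p : ℝ → ℝ) {n : ℕ} (S : Finset (Fin n)) : ℝ := p ((S.card : ℝ) / n)

/-- The noise `Z(S) ∼ Bern(p(δ|S|))`, generated from a uniform variable. -/
def noiseBit (p : ℝ → ℝ) {n : ℕ} (S : Finset (Fin n)) (u : unitInterval) : Bool :=
  open Classical in decide ((u : ℝ) < noiseLevel p S)

/-- The history of the first `t` observations `Y = 1(θ ∈ S) ⊕ Z(S)` under a strategy. -/
def Strategy.history (p : ℝ → ℝ) {n : ℕ} (A : Strategy n) (ω : Sample n) : ℕ → List Bool
  | 0 => []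
  | t + 1 =>
    let h := A.history p ω t
    let S := A.query ω.2.1 h
    xor (decide (ω.1 ∈ S)) (noiseBit p S (ω.2.2 t)) :: h

/-- The agent is willing to stop after `t` queries. -/
def Strategy.stopsAt (p : ℝ → ℝ) {n : ℕ} (A : Strategy n) (ω : Sample n) (t : ℕ) : Prop :=
  A.halt ω.2.1 (A.history p ω t)

/-- The search time `τ`: the first time at which the agent stops, `∞` if there is none. -/
def Strategy.time (p : ℝ → ℝ) {n : ℕ} (A : Strategy n) (ω : Sample n) : ℝ≥0∞ :=
  ⨅ (t : ℕ) (_ : A.stopsAt p ω t), (t : ℝ≥0∞)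

/-- `E[τ]`. -/
def Strategy.expectedTime (p : ℝ → ℝ) {n : ℕ} (A : Strategy n) : ℝ≥0∞ :=
  ∫⁻ ω, A.time p ω ∂(law n)

/-- The event that the search ends and the declared bin is the target bin. -/
def Strategy.success (p : ℝ → ℝ) {n : ℕ} (A : Strategy n) : Set (Sample n) :=
  {ω | ∃ t, A.stopsAt p ω t ∧ (∀ s < t, ¬ A.stopsAt p ω s) ∧
    A.estimate ω.2.1 (A.history p ω t) = ω.1}

/-- Reliability `ε`: the target is found with probability at least `1 - ε`. -/
def Strategy.Reliable (p : ℝ → ℝ) {n : ℕ} (A : Strategy n) (ε : ℝ) : Prop :=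
  ENNReal.ofReal (1 - ε) ≤ law n (A.success p)

/-! ### Sorted posterior matching -/

/-- `S` consists of the `k` most likely bins of `π`, where the bins are sorted in descending order
(`σ i` is the position of `i`, counted from `0`) and `k` makes the sum of the `k` largest entries as
close to `1/2` as possible. -/
def IsSortedQuery {n : ℕ} (π : Fin n → ℝ) (S : Finset (Fin n)) : Prop :=
  ∃ σ : Equiv.Perm (Fin n), (∀ i j, σ i ≤ σ j → π j ≤ π i) ∧
    ∃ k : ℕ, 1 ≤ k ∧ k ≤ n ∧
      (∀ k' : ℕ, 1 ≤ k' → k' ≤ n →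
        |(∑ i with (σ i : ℕ) < k, π i) - 1 / 2| ≤ |(∑ i with (σ i : ℕ) < k', π i) - 1 / 2|) ∧
      S = Finset.univ.filter fun i => (σ i : ℕ) < k

/-- A version of sorted posterior matching, that is, a way to break all ties: in the sorting, in
the choice of `k`, and in the choice of a most likely bin. -/
structure SortPM (n : ℕ) where
  query : (Fin n → ℝ) → Finset (Fin n)
  best : (Fin n → ℝ) → Fin n
  isSortedQuery : ∀ π : Fin n → ℝ, IsSortedQuery π (query π)
  isBest : ∀ (π : Fin n → ℝ) (i : Fin n), π i ≤ π (best π)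

/-- Bayes' rule for the observation `y` of the query `S`: given `θ = i`, the observation is the
output of the channel with input `1(i ∈ S)` and crossover probability `p(δ|S|)`. -/
def bayes (p : ℝ → ℝ) {n : ℕ} (S : Finset (Fin n)) (y : Bool) (π : Fin n → ℝ) (i : Fin n) : ℝ :=
  π i * bsc (noiseLevel p S) (decide (i ∈ S)) y /
    ∑ j, π j * bsc (noiseLevel p S) (decide (j ∈ S)) y

/-- The posterior of `θ` after a history of observations, from the uniform prior. -/
def SortPM.belief (p : ℝ → ℝ) {n : ℕ} (r : SortPM n) : List Bool → Fin n → ℝ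
  | [] => fun _ => 1 / (n : ℝ)
  | y :: h => bayes p (r.query (r.belief p h)) y (r.belief p h)

/-- Sorted posterior matching of variable length: query by the sorted posterior, stop at the first
`t ≥ 1` at which some bin has posterior more than `1 - ε`, and declare a most likely bin. -/
def SortPM.strategy (p : ℝ → ℝ) {n : ℕ} (r : SortPM n) (ε : ℝ) : Strategy n where
  query _ h := r.query (r.belief p h)
  halt _ h := h ≠ [] ∧ ∃ i, 1 - ε < r.belief p h i
  estimate _ h := r.best (r.belief p h)
  measurable_query _ _ := MeasurableSet.const _
  measurable_halt _ := MeasurableSet.const _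
  measurable_estimate _ _ := MeasurableSet.const _

/-! ### The asymptotic regime -/

/-- `1/(δε) → ∞`, over all pairs `(n, ε)` with `n = 1/δ ≥ 2` and `0 < ε < 1`. -/
def searchLimit : Filter (ℕ × ℝ) :=
  comap (fun x => (x.1 : ℝ) / x.2) atTop ⊓ 𝓟 {x | 2 ≤ x.1 ∧ x.2 ∈ Set.Ioo (0 : ℝ) 1}

end NoisySearch

end

-- Everything is reduced to weighted sums over the binary tree of observation histories. For a fixed
-- target and private seed the observations follow a kernel on this tree;
-- `Strategy.lintegral_history` turns expectations over the sample space into iterated one-step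
-- averages. Then `E[τ]` is the sum over `t` of the probability of still searching after `t`
-- observations, and success is the sum over `t` of the probability of stopping at `t` with the
-- right bin.
--
-- Converse. `change_of_measure` is the Donsker–Varadhan inequality for a stopped process: if one
-- observation separates the laws `P` and `Q` by at most `C` nats, then `c P(G) - (e^c - 1) Q(G) ≤ C
-- E_P[τ]` for an event `G` decided at stopping. For the rate, `Q` replaces each informative answer
-- by a fair coin, the cost per query is at most `I(1/2, p_min)`, `G` is the declaration of the
-- target, and `c = log n`. For the reliability, `Q` is the law under the cyclically next target,
-- the cost is at most `C₁(p(δ))`, and `c = log (1/ε)`.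
--
-- Achievability. For a fixed target, three potentials control different phases. The negative log
-- posterior starts at `log n`, stays nonnegative, and falls by nearly the mutual information when
-- the query mass is near `1/2`. The square root of the odds against the target contracts by a fixed
-- factor at every step, so large or intermediate odds are visited rarely. Once the target has
-- posterior above `2/3`, sortPM queries it alone, and its log-odds grow at exactly `C₁(p(δ))`.
--
-- Each history at which the search goes on is of one of four types: one bin is nearly certain; one
-- bin has intermediate posterior; all bins are unlikely and the query set is small, hence nearly
-- balanced and nearly noise-optimal; or all bins are unlikely and the query set is large, which
-- with posterior probability at least `1/2` forces odds of order `n` against the target. The first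
-- and third types give the two main terms, the other two cost constants
-- (`SortPM.alive_le_of_large`).
--
-- This yields the main terms with `p_min` itself, up to `η log (1/(δε))` plus a constant for every
-- `η > 0`; an infimum over `η` gives `g`. Since `I(1/2, ·)` decreases on `[0, 1/2]`, the bound with
-- `p(α)` follows.

noncomputable section

namespace NoisySearch

/-! ### Averaging over the binary tree of observations -/

/-- A transition kernel of an observation process: nonnegative masses of total mass one. -/
structure IsKernel (q : List Bool → Bool → ℝ) : Prop where
  nonneg : ∀ h y, 0 ≤ q h y
  sum_eq_one : ∀ h, ∑ y, q h y = 1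

/-- The conditional expectation of `F` at the next history. -/
def step (q : List Bool → Bool → ℝ) (F : List Bool → ℝ) (h : List Bool) : ℝ :=
  ∑ y, q h y * F (y :: h)

/-- The conditional expectation of `F` at the history reached `t` steps later. -/
def steps (q : List Bool → Bool → ℝ) (t : ℕ) (F : List Bool → ℝ) : List Bool → ℝ :=
  (step q)^[t] F

variable {q : List Bool → Bool → ℝ}

@[simp] lemma steps_zero (F : List Bool → ℝ) : steps q 0 F = F := rfl

lemma steps_succ (t : ℕ) (F : List Bool → ℝ) : steps q (t + 1) F = steps q t (step q F) := rfl

lemma steps_succ' (t : ℕ) (F : List Bool → ℝ) : steps q (t + 1) F = step q (steps q t F) :=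
  Function.iterate_succ_apply' _ _ _

lemma step_add (F G : List Bool → ℝ) : step q (F + G) = step q F + step q G := by
  ext h; simp [step, mul_add, Finset.sum_add_distrib]

lemma step_const_mul (c : ℝ) (F : List Bool → ℝ) :
    step q (fun h => c * F h) = fun h => c * step q F h := by
  ext h; simp only [step, Finset.mul_sum]; exact Finset.sum_congr rfl fun _ _ => by ring

lemma IsKernel.step_mono (hq : IsKernel q) {F G : List Bool → ℝ} (hFG : ∀ h, F h ≤ G h)
    (h : List Bool) : step q F h ≤ step q G h :=
  Finset.sum_le_sum fun y _ => mul_le_mul_of_nonneg_left (hFG _) (hq.nonneg h y)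

lemma steps_add (t : ℕ) (F G : List Bool → ℝ) :
    steps q t (F + G) = steps q t F + steps q t G := by
  induction t generalizing F G with
  | zero => rfl
  | succ t ih => simp only [steps_succ, step_add, ih]

lemma steps_const_mul (t : ℕ) (c : ℝ) (F : List Bool → ℝ) :
    steps q t (fun h => c * F h) = fun h => c * steps q t F h := by
  induction t generalizing F with
  | zero => rfl
  | succ t ih => simp only [steps_succ, step_const_mul, ih]

lemma IsKernel.steps_mono (hq : IsKernel q) (t : ℕ) {F G : List Bool → ℝ}
    (hFG : ∀ h, F h ≤ G h) (h : List Bool) : steps q t F h ≤ steps q t G h := by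
  induction t generalizing F G with
  | zero => exact hFG h
  | succ t ih => exact ih (hq.step_mono hFG)

lemma IsKernel.steps_const (hq : IsKernel q) (t : ℕ) (c : ℝ) :
    steps q t (fun _ => c) = fun _ => c := by
  induction t with
  | zero => rfl
  | succ t ih =>
    have : step q (fun _ => c) = fun _ => c := by
      ext h; simp only [step, ← Finset.sum_mul, hq.sum_eq_one, one_mul]
    rw [steps_succ, this, ih]

lemma IsKernel.steps_nonneg (hq : IsKernel q) (t : ℕ) {F : List Bool → ℝ} (hF : ∀ h, 0 ≤ F h)
    (h : List Bool) : 0 ≤ steps q t F h := by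
  have := hq.steps_mono t hF h
  rwa [hq.steps_const t 0] at this

/-- If the potential `V` decreases on average by at least `c`, then the total expected cost up to
time `T` is at most the total decrease of the potential. -/
lemma IsKernel.sum_steps_le (hq : IsKernel q) {V c : List Bool → ℝ}
    (hV : ∀ h, step q V h + c h ≤ V h) (T : ℕ) (h : List Bool) :
    ∑ t ∈ Finset.range T, steps q t c h + steps q T V h ≤ V h := by
  induction T with
  | zero => simp
  | succ T ih =>
    have h1 := hq.steps_mono T hV h
    have h2 := congrFun (steps_add (q := q) T (step q V) c) h
    rw [Finset.sum_range_succ, steps_succ]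
    simp only [Pi.add_apply] at h2
    have h3 : steps q T (step q V + c) h = steps q T (fun h => step q V h + c h) h := rfl
    linarith

/-- The form of the potential argument used for all visit counts: the cost is a rate times an
indicator, so dividing by the rate bounds the expected number of visits uniformly in `T`. -/
lemma IsKernel.sum_steps_le_of_bound (hq : IsKernel q) {V c : List Bool → ℝ} {m : ℝ}
    (hV : ∀ h, step q V h + c h ≤ V h) (hm : ∀ h, m ≤ V h) (T : ℕ) (h : List Bool) :
    ∑ t ∈ Finset.range T, steps q t c h ≤ V h - m := by
  have h1 := hq.sum_steps_le hV T h
  have h2 := hq.steps_mono T hm h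
  rw [hq.steps_const] at h2
  linarith

lemma sum_steps_succ (T : ℕ) (F : List Bool → ℝ) (h : List Bool) :
    ∑ t ∈ Finset.range (T + 1), steps q t F h
      = F h + ∑ y, q h y * ∑ t ∈ Finset.range T, steps q t F (y :: h) := by
  rw [Finset.sum_range_succ', add_comm]
  simp only [steps_succ', step, Finset.mul_sum, steps_zero]
  rw [Finset.sum_comm]

/-! ### The law of the observations of a strategy -/

lemma bsc_nonneg {a : ℝ} (h0 : 0 ≤ a) (h1 : a ≤ 1) (x y : Bool) : 0 ≤ bsc a x y := by
  unfold bsc; split_ifs <;> linarith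

lemma sum_bsc (a : ℝ) (x : Bool) : ∑ y, bsc a x y = 1 := by
  cases x <;> simp [bsc]

/-- The actual crossover probability of the channel when the set `S` is queried. -/
def crossover (p : ℝ → ℝ) {n : ℕ} (S : Finset (Fin n)) : ℝ := max 0 (min 1 (noiseLevel p S))

lemma crossover_nonneg (p : ℝ → ℝ) {n : ℕ} (S : Finset (Fin n)) : 0 ≤ crossover p S :=
  le_max_left _ _

lemma crossover_le_one (p : ℝ → ℝ) {n : ℕ} (S : Finset (Fin n)) : crossover p S ≤ 1 :=
  max_le zero_le_one (min_le_left _ _)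

/-- The law of the next observation, given the target and the past. -/
def Strategy.kernel (p : ℝ → ℝ) {n : ℕ} (A : Strategy n) (w : unitInterval) (i : Fin n)
    (h : List Bool) (y : Bool) : ℝ :=
  bsc (crossover p (A.query w h)) (decide (i ∈ A.query w h)) y

lemma Strategy.isKernel (p : ℝ → ℝ) {n : ℕ} (A : Strategy n) (w : unitInterval) (i : Fin n) :
    IsKernel (A.kernel p w i) :=
  ⟨fun _ _ => bsc_nonneg (crossover_nonneg _ _) (crossover_le_one _ _) _ _, fun _ => sum_bsc _ _⟩

-- From the sample space to the tree of histories

instance instMeasurableSpaceHistory : MeasurableSpace (List Bool) := ⊤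

instance : DiscreteMeasurableSpace (List Bool) := ⟨fun _ => trivial⟩

lemma measurableSet_noiseBit (p : ℝ → ℝ) {n : ℕ} (S : Finset (Fin n)) :
    MeasurableSet {v : unitInterval | (v : ℝ) < noiseLevel p S} :=
  measurableSet_lt measurable_subtype_coe measurable_const

lemma measurable_noiseBit (p : ℝ → ℝ) {n : ℕ} (S : Finset (Fin n)) :
    Measurable (noiseBit p S) := by
  refine measurable_to_bool ?_
  convert measurableSet_noiseBit p S using 1
  ext v; simp [noiseBit]

/-- For `U` uniform on `[0,1]`, the probability of `U < a` is `a` clipped to `[0,1]`. The clipping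
matters only for the empty and the full query, where the noise level is an arbitrary real number. -/
lemma volume_noiseBit (p : ℝ → ℝ) {n : ℕ} (S : Finset (Fin n)) :
    volume {v : unitInterval | (v : ℝ) < noiseLevel p S} = ENNReal.ofReal (crossover p S) := by
  rw [crossover]
  rcases lt_or_ge (noiseLevel p S) 0 with h0 | h0
  · have : {v : unitInterval | (v : ℝ) < noiseLevel p S} = ∅ := by
      ext v; simp; linarith [v.2.1]
    rw [this, max_eq_left (le_trans (min_le_right _ _) h0.le)]; simp
  · rw [max_eq_right (le_min zero_le_one h0)]
    rcases le_or_gt (noiseLevel p S) 1 with h1 | h1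
    · rw [min_eq_right h1, ← unitInterval.volume_Iio ⟨noiseLevel p S, h0, h1⟩]
      rfl
    · have : {v : unitInterval | (v : ℝ) < noiseLevel p S} = Set.univ := by
        ext v; simp; linarith [v.2.2]
      rw [this, min_eq_left h1.le]; simp

lemma lintegral_noiseBit (p : ℝ → ℝ) {n : ℕ} (S : Finset (Fin n)) (s : Bool) {F : Bool → ℝ}
    (hF : ∀ y, 0 ≤ F y) :
    ∫⁻ v, ENNReal.ofReal (F (xor s (noiseBit p S v)))
      = ENNReal.ofReal (∑ y, bsc (crossover p S) s y * F y) := by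
  have hm := measurableSet_noiseBit p S
  have hc0 := crossover_nonneg p S
  have hc1 := crossover_le_one p S
  have hcompl : volume {v : unitInterval | (v : ℝ) < noiseLevel p S}ᶜ
      = ENNReal.ofReal (1 - crossover p S) := by
    rw [prob_compl_eq_one_sub hm, volume_noiseBit, ENNReal.ofReal_sub _ hc0, ENNReal.ofReal_one]
  rw [← lintegral_add_compl _ hm,
    setLIntegral_congr_fun (g := fun _ => ENNReal.ofReal (F (!s))) hm
      (fun v hv => by
        have : noiseBit p S v = true := by simpa [noiseBit] using hv
        simp [this]),
    setLIntegral_congr_fun (g := fun _ => ENNReal.ofReal (F s)) hm.compl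
      (fun v hv => by
        have : noiseBit p S v = false := by simpa [noiseBit] using hv
        simp [this]),
    setLIntegral_const, setLIntegral_const, hcompl, volume_noiseBit,
    ← ENNReal.ofReal_mul (hF _), ← ENNReal.ofReal_mul (hF _),
    ← ENNReal.ofReal_add (mul_nonneg (hF _) hc0) (mul_nonneg (hF _) (by linarith))]
  congr 1
  cases s <;> simp [bsc] <;> ring

lemma Strategy.history_congr (p : ℝ → ℝ) {n : ℕ} (A : Strategy n) (i : Fin n) (w : unitInterval)
    {u v : ℕ → unitInterval} {t : ℕ} (huv : ∀ s < t, u s = v s) :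
    A.history p (i, w, u) t = A.history p (i, w, v) t := by
  induction t with
  | zero => rfl
  | succ t ih =>
    simp only [Strategy.history]
    rw [ih fun s hs => huv s (by omega), huv t (by omega)]

lemma Strategy.measurable_history (p : ℝ → ℝ) {n : ℕ} (A : Strategy n) (t : ℕ) :
    Measurable fun ω : Sample n => A.history p ω t := by
  induction t with
  | zero => exact measurable_const
  | succ t ih =>
    -- Histories form a countable discrete space, so it suffices to fix the past; likewise the query
    -- set and the target are then fixed.
    have key : Measurable fun x : List Bool × Sample n =>
        xor (decide (x.2.1 ∈ A.query x.2.2.1 x.1))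
          (noiseBit p (A.query x.2.2.1 x.1) (x.2.2.2 t)) :: x.1 := by
      refine measurable_from_prod_countable_right fun h => ?_
      let _ : MeasurableSpace (Finset (Fin n)) := ⊤
      have _ : DiscreteMeasurableSpace (Finset (Fin n)) := ⟨fun _ => trivial⟩
      have hq : Measurable fun ω : Sample n => A.query ω.2.1 h :=
        measurable_to_countable' fun S =>
          (measurable_fst.comp measurable_snd) (A.measurable_query h S)
      have key2 : Measurable fun x : (Finset (Fin n) × Fin n) × unitInterval =>
          xor (decide (x.1.2 ∈ x.1.1)) (noiseBit p x.1.1 x.2) :: h := by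
        refine measurable_from_prod_countable_right fun S => ?_
        have hd : Measurable fun b : Bool => xor (decide (S.2 ∈ S.1)) b :: h :=
          measurable_of_finite _
        exact hd.comp (measurable_noiseBit p S.1)
      exact key2.comp ((hq.prodMk measurable_fst).prodMk
        ((measurable_pi_apply t).comp (measurable_snd.comp measurable_snd)))
    exact key.comp (ih.prodMk measurable_id)

/-- The measure of the source of the noise. -/
abbrev noiseLaw : Measure (ℕ → unitInterval) :=
  Measure.infinitePi fun _ : ℕ => (volume : Measure unitInterval)

lemma Strategy.measurable_history_noise (p : ℝ → ℝ) {n : ℕ} (A : Strategy n) (i : Fin n)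
    (w : unitInterval) (t : ℕ) :
    Measurable fun u : ℕ → unitInterval => A.history p (i, w, u) t :=
  (A.measurable_history p t).comp
    (measurable_const.prodMk (measurable_const.prodMk measurable_id))

/-- The first `t` observations depend only on the noise variables with index below `t`, which are
jointly independent of the one with index `t`. -/
lemma Strategy.indepFun_history (p : ℝ → ℝ) {n : ℕ} (A : Strategy n) (i : Fin n)
    (w : unitInterval) (t : ℕ) :
    ProbabilityTheory.IndepFun (fun u : ℕ → unitInterval => A.history p (i, w, u) t)
      (fun u => u t) noiseLaw := by
  have h0 := ProbabilityTheory.iIndepFun_infinitePi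
    (P := fun _ : ℕ => (volume : Measure unitInterval)) (X := fun _ x => x) (fun _ => measurable_id)
  have h1 := h0.indepFun_finset (Finset.range t) {t} (by simp) (fun j => measurable_pi_apply j)
  -- Extends the first `t` noise values by `0`; by `Strategy.history_congr` the filler does not
  -- affect the history up to time `t`.
  let ext : ((Finset.range t) → unitInterval) → (ℕ → unitInterval) :=
    fun x s => if hs : s ∈ Finset.range t then x ⟨s, hs⟩ else 0
  have hext : Measurable ext := by
    refine measurable_pi_lambda _ fun s => ?_
    by_cases hs : s ∈ Finset.range t
    · simp only [ext, hs, dite_true]; exact measurable_pi_apply _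
    · simp only [ext, hs, dite_false]; exact measurable_const
  have h2 : ProbabilityTheory.IndepFun
      ((fun x => A.history p (i, w, ext x) t) ∘
        fun (u : ℕ → unitInterval) (j : Finset.range t) => u j)
      ((fun x : ({t} : Finset ℕ) → unitInterval => x ⟨t, by simp⟩) ∘
        fun (u : ℕ → unitInterval) (j : ({t} : Finset ℕ)) => u j) noiseLaw :=
    h1.comp ((A.measurable_history_noise p i w t).comp hext) (measurable_pi_apply _)
  have h3 : (fun u : ℕ → unitInterval => A.history p (i, w, u) t)
      = (fun x => A.history p (i, w, ext x) t) ∘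
        fun (u : ℕ → unitInterval) (j : Finset.range t) => u j := by
    ext u : 1
    refine A.history_congr p i w fun s hs => ?_
    simp [ext, hs]
  rw [h3]
  exact h2

lemma lintegral_comp_of_indepFun {Ω α β : Type} [MeasurableSpace Ω] [MeasurableSpace α]
    [MeasurableSpace β] {μ : Measure Ω} [IsProbabilityMeasure μ] {X : Ω → α} {Y : Ω → β}
    (hX : Measurable X) (hY : Measurable Y) (hXY : ProbabilityTheory.IndepFun X Y μ)
    {G : α × β → ℝ≥0∞} (hG : Measurable G) :
    ∫⁻ ω, G (X ω, Y ω) ∂μ = ∫⁻ ω, ∫⁻ y, G (X ω, y) ∂(μ.map Y) ∂μ := by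
  have := Measure.isProbabilityMeasure_map (μ := μ) hX.aemeasurable
  have := Measure.isProbabilityMeasure_map (μ := μ) hY.aemeasurable
  rw [← lintegral_map hG (hX.prodMk hY),
    hXY.map_prod_eq_prod_map_map hX.aemeasurable hY.aemeasurable, lintegral_prod _ hG.aemeasurable,
    lintegral_map hG.lintegral_prod_right' hX]

lemma Strategy.lintegral_history_noise (p : ℝ → ℝ) {n : ℕ} (A : Strategy n) (i : Fin n)
    (w : unitInterval) (t : ℕ) {F : List Bool → ℝ} (hF : ∀ h, 0 ≤ F h) :
    ∫⁻ u, ENNReal.ofReal (F (A.history p (i, w, u) t)) ∂noiseLaw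
      = ENNReal.ofReal (steps (A.kernel p w i) t F []) := by
  induction t generalizing F with
  | zero => simp [Strategy.history]
  | succ t ih =>
    have hk := A.isKernel p w i
    have hstep : ∀ h, 0 ≤ step (A.kernel p w i) F h := fun h =>
      Finset.sum_nonneg fun y _ => mul_nonneg (hk.nonneg h y) (hF _)
    rw [steps_succ, ← ih hstep]
    have hX := A.measurable_history_noise p i w t
    have hY : Measurable fun u : ℕ → unitInterval => u t := measurable_pi_apply t
    have hG : Measurable fun x : List Bool × unitInterval => ENNReal.ofReal
        (F (xor (decide (i ∈ A.query w x.1)) (noiseBit p (A.query w x.1) x.2) :: x.1)) := by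
      refine measurable_from_prod_countable_right fun h => ?_
      have hd : Measurable fun b : Bool =>
        ENNReal.ofReal (F (xor (decide (i ∈ A.query w h)) b :: h)) := measurable_of_finite _
      exact hd.comp (measurable_noiseBit p (A.query w h))
    have hI := A.indepFun_history p i w t
    have e1 := lintegral_comp_of_indepFun (μ := noiseLaw) hX hY hI hG
    have e3 : noiseLaw.map (fun u => u t) = volume := Measure.infinitePi_map_eval _ t
    rw [e3] at e1
    have e2 : ∀ u, F (A.history p (i, w, u) (t + 1))
        = F (xor (decide (i ∈ A.query w (A.history p (i, w, u) t)))
          (noiseBit p (A.query w (A.history p (i, w, u) t)) (u t)) :: A.history p (i, w, u) t) :=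
      fun u => by rw [Strategy.history]
    simp only [e2]
    refine e1.trans (lintegral_congr fun u => ?_)
    exact lintegral_noiseBit p (A.query w (A.history p (i, w, u) t))
      (decide (i ∈ A.query w (A.history p (i, w, u) t)))
      (F := fun y => F (y :: A.history p (i, w, u) t)) fun y => hF _

lemma Strategy.measurable_kernel (p : ℝ → ℝ) {n : ℕ} (A : Strategy n) (i : Fin n)
    (h : List Bool) (y : Bool) : Measurable fun w => A.kernel p w i h y := by
  let _ : MeasurableSpace (Finset (Fin n)) := ⊤
  have _ : DiscreteMeasurableSpace (Finset (Fin n)) := ⟨fun _ => trivial⟩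
  have hq : Measurable fun w => A.query w h :=
    measurable_to_countable' fun S => A.measurable_query h S
  have hb : Measurable fun S : Finset (Fin n) => bsc (crossover p S) (decide (i ∈ S)) y :=
    measurable_of_finite _
  exact hb.comp hq

lemma Strategy.measurable_steps (p : ℝ → ℝ) {n : ℕ} (A : Strategy n) (i : Fin n) (t : ℕ)
    {F : unitInterval → List Bool → ℝ} (hF : ∀ h, Measurable fun w => F w h) (h : List Bool) :
    Measurable fun w => steps (A.kernel p w i) t (F w) h := by
  induction t generalizing h with
  | zero => exact hF h
  | succ t ih =>
    simp only [steps_succ', step]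
    exact Finset.measurable_sum _ fun y _ => (A.measurable_kernel p i h y).mul (ih _)

lemma Strategy.measurable_comp_history (p : ℝ → ℝ) {n : ℕ} (A : Strategy n) (t : ℕ)
    {F : Fin n → unitInterval → List Bool → ℝ} (hFm : ∀ i h, Measurable fun w => F i w h) :
    Measurable fun ω : Sample n => F ω.1 ω.2.1 (A.history p ω t) := by
  have key : Measurable fun x : (List Bool × Fin n) × unitInterval => F x.1.2 x.2 x.1.1 :=
    measurable_from_prod_countable_right fun x => hFm x.2 x.1
  exact key.comp (((A.measurable_history p t).prodMk measurable_fst).prodMk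
    (measurable_fst.comp measurable_snd))

lemma lintegral_uniformOn_univ {n : ℕ} (f : Fin n → ℝ≥0∞) :
    ∫⁻ i, f i ∂(ProbabilityTheory.uniformOn (Set.univ : Set (Fin n)))
      = (n : ℝ≥0∞)⁻¹ * ∑ i, f i := by
  rw [ProbabilityTheory.uniformOn, ProbabilityTheory.cond, Measure.restrict_univ,
    lintegral_smul_measure, lintegral_count, tsum_fintype, Measure.count_univ]
  simp

/-- Expectations of functions of the target, the private randomness, and the first `t`
observations. -/
lemma Strategy.lintegral_history (p : ℝ → ℝ) {n : ℕ} [NeZero n] (A : Strategy n) (t : ℕ)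
    {F : Fin n → unitInterval → List Bool → ℝ} (hF : ∀ i w h, 0 ≤ F i w h)
    (hFm : ∀ i h, Measurable fun w => F i w h) :
    ∫⁻ ω, ENNReal.ofReal (F ω.1 ω.2.1 (A.history p ω t)) ∂(law n)
      = (n : ℝ≥0∞)⁻¹ * ∑ i, ∫⁻ w, ENNReal.ofReal (steps (A.kernel p w i) t (F i w) []) := by
  have hm := (A.measurable_comp_history p t hFm).ennreal_ofReal
  rw [law, lintegral_prod _ hm.aemeasurable, lintegral_uniformOn_univ]
  congr 1
  refine Finset.sum_congr rfl fun i _ => ?_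
  have hmi : Measurable fun y : unitInterval × (ℕ → unitInterval) =>
      ENNReal.ofReal (F i y.1 (A.history p (i, y) t)) :=
    hm.comp (measurable_prodMk_left (x := i))
  rw [lintegral_prod _ hmi.aemeasurable]
  refine lintegral_congr fun w => ?_
  exact A.lintegral_history_noise p i w t (hF i w)

/-! ### Stopping -/

/-- The numerical value of a proposition. -/
def ind (P : Prop) : ℝ := open Classical in if P then 1 else 0

lemma ind_of {P : Prop} (h : P) : ind P = 1 := by simp [ind, h]

lemma ind_of_not {P : Prop} (h : ¬ P) : ind P = 0 := by simp [ind, h]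

lemma ind_nonneg (P : Prop) : 0 ≤ ind P := by unfold ind; split_ifs <;> norm_num

lemma ind_le_one (P : Prop) : ind P ≤ 1 := by unfold ind; split_ifs <;> norm_num

lemma measurable_ind {α : Type} [MeasurableSpace α] {P : α → Prop}
    (h : MeasurableSet {a | P a}) : Measurable fun a => ind (P a) := by
  classical
  have : (fun a => ind (P a)) = Set.indicator {a | P a} fun _ => (1 : ℝ) := by
    ext a; simp [ind, Set.indicator]
  rw [this]
  exact measurable_const.indicator h

/-- The search has not ended before the last observation of the history. -/
def Strategy.running {n : ℕ} (A : Strategy n) (w : unitInterval) : List Bool → Prop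
  | [] => True
  | _ :: h => A.running w h ∧ ¬ A.halt w h

/-- The search continues after the history. -/
def Strategy.alive {n : ℕ} (A : Strategy n) (w : unitInterval) (h : List Bool) : Prop :=
  A.running w h ∧ ¬ A.halt w h

/-- The search ends exactly with the history, and bin `i` is declared. -/
def Strategy.declares {n : ℕ} (A : Strategy n) (w : unitInterval) (i : Fin n) (h : List Bool) :
    Prop :=
  A.running w h ∧ A.halt w h ∧ A.estimate w h = i

lemma Strategy.measurableSet_running {n : ℕ} (A : Strategy n) (h : List Bool) :
    MeasurableSet {w | A.running w h} := by
  induction h with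
  | nil => exact MeasurableSet.univ
  | cons y h ih => exact ih.inter (A.measurable_halt h).compl

lemma Strategy.measurableSet_alive {n : ℕ} (A : Strategy n) (h : List Bool) :
    MeasurableSet {w | A.alive w h} :=
  (A.measurableSet_running h).inter (A.measurable_halt h).compl

lemma Strategy.measurableSet_declares {n : ℕ} (A : Strategy n) (i : Fin n) (h : List Bool) :
    MeasurableSet {w | A.declares w i h} :=
  (A.measurableSet_running h).inter ((A.measurable_halt h).inter (A.measurable_estimate h i))

lemma Strategy.running_history_iff (p : ℝ → ℝ) {n : ℕ} (A : Strategy n) (ω : Sample n) (t : ℕ) :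
    A.running ω.2.1 (A.history p ω t) ↔ ∀ s < t, ¬ A.stopsAt p ω s := by
  induction t with
  | zero => simp [Strategy.history, Strategy.running]
  | succ t ih =>
    simp only [Strategy.history, Strategy.running, ih, Nat.lt_succ_iff_lt_or_eq]
    constructor
    · rintro ⟨h1, h2⟩ s (hs | rfl)
      exacts [h1 s hs, h2]
    · exact fun h => ⟨fun s hs => h s (Or.inl hs), h t (Or.inr rfl)⟩

lemma Strategy.alive_history_iff (p : ℝ → ℝ) {n : ℕ} (A : Strategy n) (ω : Sample n) (t : ℕ) :
    A.alive ω.2.1 (A.history p ω t) ↔ ∀ s ≤ t, ¬ A.stopsAt p ω s := by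
  rw [Strategy.alive, A.running_history_iff]
  constructor
  · rintro ⟨h1, h2⟩ s hs
    rcases hs.lt_or_eq with hs | rfl
    exacts [h1 s hs, h2]
  · exact fun h => ⟨fun s hs => h s hs.le, h t le_rfl⟩

/-- The layer formula `τ = ∑ₜ 1(τ > t)`, valid also for `τ = ∞`. It makes `E[τ]` a sum of fixed-time
expectations. -/
lemma Strategy.time_eq_tsum (p : ℝ → ℝ) {n : ℕ} (A : Strategy n) (ω : Sample n) :
    A.time p ω = ∑' t, ENNReal.ofReal (ind (A.alive ω.2.1 (A.history p ω t))) := by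
  classical
  by_cases hex : ∃ t, A.stopsAt p ω t
  · have h1 : A.time p ω = (Nat.find hex : ℝ≥0∞) := by
      refine le_antisymm (iInf₂_le _ (Nat.find_spec hex)) (le_iInf₂ fun t ht => ?_)
      exact_mod_cast Nat.find_min' hex ht
    rw [h1, tsum_eq_sum (s := Finset.range (Nat.find hex))]
    · rw [Finset.sum_congr rfl (g := fun _ => (1 : ℝ≥0∞))]
      · simp
      · intro t ht
        rw [ind_of, ENNReal.ofReal_one]
        rw [A.alive_history_iff]
        exact fun s hs => Nat.find_min hex (lt_of_le_of_lt hs (Finset.mem_range.1 ht))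
    · intro t ht
      rw [ind_of_not, ENNReal.ofReal_zero]
      rw [A.alive_history_iff]
      push Not
      exact ⟨_, not_lt.1 (fun h => ht (Finset.mem_range.2 h)), Nat.find_spec hex⟩
  · have h1 : A.time p ω = ⊤ := by
      rw [Strategy.time]
      simp only [iInf_eq_top]
      exact fun t ht => absurd ⟨t, ht⟩ hex
    have h2 : ∀ t, ENNReal.ofReal (ind (A.alive ω.2.1 (A.history p ω t))) = 1 := by
      intro t
      rw [ind_of, ENNReal.ofReal_one]
      rw [A.alive_history_iff]
      exact fun s _ hs => hex ⟨s, hs⟩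
    simp only [h1, h2]
    exact (ENNReal.tsum_const_eq_top_of_ne_zero one_ne_zero).symm

/-- At most one term is nonzero, because the search stops for the first time only once. The formula
also gives the measurability of the success event. -/
lemma Strategy.indicator_success_eq_tsum (p : ℝ → ℝ) {n : ℕ} (A : Strategy n) (ω : Sample n) :
    (A.success p).indicator (fun _ => (1 : ℝ≥0∞)) ω
      = ∑' t, ENNReal.ofReal (ind (A.declares ω.2.1 ω.1 (A.history p ω t))) := by
  classical
  have key : ∀ t, A.declares ω.2.1 ω.1 (A.history p ω t) ↔
      (∀ s < t, ¬ A.stopsAt p ω s) ∧ A.stopsAt p ω t ∧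
        A.estimate ω.2.1 (A.history p ω t) = ω.1 := fun t => by
    rw [Strategy.declares, A.running_history_iff]; rfl
  by_cases hω : ω ∈ A.success p
  · obtain ⟨t, h1, h2, h3⟩ := hω
    have hmem : ω ∈ A.success p := ⟨t, h1, h2, h3⟩
    rw [Set.indicator_of_mem hmem, tsum_eq_single t, ind_of ((key t).2 ⟨h2, h1, h3⟩),
      ENNReal.ofReal_one]
    intro s hs
    rw [ind_of_not, ENNReal.ofReal_zero]
    rw [key]
    rintro ⟨h4, h5, -⟩
    rcases lt_trichotomy s t with h | h | h
    exacts [h2 s h h5, hs h, h4 t h h1]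
  · rw [Set.indicator_of_notMem hω]
    symm
    rw [ENNReal.tsum_eq_zero]
    intro t
    rw [ind_of_not, ENNReal.ofReal_zero]
    rw [key]
    exact fun ⟨h1, h2, h3⟩ => hω ⟨t, h2, h1, h3⟩

/-- The average over the targets and the private randomness of the conditional expectation of `F`
at time `t`. -/
def Strategy.mean (p : ℝ → ℝ) {n : ℕ} (A : Strategy n) (t : ℕ)
    (F : Fin n → unitInterval → List Bool → ℝ) : ℝ :=
  (n : ℝ)⁻¹ * ∑ i, ∫ w, steps (A.kernel p w i) t (F i w) []

-- Expected time and success probability as sums over times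

lemma IsKernel.steps_mem_Icc {q : List Bool → Bool → ℝ} (hq : IsKernel q) (t : ℕ)
    {F : List Bool → ℝ} (hF : ∀ h, F h ∈ Set.Icc (0 : ℝ) 1) (h : List Bool) :
    steps q t F h ∈ Set.Icc (0 : ℝ) 1 := by
  refine ⟨hq.steps_nonneg t (fun h => (hF h).1) h, ?_⟩
  have := hq.steps_mono t (fun h => (hF h).2) h
  rwa [hq.steps_const] at this

lemma integrable_of_mem_Icc {f : unitInterval → ℝ} (hf : Measurable f)
    (h : ∀ w, f w ∈ Set.Icc (0 : ℝ) 1) : Integrable f :=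
  Integrable.of_bound hf.aestronglyMeasurable 1
    (ae_of_all _ fun w => by rw [Real.norm_of_nonneg (h w).1]; exact (h w).2)

lemma Strategy.integrable_steps (p : ℝ → ℝ) {n : ℕ} (A : Strategy n) (i : Fin n) (t : ℕ)
    {F : unitInterval → List Bool → ℝ} (hF : ∀ w h, F w h ∈ Set.Icc (0 : ℝ) 1)
    (hFm : ∀ h, Measurable fun w => F w h) (h : List Bool) :
    Integrable fun w => steps (A.kernel p w i) t (F w) h :=
  integrable_of_mem_Icc (A.measurable_steps p i t hFm h)
    fun w => (A.isKernel p w i).steps_mem_Icc t (hF w) h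

lemma Strategy.lintegral_history_eq_mean (p : ℝ → ℝ) {n : ℕ} [NeZero n] (A : Strategy n) (t : ℕ)
    {F : Fin n → unitInterval → List Bool → ℝ} (hF : ∀ i w h, F i w h ∈ Set.Icc (0 : ℝ) 1)
    (hFm : ∀ i h, Measurable fun w => F i w h) :
    ∫⁻ ω, ENNReal.ofReal (F ω.1 ω.2.1 (A.history p ω t)) ∂(law n)
      = ENNReal.ofReal (A.mean p t F) := by
  have hn : (0 : ℝ) < n := Nat.cast_pos.2 (NeZero.pos n)
  have hnn : ∀ i w, 0 ≤ steps (A.kernel p w i) t (F i w) [] := fun i w =>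
    ((A.isKernel p w i).steps_mem_Icc t (hF i w) []).1
  rw [A.lintegral_history p t (fun i w h => (hF i w h).1) hFm, Strategy.mean,
    ENNReal.ofReal_mul (by positivity), ENNReal.ofReal_inv_of_pos hn, ENNReal.ofReal_natCast,
    ENNReal.ofReal_sum_of_nonneg fun i _ => integral_nonneg (hnn i)]
  congr 1
  refine Finset.sum_congr rfl fun i _ => ?_
  rw [ofReal_integral_eq_lintegral_ofReal (A.integrable_steps p i t (hF i) (hFm i) [])
    (ae_of_all _ (hnn i))]

lemma ind_mem_Icc (P : Prop) : ind P ∈ Set.Icc (0 : ℝ) 1 := ⟨ind_nonneg P, ind_le_one P⟩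

lemma Strategy.mean_nonneg (p : ℝ → ℝ) {n : ℕ} (A : Strategy n) (t : ℕ)
    {F : Fin n → unitInterval → List Bool → ℝ} (hF : ∀ i w h, 0 ≤ F i w h) :
    0 ≤ A.mean p t F :=
  mul_nonneg (by positivity) (Finset.sum_nonneg fun i _ => integral_nonneg fun w =>
    (A.isKernel p w i).steps_nonneg t (hF i w) [])

lemma Strategy.expectedTime_eq_tsum (p : ℝ → ℝ) {n : ℕ} [NeZero n] (A : Strategy n) :
    A.expectedTime p
      = ∑' t, ENNReal.ofReal (A.mean p t fun _ w h => ind (A.alive w h)) := by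
  have hm : ∀ (i : Fin n) (h : List Bool), Measurable fun w => ind (A.alive w h) :=
    fun _ h => measurable_ind (A.measurableSet_alive h)
  simp only [Strategy.expectedTime, A.time_eq_tsum p]
  rw [lintegral_tsum fun t => ((A.measurable_comp_history p t hm).ennreal_ofReal).aemeasurable]
  congr 1
  ext t
  exact A.lintegral_history_eq_mean p t (F := fun _ w h => ind (A.alive w h))
    (fun _ _ _ => ind_mem_Icc _) hm

lemma Strategy.law_success_eq_tsum (p : ℝ → ℝ) {n : ℕ} [NeZero n] (A : Strategy n) :
    law n (A.success p)
      = ∑' t, ENNReal.ofReal (A.mean p t fun i w h => ind (A.declares w i h)) := by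
  have hm : ∀ (i : Fin n) (h : List Bool), Measurable fun w => ind (A.declares w i h) :=
    fun i h => measurable_ind (A.measurableSet_declares i h)
  have hms : ∀ t, Measurable fun ω : Sample n =>
      ENNReal.ofReal (ind (A.declares ω.2.1 ω.1 (A.history p ω t))) :=
    fun t => (A.measurable_comp_history p t hm).ennreal_ofReal
  have hind : (A.success p).indicator (fun _ => (1 : ℝ≥0∞))
      = fun ω => ∑' t, ENNReal.ofReal (ind (A.declares ω.2.1 ω.1 (A.history p ω t))) :=
    funext (A.indicator_success_eq_tsum p)
  have hsucc : MeasurableSet (A.success p) := by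
    have h1 : Measurable ((A.success p).indicator fun _ => (1 : ℝ≥0∞)) := by
      rw [hind]; exact Measurable.tsum hms
    exact (measurable_indicator_const_iff (1 : ℝ≥0∞)).1 h1
  rw [← lintegral_indicator_one hsucc]
  change ∫⁻ ω, (A.success p).indicator (fun _ => (1 : ℝ≥0∞)) ω ∂(law n) = _
  rw [hind, lintegral_tsum fun t => (hms t).aemeasurable]
  congr 1
  ext t
  exact A.lintegral_history_eq_mean p t (F := fun i w h => ind (A.declares w i h))
    (fun _ _ _ => ind_mem_Icc _) hm

lemma Strategy.sum_mean_alive_le (p : ℝ → ℝ) {n : ℕ} [NeZero n] (A : Strategy n) (T : ℕ) :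
    ENNReal.ofReal (∑ t ∈ Finset.range T, A.mean p t fun _ w h => ind (A.alive w h))
      ≤ A.expectedTime p := by
  rw [A.expectedTime_eq_tsum, ENNReal.ofReal_sum_of_nonneg
    fun t _ => A.mean_nonneg p t fun _ _ _ => ind_nonneg _]
  exact ENNReal.sum_le_tsum _

lemma Strategy.expectedTime_le (p : ℝ → ℝ) {n : ℕ} [NeZero n] (A : Strategy n) {B : ℝ}
    (hB : ∀ T, ∑ t ∈ Finset.range T, A.mean p t (fun _ w h => ind (A.alive w h)) ≤ B) :
    A.expectedTime p ≤ ENNReal.ofReal B := by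
  rw [A.expectedTime_eq_tsum, ENNReal.tsum_eq_iSup_nat]
  refine iSup_le fun T => ?_
  rw [← ENNReal.ofReal_sum_of_nonneg fun t _ => A.mean_nonneg p t fun _ _ _ => ind_nonneg _]
  exact ENNReal.ofReal_le_ofReal (hB T)

lemma Strategy.Reliable.exists_sum_mean {p : ℝ → ℝ} {n : ℕ} [NeZero n] {A : Strategy n} {ε : ℝ}
    (hA : A.Reliable p ε) {c : ℝ} (hc : c < 1 - ε) :
    ∃ T, c ≤ ∑ t ∈ Finset.range T, A.mean p t fun i w h => ind (A.declares w i h) := by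
  rcases le_or_gt c 0 with h0 | h0
  · exact ⟨0, by simpa using h0⟩
  have h1 : ENNReal.ofReal c < ENNReal.ofReal (1 - ε) :=
    (ENNReal.ofReal_lt_ofReal_iff (h0.trans hc)).2 hc
  have h2 := h1.trans_le hA
  rw [A.law_success_eq_tsum, ENNReal.tsum_eq_iSup_nat, lt_iSup_iff] at h2
  obtain ⟨T, hT⟩ := h2
  refine ⟨T, ?_⟩
  have hnn : ∀ t, 0 ≤ A.mean p t fun i w h => ind (A.declares w i h) :=
    fun t => A.mean_nonneg p t fun _ _ _ => ind_nonneg _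
  rw [← ENNReal.ofReal_sum_of_nonneg fun t _ => hnn t] at hT
  exact (ENNReal.ofReal_le_ofReal_iff (Finset.sum_nonneg fun t _ => hnn t)).1 hT.le

lemma Strategy.reliable_of_sum_mean {p : ℝ → ℝ} {n : ℕ} [NeZero n] {A : Strategy n} {ε : ℝ}
    (h : ∀ c < 1 - ε,
      ∃ T, c ≤ ∑ t ∈ Finset.range T, A.mean p t fun i w h => ind (A.declares w i h)) :
    A.Reliable p ε := by
  have hnn : ∀ t, 0 ≤ A.mean p t fun i w h => ind (A.declares w i h) :=
    fun t => A.mean_nonneg p t fun _ _ _ => ind_nonneg _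
  have key : ∀ c < 1 - ε, ENNReal.ofReal c ≤ law n (A.success p) := by
    intro c hc
    obtain ⟨T, hT⟩ := h c hc
    rw [A.law_success_eq_tsum]
    refine le_trans (ENNReal.ofReal_le_ofReal hT) ?_
    rw [ENNReal.ofReal_sum_of_nonneg fun t _ => hnn t]
    exact ENNReal.sum_le_tsum _
  have hlim : Tendsto (fun c => ENNReal.ofReal c) (𝓝[<] (1 - ε)) (𝓝 (ENNReal.ofReal (1 - ε))) :=
    (ENNReal.continuous_ofReal.tendsto _).mono_left nhdsWithin_le_nhds
  exact le_of_tendsto hlim (eventually_nhdsWithin_of_forall key)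

/-! ### The converse -/

lemma steps_eq_zero_of_not_running {q : List Bool → Bool → ℝ} {run : List Bool → Prop}
    (hrun : ∀ y h, run (y :: h) → run h) {F : List Bool → ℝ} (hF : ∀ h, ¬ run h → F h = 0)
    (t : ℕ) {h : List Bool} (hh : ¬ run h) : steps q t F h = 0 := by
  induction t generalizing h with
  | zero => exact hF h hh
  | succ t ih =>
    rw [steps_succ', step]
    exact Finset.sum_eq_zero fun y _ => by rw [ih fun h' => hh (hrun y h h'), mul_zero]

/-- Change of measure on a stopped tree: if each observation of the process `P` distinguishes it
from `Q` by at most `C` nats, then the expected number of observations is large if the final event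
has large `P`-probability and small `Q`-probability. -/
lemma change_of_measure {P Q : List Bool → Bool → ℝ} (hP : IsKernel P) (hQ : IsKernel Q)
    {run halt good : List Bool → Prop} (hrun : ∀ y h, run (y :: h) ↔ run h ∧ ¬ halt h)
    {C : ℝ} (hC : 0 ≤ C)
    (hPQ : ∀ h, (∀ y, P h y = Q h y) ∨ ((∀ y, 0 < P h y) ∧ (∀ y, 0 < Q h y) ∧
      KL (P h) (Q h) ≤ C)) (c : ℝ) (T : ℕ) (h : List Bool) (d : ℝ) :
    c * ∑ t ∈ Finset.range T, steps P t (fun h => ind (run h ∧ halt h ∧ good h)) h + d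
      - Real.exp d * (1 + (Real.exp c - 1) *
          ∑ t ∈ Finset.range T, steps Q t (fun h => ind (run h ∧ halt h ∧ good h)) h) + 1
      ≤ C * ∑ t ∈ Finset.range T, steps P t (fun h => ind (run h ∧ ¬ halt h)) h := by
  -- Here `d` is the accumulated log-likelihood ratio of `Q` to `P`. The expression `d - exp d * x +
  -- 1` is a tangent-line version of `-log x`: its supremum over `d` is `-log x`, and it has the
  -- advantage of being linear in the `Q`-probability, so that it propagates through the tree.
  induction T generalizing h d with
  | zero =>
    have := Real.add_one_le_exp d
    simp only [Finset.range_zero, Finset.sum_empty]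
    nlinarith
  | succ T ih =>
    simp only [sum_steps_succ]
    by_cases hh : run h ∧ ¬ halt h
    · rw [ind_of hh, ind_of_not (P := run h ∧ halt h ∧ good h) fun h' => hh.2 h'.2.1]
      set a := fun y => ∑ t ∈ Finset.range T,
        steps P t (fun h => ind (run h ∧ halt h ∧ good h)) (y :: h) with ha
      set b := fun y => ∑ t ∈ Finset.range T,
        steps Q t (fun h => ind (run h ∧ halt h ∧ good h)) (y :: h) with hb
      set m := fun y => ∑ t ∈ Finset.range T,
        steps P t (fun h => ind (run h ∧ ¬ halt h)) (y :: h) with hm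
      have hsum := hP.sum_eq_one h
      rcases hPQ h with heq | ⟨hp, hq, hKL⟩
      · have key : ∑ y, P h y * (c * a y + d - Real.exp d * (1 + (Real.exp c - 1) * b y) + 1)
            ≤ ∑ y, P h y * (C * m y) :=
          Finset.sum_le_sum fun y _ => mul_le_mul_of_nonneg_left (ih (y :: h) d) (hP.nonneg h y)
        simp only [← heq]
        simp only [Fintype.sum_bool] at key hsum ⊢
        have e : P h false = 1 - P h true := by linarith
        rw [e] at key ⊢
        nlinarith
      -- At the child `y` the induction hypothesis is used with `d` shifted by the log-likelihood
      -- ratio of `y`. The exponential turns the weight `P h y` into `exp d * Q h y`, and the shift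
      -- averages to minus the divergence, which is at least `-C`.
      · have key : ∑ y, P h y * (c * a y + (d + Real.log (Q h y / P h y))
              - Real.exp (d + Real.log (Q h y / P h y)) * (1 + (Real.exp c - 1) * b y) + 1)
            ≤ ∑ y, P h y * (C * m y) :=
          Finset.sum_le_sum fun y _ => mul_le_mul_of_nonneg_left (ih (y :: h) _) (hP.nonneg h y)
        have hexp : ∀ y, P h y * (c * a y + (d + Real.log (Q h y / P h y))
              - Real.exp (d + Real.log (Q h y / P h y)) * (1 + (Real.exp c - 1) * b y) + 1)
            = c * (P h y * a y) + P h y * d - P h y * Real.log (P h y / Q h y)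
              - Real.exp d * Q h y - Real.exp d * (Real.exp c - 1) * (Q h y * b y) + P h y := by
          intro y
          have h1 := hp y
          have h2 := hq y
          rw [Real.exp_add, Real.exp_log (div_pos h2 h1), ← inv_div (P h y) (Q h y), Real.log_inv]
          field_simp
          ring
        simp only [hexp, KL, Fintype.sum_bool] at key hKL hsum ⊢
        have hsumQ : ∑ y, Q h y = 1 := hQ.sum_eq_one h
        rw [Fintype.sum_bool] at hsumQ
        have e : P h false = 1 - P h true := by linarith
        have e' : Q h false = 1 - Q h true := by linarith
        rw [e, e'] at key ⊢
        rw [e, e'] at hKL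
        nlinarith
    · have hz : ∀ y, ¬ run (y :: h) := fun y hy => hh ((hrun y h).1 hy)
      have hr : ∀ y h, run (y :: h) → run h := fun y h hy => ((hrun y h).1 hy).1
      have z1 : ∀ (q : List Bool → Bool → ℝ) t y,
          steps q t (fun h => ind (run h ∧ halt h ∧ good h)) (y :: h) = 0 := fun q t y =>
        steps_eq_zero_of_not_running hr (fun h hh => ind_of_not fun h' => hh h'.1) t (hz y)
      have z2 : ∀ t y, steps P t (fun h => ind (run h ∧ ¬ halt h)) (y :: h) = 0 := fun t y =>
        steps_eq_zero_of_not_running hr (fun h hh => ind_of_not fun h' => hh h'.1) t (hz y)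
      simp only [z1, z2, ind_of_not hh, Finset.sum_const_zero, mul_zero, add_zero]
      -- Nothing happens below `h` any more; what remains is `x + 1 ≤ exp x`, at `x = d + c` if the
      -- end is good and at `x = d` otherwise.
      by_cases hg : run h ∧ halt h ∧ good h
      · rw [ind_of hg]
        have := Real.add_one_le_exp (d + c)
        rw [Real.exp_add] at this
        nlinarith
      · rw [ind_of_not hg]
        have := Real.add_one_le_exp d
        nlinarith

-- Averaging the comparison over targets and private randomness

lemma Strategy.sum_mean (p : ℝ → ℝ) {n : ℕ} (A : Strategy n) (T : ℕ)
    {F : Fin n → unitInterval → List Bool → ℝ} (hF : ∀ i w h, F i w h ∈ Set.Icc (0 : ℝ) 1)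
    (hFm : ∀ i h, Measurable fun w => F i w h) :
    ∑ t ∈ Finset.range T, A.mean p t F
      = (n : ℝ)⁻¹ * ∑ i, ∫ w, ∑ t ∈ Finset.range T, steps (A.kernel p w i) t (F i w) [] := by
  simp only [Strategy.mean]
  rw [← Finset.mul_sum, Finset.sum_comm]
  congr 1
  refine Finset.sum_congr rfl fun i _ => ?_
  rw [integral_finsetSum _ fun t _ => A.integrable_steps p i t (hF i) (hFm i) []]

lemma Strategy.mul_sum_mean_declares_sub_le {p : ℝ → ℝ} {n : ℕ} (A : Strategy n) (T : ℕ)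
    {α β C : ℝ}
    (h : ∀ w,
      α * ((n : ℝ)⁻¹ * ∑ i, ∑ t ∈ Finset.range T,
        steps (A.kernel p w i) t (fun h => ind (A.declares w i h)) []) - β
      ≤ C * ((n : ℝ)⁻¹ * ∑ i, ∑ t ∈ Finset.range T,
        steps (A.kernel p w i) t (fun h => ind (A.alive w h)) [])) :
    α * ∑ t ∈ Finset.range T, A.mean p t (fun i w h => ind (A.declares w i h)) - β
      ≤ C * ∑ t ∈ Finset.range T, A.mean p t (fun _ w h => ind (A.alive w h)) := by
  have hm1 : ∀ (i : Fin n) (h : List Bool), Measurable fun w => ind (A.declares w i h) :=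
    fun i h => measurable_ind (A.measurableSet_declares i h)
  have hm2 : ∀ (i : Fin n) (h : List Bool), Measurable fun w => ind (A.alive w h) :=
    fun _ h => measurable_ind (A.measurableSet_alive h)
  have i1 : ∀ i, Integrable fun w => ∑ t ∈ Finset.range T,
      steps (A.kernel p w i) t (fun h => ind (A.declares w i h)) [] := fun i =>
    integrable_finsetSum _ fun t _ =>
      A.integrable_steps p i t (fun _ _ => ind_mem_Icc _) (hm1 i) []
  have i2 : ∀ i, Integrable fun w => ∑ t ∈ Finset.range T,
      steps (A.kernel p w i) t (fun h => ind (A.alive w h)) [] := fun i =>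
    integrable_finsetSum _ fun t _ =>
      A.integrable_steps p i t (fun _ _ => ind_mem_Icc _) (hm2 i) []
  rw [A.sum_mean p T (F := fun i w h => ind (A.declares w i h)) (fun _ _ _ => ind_mem_Icc _) hm1,
    A.sum_mean p T (F := fun _ w h => ind (A.alive w h)) (fun _ _ _ => ind_mem_Icc _) hm2,
    ← integral_finsetSum _ fun i _ => i1 i, ← integral_finsetSum _ fun i _ => i2 i,
    ← integral_const_mul, ← integral_const_mul, ← integral_const_mul, ← integral_const_mul]
  have hβ : β = ∫ _ : unitInterval, β := by simp
  rw [hβ, ← integral_sub]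
  · refine integral_mono ?_ ?_ h
    · exact (((integrable_finsetSum _ fun i _ => i1 i).const_mul _).const_mul _).sub
        (integrable_const _)
    · exact ((integrable_finsetSum _ fun i _ => i2 i).const_mul _).const_mul _
  · exact ((integrable_finsetSum _ fun i _ => i1 i).const_mul _).const_mul _
  · exact integrable_const _

/-- Both converses are proved for each seed `w` and each horizon `T` as an inequality linear in
success and time; linearity lets it pass to the average over seeds. -/
lemma Strategy.Reliable.le_expectedTime {p : ℝ → ℝ} {n : ℕ} [NeZero n] {A : Strategy n} {ε : ℝ}
    (hA : A.Reliable p ε) {α β C : ℝ} (hα : 0 ≤ α) (hC : 0 < C)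
    (h : ∀ T w,
      α * ((n : ℝ)⁻¹ * ∑ i, ∑ t ∈ Finset.range T,
        steps (A.kernel p w i) t (fun h => ind (A.declares w i h)) []) - β
      ≤ C * ((n : ℝ)⁻¹ * ∑ i, ∑ t ∈ Finset.range T,
        steps (A.kernel p w i) t (fun h => ind (A.alive w h)) [])) :
    ENNReal.ofReal ((α * (1 - ε) - β) / C) ≤ A.expectedTime p := by
  have key : ∀ c < 1 - ε, ENNReal.ofReal ((α * c - β) / C) ≤ A.expectedTime p := by
    intro c hc
    obtain ⟨T, hT⟩ := hA.exists_sum_mean hc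
    refine le_trans (ENNReal.ofReal_le_ofReal ?_) (A.sum_mean_alive_le p T)
    rw [div_le_iff₀ hC]
    have h1 := A.mul_sum_mean_declares_sub_le T (h T)
    have h2 := mul_le_mul_of_nonneg_left hT hα
    linarith
  -- A finite horizon is only guaranteed to reach success probabilities strictly below `1 - ε`, so
  -- the bound is obtained for these and carried to the limit.
  have hlim : Tendsto (fun c => ENNReal.ofReal ((α * c - β) / C)) (𝓝[<] (1 - ε))
      (𝓝 (ENNReal.ofReal ((α * (1 - ε) - β) / C))) := by
    have : Continuous fun c => ENNReal.ofReal ((α * c - β) / C) :=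
      ENNReal.continuous_ofReal.comp (by fun_prop)
    exact (this.tendsto _).mono_left nhdsWithin_le_nhds
  exact le_of_tendsto hlim (eventually_nhdsWithin_of_forall key)

/-- For any process of observations, the search ends at most once. -/
lemma IsKernel.sum_steps_halt_le {q : List Bool → Bool → ℝ} (hq : IsKernel q) {n : ℕ}
    (A : Strategy n) (w : unitInterval) (T : ℕ) :
    ∑ t ∈ Finset.range T, steps q t (fun h => ind (A.running w h ∧ A.halt w h)) [] ≤ 1 := by
  have hV : ∀ h, step q (fun h => ind (A.running w h)) h + ind (A.running w h ∧ A.halt w h)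
      ≤ ind (A.running w h) := by
    intro h
    have h1 : step q (fun h => ind (A.running w h)) h = ind (A.running w h ∧ ¬ A.halt w h) := by
      simp only [step, Strategy.running, ← Finset.sum_mul, hq.sum_eq_one, one_mul]
    rw [h1]
    by_cases hr : A.running w h <;> by_cases hh : A.halt w h <;> simp [ind, hr, hh]
  have := hq.sum_steps_le_of_bound hV (fun h => ind_nonneg _) T []
  have h2 := ind_le_one (A.running w [])
  linarith

lemma steps_sum {ι : Type} {q : List Bool → Bool → ℝ} (s : Finset ι) (t : ℕ)
    (F : ι → List Bool → ℝ) (h : List Bool) :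
    ∑ i ∈ s, steps q t (F i) h = steps q t (fun h => ∑ i ∈ s, F i h) h := by
  induction t generalizing h with
  | zero => rfl
  | succ t ih =>
    simp only [steps_succ', step]
    rw [Finset.sum_comm]
    refine Finset.sum_congr rfl fun y _ => ?_
    rw [← Finset.mul_sum, ih]

lemma sum_ind_declares {n : ℕ} (A : Strategy n) (w : unitInterval) (h : List Bool) :
    ∑ i, ind (A.declares w i h) = ind (A.running w h ∧ A.halt w h) := by
  by_cases hh : A.running w h ∧ A.halt w h
  · rw [Finset.sum_eq_single (A.estimate w h), ind_of hh, ind_of ⟨hh.1, hh.2, rfl⟩]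
    · exact fun i _ hi => ind_of_not fun h' => hi h'.2.2.symm
    · simp
  · rw [ind_of_not hh]
    exact Finset.sum_eq_zero fun i _ => ind_of_not fun h' => hh ⟨h'.1, h'.2.1⟩

/-- For any process of observations, the probabilities of declaring the bins sum to at most `1`. -/
lemma IsKernel.sum_sum_declares_le {q : List Bool → Bool → ℝ} (hq : IsKernel q) {n : ℕ}
    (A : Strategy n) (w : unitInterval) (T : ℕ) :
    ∑ i, ∑ t ∈ Finset.range T, steps q t (fun h => ind (A.declares w i h)) [] ≤ 1 := by
  rw [Finset.sum_comm]
  refine le_trans (le_of_eq ?_) (hq.sum_steps_halt_le A w T)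
  refine Finset.sum_congr rfl fun t _ => ?_
  rw [steps_sum]
  simp only [sum_ind_declares]

/-- Comparison of the law of the observations for target `i` with a process `Q`. -/
lemma Strategy.sum_declares_sub_le (p : ℝ → ℝ) {n : ℕ} (A : Strategy n) (w : unitInterval)
    (i : Fin n) {Q : List Bool → Bool → ℝ} (hQ : IsKernel Q) {C : ℝ} (hC : 0 ≤ C)
    (hPQ : ∀ h, (∀ y, A.kernel p w i h y = Q h y) ∨
      ((∀ y, 0 < A.kernel p w i h y) ∧ (∀ y, 0 < Q h y) ∧ KL (A.kernel p w i h) (Q h) ≤ C))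
    (c : ℝ) (T : ℕ) :
    c * ∑ t ∈ Finset.range T, steps (A.kernel p w i) t (fun h => ind (A.declares w i h)) []
      - (Real.exp c - 1) *
        ∑ t ∈ Finset.range T, steps Q t (fun h => ind (A.declares w i h)) []
      ≤ C * ∑ t ∈ Finset.range T, steps (A.kernel p w i) t (fun h => ind (A.alive w h)) [] := by
  have := change_of_measure (A.isKernel p w i) hQ (run := A.running w) (halt := A.halt w)
    (good := fun h => A.estimate w h = i) (fun _ _ => Iff.rfl) hC hPQ c T [] 0
  simp only [Real.exp_zero] at this
  simp only [Strategy.declares, Strategy.alive]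
  linarith

/-! ### Information quantities of binary symmetric channels -/

lemma KL_nonneg {P Q : Bool → ℝ} (hP : ∀ y, 0 < P y) (hQ : ∀ y, 0 < Q y)
    (hPs : ∑ y, P y = 1) (hQs : ∑ y, Q y = 1) : 0 ≤ KL P Q := by
  have key : ∀ y, P y - Q y ≤ P y * Real.log (P y / Q y) := by
    intro y
    have h1 := Real.log_le_sub_one_of_pos (div_pos (hQ y) (hP y))
    have h2 := mul_le_mul_of_nonneg_left h1 (hP y).le
    rw [mul_sub, mul_div_cancel₀ _ (hP y).ne', ← inv_div, Real.log_inv] at h2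
    linarith
  have := Finset.sum_le_sum fun y (_ : y ∈ Finset.univ) => key y
  rw [Finset.sum_sub_distrib, hPs, hQs, sub_self] at this
  exact this

lemma KL_pos {P Q : Bool → ℝ} (hP : ∀ y, 0 < P y) (hQ : ∀ y, 0 < Q y)
    (hPs : ∑ y, P y = 1) (hQs : ∑ y, Q y = 1) (hne : ∀ y, P y ≠ Q y) : 0 < KL P Q := by
  have key : ∀ y, P y - Q y < P y * Real.log (P y / Q y) := by
    intro y
    have h1 := Real.log_lt_sub_one_of_pos (div_pos (hQ y) (hP y))
      fun h => hne y ((div_eq_one_iff_eq (hP y).ne').1 h).symm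
    have h2 := mul_lt_mul_of_pos_left h1 (hP y)
    rw [mul_sub, mul_div_cancel₀ _ (hP y).ne', ← inv_div, Real.log_inv] at h2
    linarith
  have := Finset.sum_lt_sum_of_nonempty (s := Finset.univ) Finset.univ_nonempty
    fun y _ => key y
  rw [Finset.sum_sub_distrib, hPs, hQs, sub_self] at this
  exact this

lemma IsNoiseProfile.half_mem {p : ℝ → ℝ} (hp : IsNoiseProfile p) :
    p (1 / 2) ∈ Set.Ioo (0 : ℝ) (1 / 2) := hp.mem _ ⟨by norm_num, by norm_num⟩

/-- The first entry of the maximum is already positive: `p(1/2) < 1/2` makes the two Bernoulli laws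
differ at both outcomes. -/
lemma Ks_pos {p : ℝ → ℝ} (hp : IsNoiseProfile p) : 0 < Ks p := by
  obtain ⟨h0, h1⟩ := hp.half_mem
  refine lt_max_of_lt_left (mul_pos (by norm_num) (KL_pos ?_ ?_ ?_ ?_ ?_))
  · intro y; cases y <;> simp [mix, bern] <;> linarith
  · intro y; cases y <;> simp [bern] <;> linarith
  · simp [mix, bern]; ring
  · simp [bern]
  · intro y; cases y <;> simp [mix, bern] <;> intro h <;> linarith

lemma infoBSC_half {a : ℝ} (h0 : 0 ≤ a) (h1 : a < 1) :
    infoBSC (1 / 2) a = Real.log 2 - Real.binEntropy a := by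
  have hl : ∀ b : ℝ, 0 ≤ b →
      1 / 2 * b * Real.log (1 / 2 * b / (1 / 2 * (1 / 2)))
        = 1 / 2 * (b * Real.log 2 + b * Real.log b) := by
    intro b hb
    rcases hb.eq_or_lt with rfl | hb
    -- The value `b = 0` is needed because `p_min` may vanish.
    · simp
    · rw [show 1 / 2 * b / (1 / 2 * (1 / 2)) = 2 * b by ring, Real.log_mul two_ne_zero hb.ne']
      ring
  have e : infoBSC (1 / 2) a = ∑ x, ∑ y, 1 / 2 * bsc a x y *
      Real.log (1 / 2 * bsc a x y / (1 / 2 * (1 / 2))) := by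
    simp only [infoBSC, mutualInfo]
    refine Finset.sum_congr rfl fun x _ => Finset.sum_congr rfl fun y _ => ?_
    have hb : ∀ x, bern (1 / 2) x = 1 / 2 := by intro x; cases x <;> norm_num [bern]
    simp only [hb, ← Finset.mul_sum, sum_bsc, mul_one]
    have : ∑ i, bsc a i y = 1 := by cases y <;> simp [bsc]
    rw [this]
    norm_num
  rw [e]
  simp only [Fintype.sum_bool, bsc, Bool.false_eq_true, Bool.true_eq_false, if_true, if_false]
  rw [hl _ h0, hl _ (by linarith), Real.binEntropy_eq_negMulLog_add_negMulLog_one_sub]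
  simp only [Real.negMulLog]
  ring

lemma infoBSC_half_anti {a b : ℝ} (h0 : 0 ≤ a) (hab : a ≤ b) (h1 : b ≤ 1 / 2) :
    infoBSC (1 / 2) b ≤ infoBSC (1 / 2) a := by
  rw [infoBSC_half h0 (by linarith), infoBSC_half (by linarith) (by linarith)]
  have := Real.binEntropy_strictMonoOn.monotoneOn (a := a) (b := b) ⟨h0, by norm_num; linarith⟩
    ⟨by linarith, by norm_num; linarith⟩ hab
  linarith

lemma infoBSC_half_pos {a : ℝ} (h0 : 0 ≤ a) (h1 : a < 1 / 2) : 0 < infoBSC (1 / 2) a := by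
  rw [infoBSC_half h0 (by linarith)]
  have := Real.binEntropy_lt_log_two (p := a).2 (by norm_num; linarith)
  linarith

lemma C1_eq (a : ℝ) :
    C1 a = (1 - 2 * a) * Real.log ((1 - a) / a) := by
  simp only [C1, KL, bern, Fintype.sum_bool, Bool.false_eq_true, if_true, if_false, sub_sub_cancel]
  rw [← inv_div (1 - a) a, Real.log_inv]
  ring

lemma log_odds_pos {a : ℝ} (h0 : 0 < a) (h1 : a < 1 / 2) : 0 < Real.log ((1 - a) / a) :=
  Real.log_pos (by rw [one_lt_div h0]; linarith)

lemma log_odds_anti {a b : ℝ} (h0 : 0 < a) (hab : a ≤ b) (h1 : b < 1) :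
    Real.log ((1 - b) / b) ≤ Real.log ((1 - a) / a) :=
  Real.log_le_log (div_pos (by linarith) (by linarith))
    (div_le_div₀ (by linarith) (by linarith) h0 hab)

lemma C1_pos {a : ℝ} (h0 : 0 < a) (h1 : a < 1 / 2) : 0 < C1 a := by
  rw [C1_eq]
  exact mul_pos (by linarith) (log_odds_pos h0 h1)

lemma C1_anti {a b : ℝ} (h0 : 0 < a) (hab : a ≤ b) (h1 : b < 1 / 2) : C1 b ≤ C1 a := by
  rw [C1_eq, C1_eq]
  exact mul_le_mul (by linarith) (log_odds_anti h0 hab (by linarith))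
    (log_odds_pos (by linarith) h1).le (by linarith)

lemma KL_bsc_not (a : ℝ) (s : Bool) : KL (bsc a s) (bsc a !s) = C1 a := by
  rw [C1_eq]
  cases s <;>
  · simp only [KL, bsc, Fintype.sum_bool, Bool.false_eq_true, Bool.true_eq_false, if_true, if_false,
      Bool.not_true, Bool.not_false]
    rw [← inv_div (1 - a) a, Real.log_inv]
    ring

/-- A uniform input makes the output a fair coin, and by symmetry both inputs are equally far from
it; so the mutual information is the divergence for either input. -/
lemma KL_bsc_coin {a : ℝ} (h0 : 0 < a) (h1 : a < 1) (s : Bool) :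
    KL (bsc a s) (fun _ => 1 / 2) = infoBSC (1 / 2) a := by
  have hb : 0 < 1 - a := by linarith
  rw [infoBSC_half h0.le h1, Real.binEntropy_eq_negMulLog_add_negMulLog_one_sub]
  simp only [Real.negMulLog]
  have e : ∀ b : ℝ, 0 < b → Real.log (b / (1 / 2)) = Real.log b + Real.log 2 := by
    intro b hb
    rw [show b / (1 / 2) = b * 2 by ring, Real.log_mul hb.ne' two_ne_zero]
  cases s <;>
  · simp only [KL, bsc, Fintype.sum_bool, Bool.false_eq_true, Bool.true_eq_false, if_true, if_false]
    rw [e _ h0, e _ hb]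
    ring

lemma bsc_pos {a : ℝ} (h0 : 0 < a) (h1 : a < 1) (s y : Bool) : 0 < bsc a s y := by
  unfold bsc; split_ifs <;> linarith

/-! ### The noise profile -/

variable {p : ℝ → ℝ}

lemma IsNoiseProfile.bddBelow (hp : IsNoiseProfile p) : BddBelow (p '' Set.Ioo 0 1) :=
  ⟨0, by rintro _ ⟨x, hx, rfl⟩; exact (hp.mem x hx).1.le⟩

lemma IsNoiseProfile.pMin_le (hp : IsNoiseProfile p) {x : ℝ} (hx : x ∈ Set.Ioo (0 : ℝ) 1) :
    pMin p ≤ p x := csInf_le hp.bddBelow ⟨x, hx, rfl⟩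

lemma IsNoiseProfile.pMin_nonneg (hp : IsNoiseProfile p) : 0 ≤ pMin p :=
  le_csInf ⟨_, 1 / 2, ⟨by norm_num, by norm_num⟩, rfl⟩
    (by rintro _ ⟨x, hx, rfl⟩; exact (hp.mem x hx).1.le)

lemma IsNoiseProfile.pMin_lt (hp : IsNoiseProfile p) : pMin p < 1 / 2 :=
  (hp.pMin_le ⟨by norm_num, by norm_num⟩).trans_lt hp.half_mem.2

lemma IsNoiseProfile.info_pMin_pos (hp : IsNoiseProfile p) : 0 < infoBSC (1 / 2) (pMin p) :=
  infoBSC_half_pos hp.pMin_nonneg hp.pMin_lt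

lemma inv_nat_mem {n : ℕ} (hn : 2 ≤ n) : 1 / (n : ℝ) ∈ Set.Ioo (0 : ℝ) 1 := by
  have : (2 : ℝ) ≤ n := by exact_mod_cast hn
  exact ⟨by positivity, by rw [div_lt_one] <;> linarith⟩

lemma card_div_mem {n : ℕ} {S : Finset (Fin n)} (h0 : S.Nonempty) (h1 : S ≠ Finset.univ) :
    (S.card : ℝ) / n ∈ Set.Ioo (0 : ℝ) 1 := by
  have hc : 0 < S.card := h0.card_pos
  have hc' : S.card < n := by
    simpa using Finset.card_lt_card (Finset.ssubset_univ_iff.2 h1)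
  have hn : (0 : ℝ) < n := by exact_mod_cast hc.trans hc'
  exact ⟨div_pos (by exact_mod_cast hc) hn, by rw [div_lt_one hn]; exact_mod_cast hc'⟩

lemma IsNoiseProfile.noiseLevel_mem (hp : IsNoiseProfile p) {n : ℕ} {S : Finset (Fin n)}
    (h0 : S.Nonempty) (h1 : S ≠ Finset.univ) : noiseLevel p S ∈ Set.Ioo (0 : ℝ) (1 / 2) :=
  hp.mem _ (card_div_mem h0 h1)

lemma IsNoiseProfile.crossover_eq (hp : IsNoiseProfile p) {n : ℕ} {S : Finset (Fin n)}
    (h0 : S.Nonempty) (h1 : S ≠ Finset.univ) : crossover p S = noiseLevel p S := by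
  have := hp.noiseLevel_mem h0 h1
  rw [crossover, min_eq_right (by linarith [this.2]), max_eq_right this.1.le]

lemma IsNoiseProfile.le_noiseLevel (hp : IsNoiseProfile p) {n : ℕ} (hn : 2 ≤ n)
    {S : Finset (Fin n)} (h0 : S.Nonempty) (h1 : S ≠ Finset.univ) :
    p (1 / (n : ℝ)) ≤ noiseLevel p S := by
  refine hp.mono (inv_nat_mem hn) (card_div_mem h0 h1) ?_
  have : (1 : ℝ) ≤ S.card := by exact_mod_cast h0.card_pos
  gcongr

/-! ### Converse bounds -/

lemma isKernel_bsc_of {f : List Bool → ℝ} {s : List Bool → Bool} (h0 : ∀ h, 0 ≤ f h)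
    (h1 : ∀ h, f h ≤ 1) : IsKernel fun h y => bsc (f h) (s h) y :=
  ⟨fun h _ => bsc_nonneg (h0 h) (h1 h) _ _, fun _ => sum_bsc _ _⟩

theorem IsNoiseProfile.rate_converse (hp : IsNoiseProfile p) {n : ℕ} (hn : 2 ≤ n)
    (A : Strategy n) {ε : ℝ} (hA : A.Reliable p ε) :
    ENNReal.ofReal ((Real.log n * (1 - ε) - 1) / infoBSC (1 / 2) (pMin p))
      ≤ A.expectedTime p := by
  classical
  have : NeZero n := ⟨by omega⟩
  have hn0 : (0 : ℝ) < n := by positivity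
  have hlog : 0 ≤ Real.log n := Real.log_natCast_nonneg n
  refine hA.le_expectedTime hlog hp.info_pMin_pos fun T w => ?_
  -- A process that knows nothing about the target: a fair coin for informative queries, and the
  -- true answer law for the empty and the full query, where that law is the same for all targets.
  let Q : List Bool → Bool → ℝ := fun h y =>
    bsc (if A.query w h = ∅ ∨ A.query w h = Finset.univ then crossover p (A.query w h) else 1 / 2)
      (decide (A.query w h = Finset.univ)) y
  have hQ : IsKernel Q := isKernel_bsc_of
    (fun h => by split_ifs; exacts [crossover_nonneg _ _, by norm_num])
    (fun h => by split_ifs; exacts [crossover_le_one _ _, by norm_num])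
  have key : ∀ i, _ := fun i => A.sum_declares_sub_le p w i hQ hp.info_pMin_pos.le (fun h => by
    by_cases h1 : A.query w h = Finset.univ
    · left; intro y; simp [Strategy.kernel, Q, h1]
    by_cases h0 : A.query w h = ∅
    · left
      intro y
      have : (∅ : Finset (Fin n)) ≠ Finset.univ := h0 ▸ h1
      simp [Strategy.kernel, Q, h0, this]
    right
    have h0' := Finset.nonempty_iff_ne_empty.2 h0
    have hm := hp.noiseLevel_mem h0' h1
    have hQe : Q h = fun _ => 1 / 2 := by
      ext y
      simp only [Q, h0, h1, or_self, if_false, bsc]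
      split_ifs <;> norm_num
    have hPe : A.kernel p w i h = bsc (noiseLevel p (A.query w h)) (decide (i ∈ A.query w h)) := by
      ext y; rw [Strategy.kernel, hp.crossover_eq h0' h1]
    rw [hQe, hPe, KL_bsc_coin hm.1 (by linarith [hm.2])]
    exact ⟨bsc_pos hm.1 (by linarith [hm.2]) _, fun _ => by norm_num,
      infoBSC_half_anti hp.pMin_nonneg (hp.pMin_le (card_div_mem h0' h1)) hm.2.le⟩) (Real.log n) T
  have hsum := Finset.sum_le_sum fun i (_ : i ∈ Finset.univ) => key i
  rw [Finset.sum_sub_distrib, ← Finset.mul_sum, ← Finset.mul_sum, ← Finset.mul_sum,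
    Real.exp_log hn0] at hsum
  -- Since `Q` does not depend on the target, it declares the right bin with average probability at
  -- most `1/n`. The factor `exp (log n) - 1 = n - 1` then contributes less than `1`.
  have h1 := hQ.sum_sum_declares_le A w T
  have hn1 : (1 : ℝ) ≤ n := by exact_mod_cast (by omega : 1 ≤ n)
  have h2 := mul_le_mul_of_nonneg_left h1 (by linarith : (0 : ℝ) ≤ n - 1)
  have h3 := mul_le_mul_of_nonneg_left hsum (inv_nonneg.2 hn0.le)
  have h4 := mul_le_mul_of_nonneg_left h2 (inv_nonneg.2 hn0.le)
  have h5 : (n : ℝ)⁻¹ * n = 1 := inv_mul_cancel₀ hn0.ne'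
  have h6 : 0 ≤ (n : ℝ)⁻¹ := inv_nonneg.2 hn0.le
  linarith

theorem IsNoiseProfile.reliability_converse (hp : IsNoiseProfile p) {n : ℕ} (hn : 2 ≤ n)
    (A : Strategy n) {ε : ℝ} (hε : ε ∈ Set.Ioo (0 : ℝ) 1) (hA : A.Reliable p ε) :
    ENNReal.ofReal (((1 - ε) * Real.log (1 / ε) - 1) / C1 (p (1 / (n : ℝ))))
      ≤ A.expectedTime p := by
  classical
  have : NeZero n := ⟨by omega⟩
  have hn0 : (0 : ℝ) < n := by positivity
  have hpn := hp.mem _ (inv_nat_mem hn)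
  have hC := C1_pos hpn.1 hpn.2
  set c := Real.log (1 / ε) with hc
  have hec : Real.exp c = 1 / ε := Real.exp_log (by have := hε.1; positivity)
  have hε1 : 1 ≤ 1 / ε := by rw [le_div_iff₀ hε.1]; linarith [hε.2]
  have hc0 : 0 ≤ c := Real.log_nonneg hε1
  -- If `s` is the average success probability, the comparison below has the form `c s - (1/ε - 1)(1
  -- - s) ≤ C E[τ]`; these `α` and `β` collect the terms in `s`. At `s = 1 - ε` the left side is `(1
  -- - ε)(c - 1)`.
  have main := hA.le_expectedTime (α := c + (1 / ε - 1)) (β := 1 / ε - 1)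
    (by linarith) hC fun T w => ?_
  · refine le_trans (ENNReal.ofReal_le_ofReal ?_) main
    refine div_le_div_of_nonneg_right ?_ hC.le
    have : 1 / ε * ε = 1 := div_mul_cancel₀ _ hε.1.ne'
    nlinarith [hε.1]
  have hne : ∀ i : Fin n, i + 1 ≠ i := by
    intro i hi
    have h1 : (1 : Fin n) = 0 := by simpa using hi
    have h2 := congrArg Fin.val h1
    rw [Fin.val_one', Fin.val_zero, Nat.mod_eq_of_lt (by omega)] at h2
    omega
  -- Target `i` is compared with its cyclic successor. A query separates the two only if it contains
  -- exactly one of them, hence is neither empty nor full and has noise at least `p(1/n)`.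
  have key : ∀ i, _ := fun i => A.sum_declares_sub_le p w i (A.isKernel p w (i + 1)) hC.le
    (fun h => by
      by_cases hs : (i ∈ A.query w h ↔ i + 1 ∈ A.query w h)
      · left; intro y; simp [Strategy.kernel, hs]
      right
      have h0 : (A.query w h).Nonempty := by
        by_contra h; rw [Finset.not_nonempty_iff_eq_empty] at h; simp [h] at hs
      have h1 : A.query w h ≠ Finset.univ := by intro h; simp [h] at hs
      have hm := hp.noiseLevel_mem h0 h1
      have hPe : A.kernel p w i h =
          bsc (noiseLevel p (A.query w h)) (decide (i ∈ A.query w h)) := by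
        ext y; rw [Strategy.kernel, hp.crossover_eq h0 h1]
      have hQe : A.kernel p w (i + 1) h
          = bsc (noiseLevel p (A.query w h)) (!decide (i ∈ A.query w h)) := by
        ext y
        rw [Strategy.kernel, hp.crossover_eq h0 h1]
        congr 1
        by_cases hi : i ∈ A.query w h <;> by_cases hj : i + 1 ∈ A.query w h <;>
          simp [hi, hj] at hs ⊢
      rw [hPe, hQe, KL_bsc_not]
      exact ⟨bsc_pos hm.1 (by linarith [hm.2]) _, bsc_pos hm.1 (by linarith [hm.2]) _,
        C1_anti hpn.1 (hp.le_noiseLevel hn h0 h1) hm.2⟩) c T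
  have hsum := Finset.sum_le_sum fun i (_ : i ∈ Finset.univ) => key i
  rw [Finset.sum_sub_distrib, ← Finset.mul_sum, ← Finset.mul_sum, ← Finset.mul_sum, hec] at hsum
  set a : Fin n → Fin n → ℝ := fun j i => ∑ t ∈ Finset.range T,
    steps (A.kernel p w j) t (fun h => ind (A.declares w i h)) [] with ha
  have hann : ∀ j i, 0 ≤ a j i := fun j i => Finset.sum_nonneg fun t _ =>
    (A.isKernel p w j).steps_nonneg t (fun _ => ind_nonneg _) []
  -- Declaring `i` is an error when the target is `i + 1`; since `i ↦ i + 1` is a bijection, the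
  -- errors sum to at most `n` minus the total success.
  have htwo : ∀ i, a (i + 1) i ≤ 1 - a (i + 1) (i + 1) := by
    intro i
    have h1 := (A.isKernel p w (i + 1)).sum_sum_declares_le A w T
    have h2 : ∑ k ∈ {i, i + 1}, a (i + 1) k ≤ ∑ k, a (i + 1) k :=
      Finset.sum_le_sum_of_subset_of_nonneg (Finset.subset_univ _) fun _ _ _ => hann _ _
    rw [Finset.sum_pair (hne i).symm] at h2
    linarith
  have h1 : ∑ i, a (i + 1) i ≤ n - ∑ i, a i i := by
    refine (Finset.sum_le_sum fun i _ => htwo i).trans (le_of_eq ?_)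
    have h2 : ∑ i, a (i + 1) (i + 1) = ∑ i, a i i :=
      Equiv.sum_comp (Equiv.addRight (1 : Fin n)) fun i => a i i
    rw [Finset.sum_sub_distrib, h2]
    simp
  have h2 := mul_le_mul_of_nonneg_left h1 (by linarith : (0 : ℝ) ≤ 1 / ε - 1)
  have h3 := mul_le_mul_of_nonneg_left hsum (inv_nonneg.2 hn0.le)
  have h4 := mul_le_mul_of_nonneg_left h2 (inv_nonneg.2 hn0.le)
  have h5 : (n : ℝ)⁻¹ * n = 1 := inv_mul_cancel₀ hn0.ne'
  have h6 : (n : ℝ)⁻¹ * ((1 / ε - 1) * n) = 1 / ε - 1 := by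
    rw [mul_comm (1 / ε - 1), ← mul_assoc, h5, one_mul]
  linarith

/-! ### The geometry of sorted queries -/

section SortedQuery

variable {n : ℕ} {π : Fin n → ℝ} {S : Finset (Fin n)}

/-- The consequences of the choice of a sorted query set that are used in the analysis: it collects
the largest entries, removing its smallest entry or adding the largest remaining entry does not
bring the mass closer to `1/2`. -/
structure BalancedQuery (π : Fin n → ℝ) (S : Finset (Fin n)) : Prop where
  nonempty : S.Nonempty
  le_of_mem : ∀ i ∈ S, ∀ j ∉ S, π j ≤ π i
  exists_min : 2 ≤ S.card → ∃ m ∈ S, (∀ i ∈ S, π m ≤ π i) ∧ 2 * ∑ i ∈ S, π i ≤ 1 + π m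
  exists_max : ∃ m ∉ S, (∀ j ∉ S, π j ≤ π m) ∧ 1 ≤ 2 * ∑ i ∈ S, π i + π m

/-- The two mass inequalities compare the optimal `k` with `k - 1`, which is admissible only for `k
≥ 2`, and with `k + 1`. -/
lemma IsSortedQuery.balancedQuery (hn : 2 ≤ n) (hpos : ∀ i, 0 < π i) (hsum : ∑ i, π i = 1)
    (h : IsSortedQuery π S) : BalancedQuery π S := by
  obtain ⟨σ, hσ, k, hk1, hkn, hmin, rfl⟩ := h
  have hins : ∀ j (hj : j < n), Finset.univ.filter (fun i => (σ i : ℕ) < j + 1)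
      = insert (σ.symm ⟨j, hj⟩) (Finset.univ.filter fun i => (σ i : ℕ) < j) := by
    intro j hj
    ext i
    simp only [Finset.mem_filter, Finset.mem_univ, true_and, Finset.mem_insert,
      Equiv.eq_symm_apply, Fin.ext_iff]
    omega
  have hnot : ∀ j (hj : j < n),
      σ.symm ⟨j, hj⟩ ∉ Finset.univ.filter fun i => (σ i : ℕ) < j := by
    intro j hj; simp
  have hadd : ∀ j (hj : j < n), (∑ i with (σ i : ℕ) < j + 1, π i)
      = π (σ.symm ⟨j, hj⟩) + ∑ i with (σ i : ℕ) < j, π i := by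
    intro j hj; rw [hins j hj, Finset.sum_insert (hnot j hj)]
  have hlast : 2 ≤ k → ∃ m ∈ Finset.univ.filter (fun i => (σ i : ℕ) < k),
      (∀ i ∈ Finset.univ.filter (fun i => (σ i : ℕ) < k), π m ≤ π i) ∧
      2 * ∑ i with (σ i : ℕ) < k, π i ≤ 1 + π m := by
    intro hk
    obtain ⟨j, rfl⟩ : ∃ j, k = j + 1 := ⟨k - 1, by omega⟩
    have hj : j < n := by omega
    refine ⟨σ.symm ⟨j, hj⟩, by simp, fun i hi => hσ _ _ ?_, ?_⟩
    · simp only [Finset.mem_filter, Finset.mem_univ, true_and] at hi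
      rw [Equiv.apply_symm_apply, Fin.le_def]
      exact Nat.lt_succ_iff.1 hi
    · have h1 := hmin j (by omega) (by omega)
      have h2 := hadd j hj
      have h3 := hpos (σ.symm ⟨j, hj⟩)
      by_contra hcon
      rw [not_le] at hcon
      rw [abs_le] at h1
      rcases le_total 0 ((∑ i with (σ i : ℕ) < j, π i) - 1 / 2) with h4 | h4
      · rw [abs_of_nonneg h4] at h1; linarith
      · rw [abs_of_nonpos h4] at h1; linarith
  -- The full set is never optimal: its mass `1` would force the smallest entry to be at least `1`,
  -- although another entry is positive.
  have hkn' : k < n := by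
    refine lt_of_le_of_ne hkn fun hkn => ?_
    obtain ⟨m, -, -, h2⟩ := hlast (by omega)
    have huniv : Finset.univ.filter (fun i => (σ i : ℕ) < k) = Finset.univ :=
      Finset.filter_true_of_mem fun i _ => hkn ▸ (σ i).2
    rw [huniv, hsum] at h2
    have : Nontrivial (Fin n) := Fin.nontrivial_iff_two_le.2 hn
    obtain ⟨m', hm'⟩ := exists_ne m
    have h3 : ∑ i ∈ {m, m'}, π i ≤ ∑ i, π i :=
      Finset.sum_le_sum_of_subset_of_nonneg (Finset.subset_univ _) fun i _ _ => (hpos i).le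
    rw [Finset.sum_pair hm'.symm, hsum] at h3
    linarith [hpos m']
  refine ⟨⟨σ.symm ⟨0, by omega⟩, by simp; omega⟩, fun i hi j hj => hσ i j ?_, fun hc => hlast ?_,
    σ.symm ⟨k, hkn'⟩, hnot k hkn', fun j hj => hσ _ _ ?_, ?_⟩
  · simp only [Finset.mem_filter, Finset.mem_univ, true_and] at hi hj
    rw [Fin.le_def]; omega
  · by_contra hk
    have : (Finset.univ.filter fun i => (σ i : ℕ) < k).card ≤ 1 := by
      refine Finset.card_le_one.2 fun a ha b hb => σ.injective (Fin.ext ?_)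
      simp only [Finset.mem_filter, Finset.mem_univ, true_and] at ha hb
      omega
    omega
  · simp only [Finset.mem_filter, Finset.mem_univ, true_and] at hj
    rw [Equiv.apply_symm_apply, Fin.le_def]
    exact not_lt.1 hj
  · have h1 := hmin (k + 1) (by omega) hkn'
    have h2 := hadd k hkn'
    have h3 := hpos (σ.symm ⟨k, hkn'⟩)
    by_contra hcon
    rw [not_le] at hcon
    have h4 : (∑ i with (σ i : ℕ) < k, π i) - 1 / 2 ≤ 0 := by linarith
    rw [abs_of_nonpos h4, h2] at h1
    have h5 : |π (σ.symm ⟨k, hkn'⟩) + (∑ i with (σ i : ℕ) < k, π i) - 1 / 2|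
        < -((∑ i with (σ i : ℕ) < k, π i) - 1 / 2) :=
      abs_lt.2 ⟨by linarith, by linarith⟩
    linarith

namespace BalancedQuery

lemma ne_univ (h : BalancedQuery π S) : S ≠ Finset.univ := by
  obtain ⟨m, hm, -⟩ := h.exists_max
  rintro rfl
  exact hm (Finset.mem_univ _)

lemma le_mass (hpos : ∀ i, 0 < π i) {i : Fin n} (hi : i ∈ S) : π i ≤ ∑ j ∈ S, π j :=
  Finset.single_le_sum (fun j _ => (hpos j).le) hi

/-- The largest entry `m` outside is at most any entry inside, hence at most the mass `s`; so `1 ≤ 2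
s + π m ≤ 3 s`. -/
lemma third_le_mass (h : BalancedQuery π S) (hpos : ∀ i, 0 < π i) : 1 / 3 ≤ ∑ i ∈ S, π i := by
  obtain ⟨m, hm, -, h2⟩ := h.exists_max
  obtain ⟨i, hi⟩ := h.nonempty
  have h3 := h.le_of_mem i hi m hm
  have h4 := le_mass hpos hi
  linarith

/-- With at least two bins inside, the smallest entry is at most `s / 2`, and `2 s ≤ 1 + s / 2`. A
single bin may of course carry more mass. -/
lemma mass_le (h : BalancedQuery π S) (hpos : ∀ i, 0 < π i) (hS : 2 ≤ S.card) :
    ∑ i ∈ S, π i ≤ 2 / 3 := by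
  obtain ⟨m, hm, h1, h2⟩ := h.exists_min hS
  obtain ⟨m', hm', hne⟩ := Finset.exists_mem_ne (by omega : 1 < S.card) m
  have h3 : ∑ i ∈ {m, m'}, π i ≤ ∑ i ∈ S, π i :=
    Finset.sum_le_sum_of_subset_of_nonneg
      (by intro x hx; simp only [Finset.mem_insert, Finset.mem_singleton] at hx
          rcases hx with rfl | rfl <;> assumption) fun i _ _ => (hpos i).le
  rw [Finset.sum_pair hne.symm] at h3
  linarith [h1 m' hm']

lemma eq_singleton (h : BalancedQuery π S) (hpos : ∀ i, 0 < π i) (hsum : ∑ i, π i = 1)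
    {i : Fin n} (hi : 2 / 3 < π i) : S = {i} := by
  have hmem : i ∈ S := by
    by_contra hiS
    obtain ⟨j, hj⟩ := h.nonempty
    have h1 := h.le_of_mem j hj i hiS
    have h2 : ∑ k ∈ {i, j}, π k ≤ ∑ k, π k :=
      Finset.sum_le_sum_of_subset_of_nonneg (Finset.subset_univ _) fun i _ _ => (hpos i).le
    rw [Finset.sum_pair (by rintro rfl; exact hiS hj), hsum] at h2
    linarith
  have hc : S.card ≤ 1 := by
    by_contra hc
    have h1 := h.mass_le hpos (by omega)
    have h2 := le_mass hpos hmem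
    linarith
  exact Finset.eq_singleton_iff_unique_mem.2 ⟨hmem, fun j hj => Finset.card_le_one.1 hc _ hj _ hmem⟩

lemma abs_mass_sub_le (h : BalancedQuery π S) {κ : ℝ} (hκ : κ ≤ 1) (hle : ∀ i, π i ≤ κ) :
    |∑ i ∈ S, π i - 1 / 2| ≤ κ / 2 := by
  rw [abs_le]
  constructor
  · obtain ⟨m, -, -, h2⟩ := h.exists_max
    linarith [hle m]
  · rcases Nat.lt_or_ge S.card 2 with hS | hS
    · obtain ⟨i, hi⟩ := Finset.card_eq_one.1 (le_antisymm (by omega) h.nonempty.card_pos)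
      rw [hi, Finset.sum_singleton]
      linarith [hle i]
    · obtain ⟨m, -, -, h2⟩ := h.exists_min hS
      linarith [hle m]

/-- Without its smallest bin `m` the query set has mass below `1/2`, while each of its bins has at
least the mass of `m` and each bin outside at most that. So a large query set makes `π m`, and every
posterior outside, small. -/
lemma card_sub_one_mul_le (h : BalancedQuery π S) (hS : 2 ≤ S.card) :
    ∃ m ∈ S, (∀ i ∉ S.erase m, π i ≤ π m) ∧ ∑ i ∈ S.erase m, π i ≤ (1 - π m) / 2 ∧
      ((S.card : ℝ) - 1) * π m ≤ ∑ i ∈ S.erase m, π i := by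
  obtain ⟨m, hm, h1, h2⟩ := h.exists_min hS
  have h3 := Finset.sum_erase_add S π hm
  refine ⟨m, hm, fun i hi => ?_, by linarith, ?_⟩
  · by_cases him : i = m
    · rw [him]
    · exact h.le_of_mem m hm i fun hiS => hi (Finset.mem_erase.2 ⟨him, hiS⟩)
  · have h4 := Finset.card_nsmul_le_sum (S.erase m) π (π m)
      fun i hi => h1 i (Finset.mem_of_mem_erase hi)
    rw [Finset.card_erase_of_mem hm, nsmul_eq_mul, Nat.cast_sub (by omega)] at h4
    simpa using h4

/-- Keeps the noise below the fixed level `p(2/3) < 1/2`. The bins of `S` other than `m` have less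
than half the mass, with entries at least `π m`; the others have more than half, with entries at
most `π m`. Hence `|S| - 1 < n - |S| + 1`, and for `|S| ≥ 2` integrality gives `3 |S| ≤ 2 n`. -/
lemma card_div_le (h : BalancedQuery π S) (hn : 2 ≤ n) (hpos : ∀ i, 0 < π i)
    (hsum : ∑ i, π i = 1) : (S.card : ℝ) / n ≤ 2 / 3 := by
  have hn0 : (0 : ℝ) < n := by positivity
  have hn2 : (2 : ℝ) ≤ n := by exact_mod_cast hn
  rw [div_le_iff₀ hn0]
  rcases Nat.lt_or_ge S.card 2 with hS | hS
  · have : (S.card : ℝ) ≤ 1 := by exact_mod_cast (by omega : S.card ≤ 1)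
    linarith
  obtain ⟨m, hm, h1, h2, h3⟩ := h.card_sub_one_mul_le hS
  have h4 : ∑ i ∈ (S.erase m)ᶜ, π i ≤ ((n : ℝ) - S.card + 1) * π m := by
    have := Finset.sum_le_card_nsmul (S.erase m)ᶜ π (π m)
      fun i hi => h1 i (Finset.mem_compl.1 hi)
    have hcn : S.card ≤ n := by simpa using Finset.card_le_univ S
    rw [Finset.card_compl, Finset.card_erase_of_mem hm, Fintype.card_fin, nsmul_eq_mul,
      Nat.cast_sub (by omega), Nat.cast_sub (by omega)] at this
    push_cast at this
    linarith
  have h5 := Finset.sum_add_sum_compl (S.erase m) π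
  rw [hsum] at h5
  have h6 : ((S.card : ℝ) - 1) * π m < ((n : ℝ) - S.card + 1) * π m := by
    linarith [hpos m]
  have h7 := lt_of_mul_lt_mul_right h6 (hpos m).le
  have h8 : (2 * S.card : ℝ) < n + 2 := by linarith
  have h9 : 2 * S.card < n + 2 := by exact_mod_cast h8
  have h10 : 3 * S.card ≤ 2 * n := by omega
  have h11 : (3 * S.card : ℝ) ≤ 2 * n := by exact_mod_cast h10
  linarith

end BalancedQuery

end SortedQuery

/-! ### The posterior under sorted posterior matching -/

variable {n : ℕ}

namespace SortPM

/-- The noise level of the next query. -/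
def noise (p : ℝ → ℝ) (r : SortPM n) (h : List Bool) : ℝ := noiseLevel p (r.query (r.belief p h))

/-- The input of the channel at the next query if the target is `i`. -/
def side (p : ℝ → ℝ) (r : SortPM n) (i : Fin n) (h : List Bool) : Bool :=
  decide (i ∈ r.query (r.belief p h))

/-- The law of the next observation if the target is `i`. -/
def obs (p : ℝ → ℝ) (r : SortPM n) (i : Fin n) (h : List Bool) (y : Bool) : ℝ :=
  bsc (r.noise p h) (r.side p i h) y

/-- The posterior law of the next observation. -/
def mixture (p : ℝ → ℝ) (r : SortPM n) (h : List Bool) (y : Bool) : ℝ :=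
  ∑ j, r.belief p h j * r.obs p j h y

/-- The posterior odds against bin `i`. -/
def odds (p : ℝ → ℝ) (r : SortPM n) (i : Fin n) (h : List Bool) : ℝ :=
  (1 - r.belief p h i) / r.belief p h i

/-- The posterior mass of the next query set. -/
def mass (p : ℝ → ℝ) (r : SortPM n) (h : List Bool) : ℝ :=
  ∑ i ∈ r.query (r.belief p h), r.belief p h i

/-- The posterior probability that the next channel input is not that of bin `i`. -/
def opp (p : ℝ → ℝ) (r : SortPM n) (i : Fin n) (h : List Bool) : ℝ :=
  if i ∈ r.query (r.belief p h) then 1 - r.mass p h else r.mass p h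

/-- The posterior law of the next observation conditioned on the target not being `i`. -/
def rest (p : ℝ → ℝ) (r : SortPM n) (i : Fin n) (h : List Bool) (y : Bool) : ℝ :=
  (r.mixture p h y - r.belief p h i * r.obs p i h y) / (1 - r.belief p h i)

lemma belief_cons (r : SortPM n) (y : Bool) (h : List Bool) (i : Fin n) :
    r.belief p (y :: h) i = r.belief p h i * r.obs p i h y / r.mixture p h y := rfl

lemma belief_pos_and_sum (hp : IsNoiseProfile p) (hn : 2 ≤ n) (r : SortPM n) (h : List Bool) :
    (∀ i, 0 < r.belief p h i) ∧ ∑ i, r.belief p h i = 1 := by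
  have hn0 : (0 : ℝ) < n := by positivity
  induction h with
  | nil =>
    refine ⟨fun i => by simp only [belief]; positivity, ?_⟩
    simp [belief, hn0.ne']
  | cons y h ih =>
    have hb := (r.isSortedQuery (r.belief p h)).balancedQuery hn ih.1 ih.2
    have hm := hp.noiseLevel_mem hb.nonempty hb.ne_univ
    have hobs : ∀ i, 0 < r.obs p i h y := fun i => bsc_pos hm.1 (by linarith [hm.2]) _ _
    have hmix : 0 < r.mixture p h y :=
      Finset.sum_pos (fun j _ => mul_pos (ih.1 j) (hobs j)) ⟨⟨0, by omega⟩, Finset.mem_univ _⟩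
    refine ⟨fun i => ?_, ?_⟩
    · rw [belief_cons]
      exact div_pos (mul_pos (ih.1 i) (hobs i)) hmix
    · simp only [belief_cons]
      rw [← Finset.sum_div]
      exact div_self hmix.ne'

lemma belief_pos (hp : IsNoiseProfile p) (hn : 2 ≤ n) (r : SortPM n) (h : List Bool)
    (i : Fin n) : 0 < r.belief p h i :=
  (r.belief_pos_and_sum hp hn h).1 i

lemma sum_belief (hp : IsNoiseProfile p) (hn : 2 ≤ n) (r : SortPM n) (h : List Bool) :
    ∑ i, r.belief p h i = 1 :=
  (r.belief_pos_and_sum hp hn h).2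

lemma balanced (hp : IsNoiseProfile p) (hn : 2 ≤ n) (r : SortPM n) (h : List Bool) :
    BalancedQuery (r.belief p h) (r.query (r.belief p h)) :=
  (r.isSortedQuery _).balancedQuery hn (r.belief_pos hp hn h) (r.sum_belief hp hn h)

lemma noise_mem (hp : IsNoiseProfile p) (hn : 2 ≤ n) (r : SortPM n) (h : List Bool) :
    r.noise p h ∈ Set.Ioo (0 : ℝ) (1 / 2) :=
  hp.noiseLevel_mem (r.balanced hp hn h).nonempty (r.balanced hp hn h).ne_univ

lemma noise_lt_one (hp : IsNoiseProfile p) (hn : 2 ≤ n) (r : SortPM n) (h : List Bool) :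
    r.noise p h < 1 := by
  linarith [(r.noise_mem hp hn h).2]

lemma noise_le (hp : IsNoiseProfile p) (hn : 2 ≤ n) (r : SortPM n) (h : List Bool) :
    r.noise p h ≤ p (2 / 3) :=
  hp.mono (card_div_mem (r.balanced hp hn h).nonempty (r.balanced hp hn h).ne_univ)
    ⟨by norm_num, by norm_num⟩
    ((r.balanced hp hn h).card_div_le hn (r.belief_pos hp hn h) (r.sum_belief hp hn h))

lemma le_noise (hp : IsNoiseProfile p) (hn : 2 ≤ n) (r : SortPM n) (h : List Bool) :
    p (1 / (n : ℝ)) ≤ r.noise p h :=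
  hp.le_noiseLevel hn (r.balanced hp hn h).nonempty (r.balanced hp hn h).ne_univ

lemma obs_pos (hp : IsNoiseProfile p) (hn : 2 ≤ n) (r : SortPM n) (i : Fin n) (h : List Bool)
    (y : Bool) : 0 < r.obs p i h y :=
  bsc_pos (r.noise_mem hp hn h).1 (r.noise_lt_one hp hn h) _ _

lemma sum_obs (r : SortPM n) (i : Fin n) (h : List Bool) : ∑ y, r.obs p i h y = 1 := sum_bsc _ _

lemma isKernel_obs (hp : IsNoiseProfile p) (hn : 2 ≤ n) (r : SortPM n) (i : Fin n) :
    IsKernel (r.obs p i) :=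
  ⟨fun h y => (r.obs_pos hp hn i h y).le, r.sum_obs i⟩

lemma mixture_pos (hp : IsNoiseProfile p) (hn : 2 ≤ n) (r : SortPM n) (h : List Bool)
    (y : Bool) : 0 < r.mixture p h y :=
  Finset.sum_pos (fun j _ => mul_pos (r.belief_pos hp hn h j) (r.obs_pos hp hn j h y))
    ⟨⟨0, by omega⟩, Finset.mem_univ _⟩

lemma sum_mixture (hp : IsNoiseProfile p) (hn : 2 ≤ n) (r : SortPM n) (h : List Bool) :
    ∑ y, r.mixture p h y = 1 := by
  simp only [mixture]
  rw [Finset.sum_comm]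
  simp only [← Finset.mul_sum, r.sum_obs, mul_one, r.sum_belief hp hn]

lemma isKernel_mixture (hp : IsNoiseProfile p) (hn : 2 ≤ n) (r : SortPM n) : IsKernel
    (r.mixture p) :=
  ⟨fun h y => (r.mixture_pos hp hn h y).le, r.sum_mixture hp hn⟩

lemma mixture_eq (hp : IsNoiseProfile p) (hn : 2 ≤ n) (r : SortPM n) (i : Fin n) (h : List Bool)
    (y : Bool) : r.mixture p h y = (1 - r.opp p i h) * bsc (r.noise p h) (r.side p i h) y
      + r.opp p i h * bsc (r.noise p h) (!r.side p i h) y := by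
  have h1 : r.mixture p h y = r.mass p h * bsc (r.noise p h) true y
      + (1 - r.mass p h) * bsc (r.noise p h) false y := by
    have hs := r.sum_belief hp hn h
    rw [← Finset.sum_add_sum_compl (r.query (r.belief p h))] at hs
    have e1 : ∑ j ∈ r.query (r.belief p h), r.belief p h j * r.obs p j h y
        = r.mass p h * bsc (r.noise p h) true y := by
      rw [mass, Finset.sum_mul]
      exact Finset.sum_congr rfl fun j hj => by simp [obs, side, hj]
    have e2 : ∑ j ∈ (r.query (r.belief p h))ᶜ, r.belief p h j * r.obs p j h y
        = (1 - r.mass p h) * bsc (r.noise p h) false y := by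
      rw [mass, ← eq_sub_iff_add_eq'.2 hs, Finset.sum_mul]
      refine Finset.sum_congr rfl fun j hj => ?_
      rw [Finset.mem_compl] at hj
      simp [obs, side, hj]
    rw [mixture, ← Finset.sum_add_sum_compl (r.query (r.belief p h)), e1, e2]
  rw [h1, opp, side]
  by_cases hi : i ∈ r.query (r.belief p h) <;> simp [hi]; ring

lemma belief_lt_one (hp : IsNoiseProfile p) (hn : 2 ≤ n) (r : SortPM n) (h : List Bool)
    (i : Fin n) : r.belief p h i < 1 := by
  have : Nontrivial (Fin n) := Fin.nontrivial_iff_two_le.2 hn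
  obtain ⟨j, hj⟩ := exists_ne i
  have h1 : ∑ k ∈ {i, j}, r.belief p h k ≤ ∑ k, r.belief p h k :=
    Finset.sum_le_sum_of_subset_of_nonneg (Finset.subset_univ _)
      fun k _ _ => (r.belief_pos hp hn h k).le
  rw [Finset.sum_pair hj.symm, r.sum_belief hp hn] at h1
  linarith [r.belief_pos hp hn h j]

lemma odds_pos (hp : IsNoiseProfile p) (hn : 2 ≤ n) (r : SortPM n) (i : Fin n) (h : List Bool) :
    0 < r.odds p i h :=
  div_pos (by linarith [r.belief_lt_one hp hn h i]) (r.belief_pos hp hn h i)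

lemma opp_le (hp : IsNoiseProfile p) (hn : 2 ≤ n) (r : SortPM n) (i : Fin n) (h : List Bool) :
    r.opp p i h ≤ 1 - r.belief p h i := by
  have hpos := r.belief_pos hp hn h
  rw [opp]
  split_ifs with hi
  · linarith [BalancedQuery.le_mass hpos hi,
      show r.mass p h = ∑ i ∈ r.query (r.belief p h), r.belief p h i from rfl]
  · have h1 : ∑ k ∈ insert i (r.query (r.belief p h)), r.belief p h k ≤ ∑ k, r.belief p h k :=
      Finset.sum_le_sum_of_subset_of_nonneg (Finset.subset_univ _) fun k _ _ => (hpos k).le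
    rw [Finset.sum_insert hi, r.sum_belief hp hn] at h1
    linarith [show r.mass p h = ∑ i ∈ r.query (r.belief p h), r.belief p h i from rfl]

lemma opp_eq_of_query_eq {r : SortPM n} {i : Fin n} {h : List Bool}
    (hS : r.query (r.belief p h) = {i}) : r.opp p i h = 1 - r.belief p h i := by
  rw [opp, mass, hS]; simp

/-- Every query tests bin `i` against a fixed fraction of its competitors. If `i` is queried alone,
all of them are on the other side; otherwise that side has mass at least `1/3`, by `mass_le` or
`third_le_mass`. -/
lemma third_le_opp (hp : IsNoiseProfile p) (hn : 2 ≤ n) (r : SortPM n) (i : Fin n) (h : List Bool) :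
    (1 - r.belief p h i) / 3 ≤ r.opp p i h := by
  have hpos := r.belief_pos hp hn h
  have hb := r.balanced hp hn h
  have h1 := r.belief_lt_one hp hn h i
  by_cases hi : i ∈ r.query (r.belief p h)
  · rcases Nat.lt_or_ge (r.query (r.belief p h)).card 2 with hS | hS
    · have : r.query (r.belief p h) = {i} :=
        Finset.eq_singleton_iff_unique_mem.2
          ⟨hi, fun j hj => Finset.card_le_one.1 (by omega) _ hj _ hi⟩
      rw [opp_eq_of_query_eq this]
      linarith
    · rw [opp, if_pos hi]
      linarith [hb.mass_le hpos hS, hpos i,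
        show r.mass p h = ∑ i ∈ r.query (r.belief p h), r.belief p h i from rfl]
  · rw [opp, if_neg hi]
    linarith [hb.third_le_mass hpos, hpos i,
      show r.mass p h = ∑ i ∈ r.query (r.belief p h), r.belief p h i from rfl]

lemma rest_eq (hp : IsNoiseProfile p) (hn : 2 ≤ n) (r : SortPM n) (i : Fin n) (h : List Bool)
    (y : Bool) : r.rest p i h y
      = (1 - r.opp p i h / (1 - r.belief p h i)) * bsc (r.noise p h) (r.side p i h) y
        + r.opp p i h / (1 - r.belief p h i) * bsc (r.noise p h) (!r.side p i h) y := by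
  have h1 : 1 - r.belief p h i ≠ 0 := by linarith [r.belief_lt_one hp hn h i]
  rw [rest, r.mixture_eq hp hn i, obs]
  field_simp
  ring

lemma weight_mem (hp : IsNoiseProfile p) (hn : 2 ≤ n) (r : SortPM n) (i : Fin n) (h : List Bool) :
    r.opp p i h / (1 - r.belief p h i) ∈ Set.Icc (1 / 3 : ℝ) 1 := by
  have h1 : 0 < 1 - r.belief p h i := by linarith [r.belief_lt_one hp hn h i]
  constructor
  · rw [le_div_iff₀ h1]; linarith [r.third_le_opp hp hn i h]
  · rw [div_le_one h1]; exact r.opp_le hp hn i h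

/-- Bayes' rule for `i` against its complement: the normalization `mixture` cancels and a likelihood
ratio remains. -/
lemma odds_cons (hp : IsNoiseProfile p) (hn : 2 ≤ n) (r : SortPM n) (i : Fin n) (h : List Bool)
    (y : Bool) :
    r.odds p i (y :: h) = r.odds p i h * (r.rest p i h y / r.obs p i h y) := by
  have h1 : 1 - r.belief p h i ≠ 0 := by linarith [r.belief_lt_one hp hn h i]
  have h2 := (r.belief_pos hp hn h i).ne'
  have h3 := (r.obs_pos hp hn i h y).ne'
  have h4 := (r.mixture_pos hp hn h y).ne'
  rw [odds, odds, belief_cons, rest]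
  field_simp

lemma rest_pos (hp : IsNoiseProfile p) (hn : 2 ≤ n) (r : SortPM n) (i : Fin n) (h : List Bool)
    (y : Bool) : 0 < r.rest p i h y := by
  have h1 := r.odds_pos hp hn i (y :: h)
  rw [r.odds_cons hp hn] at h1
  have h2 := pos_of_mul_pos_right h1 (r.odds_pos hp hn i h).le
  exact (div_pos_iff_of_pos_right (r.obs_pos hp hn i h y)).1 h2

lemma sum_rest (hp : IsNoiseProfile p) (hn : 2 ≤ n) (r : SortPM n) (i : Fin n) (h : List Bool) :
    ∑ y, r.rest p i h y = 1 := by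
  simp only [r.rest_eq hp hn, Finset.sum_add_distrib, ← Finset.mul_sum, sum_bsc]
  ring

end SortPM

/-! ### One-step estimates -/

/-- With `s = √x` and `t = √y`, the gap `(x + y)/2 - s t` equals `(s - t)²/2`, while `(x - y)² = (s
- t)² (s + t)² ≤ 4 (s - t)²`. -/
lemma sqrt_mul_le {x y : ℝ} (hx : x ∈ Set.Icc (0 : ℝ) 1) (hy : y ∈ Set.Icc (0 : ℝ) 1) :
    Real.sqrt (x * y) ≤ (x + y) / 2 - (x - y) ^ 2 / 8 := by
  have hx' := Real.sq_sqrt hx.1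
  have hy' := Real.sq_sqrt hy.1
  have h1 : Real.sqrt x ≤ 1 := Real.sqrt_le_one.2 hx.2
  have h2 : Real.sqrt y ≤ 1 := Real.sqrt_le_one.2 hy.2
  have h3 := Real.sqrt_nonneg x
  have h4 := Real.sqrt_nonneg y
  rw [Real.sqrt_mul hx.1]
  set s := Real.sqrt x
  set t := Real.sqrt y
  have h5 : (s + t) ^ 2 ≤ 4 := by nlinarith
  have h6 := mul_le_mul_of_nonneg_left h5 (sq_nonneg (s - t))
  have h7 : (x - y) ^ 2 = (s - t) ^ 2 * (s + t) ^ 2 := by rw [← hx', ← hy']; ring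
  nlinarith

/-- The contraction factor of the square root of the odds. -/
def contraction (p : ℝ → ℝ) : ℝ := 1 - (1 - 2 * p (2 / 3)) ^ 2 / 36

lemma IsNoiseProfile.contraction_lt_one (hp : IsNoiseProfile p) : contraction p < 1 := by
  have := (hp.mem (2 / 3) ⟨by norm_num, by norm_num⟩).2
  have : 0 < (1 - 2 * p (2 / 3)) ^ 2 := by apply pow_pos; linarith
  rw [contraction]; linarith

namespace SortPM

/-- The contraction factor is the Bhattacharyya coefficient of the laws `obs` and `rest`. At both
outcomes they differ by `w (1 - 2a)`, with weight `w ≥ 1/3` and noise `a ≤ p(2/3)`; two terms `(w (1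
- 2a))² / 8` give the denominator `36`. -/
lemma step_sqrt_odds_le (hp : IsNoiseProfile p) (hn : 2 ≤ n) (r : SortPM n) (i : Fin n)
    (h : List Bool) :
    step (r.obs p i) (fun h => Real.sqrt (r.odds p i h)) h
      ≤ contraction p * Real.sqrt (r.odds p i h) := by
  have hf := r.obs_pos hp hn i h
  have hg := r.rest_pos hp hn i h
  have hfs := r.sum_obs (p := p) i h
  have hgs := r.sum_rest hp hn i h
  have hle : ∀ f : Bool → ℝ, (∀ y, 0 < f y) → ∑ y, f y = 1 → ∀ y, f y ∈ Set.Icc (0 : ℝ) 1 := by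
    intro f h0 h1 y
    refine ⟨(h0 y).le, ?_⟩
    rw [← h1]
    exact Finset.single_le_sum (fun y _ => (h0 y).le) (Finset.mem_univ y)
  have e : step (r.obs p i) (fun h => Real.sqrt (r.odds p i h)) h
      = Real.sqrt (r.odds p i h) * ∑ y, Real.sqrt (r.obs p i h y * r.rest p i h y) := by
    rw [step, Finset.mul_sum]
    refine Finset.sum_congr rfl fun y _ => ?_
    have h1 : r.obs p i h y * r.rest p i h y
        = r.obs p i h y ^ 2 * (r.rest p i h y / r.obs p i h y) := by
      have := (hf y).ne'
      field_simp
    rw [r.odds_cons hp hn, Real.sqrt_mul (r.odds_pos hp hn i h).le, h1,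
      Real.sqrt_mul (sq_nonneg _), Real.sqrt_sq (hf y).le]
    ring
  rw [e, mul_comm]
  refine mul_le_mul_of_nonneg_right ?_ (Real.sqrt_nonneg _)
  have hb : ∀ y, (r.obs p i h y - r.rest p i h y) ^ 2
      = (r.opp p i h / (1 - r.belief p h i)) ^ 2 * (1 - 2 * r.noise p h) ^ 2 := by
    intro y
    rw [r.rest_eq hp hn, obs]
    cases y <;> cases r.side p i h <;> simp [bsc] <;> ring
  have hw := (r.weight_mem hp hn i h).1
  have ha := r.noise_le hp hn h
  have ha' := (hp.mem (2 / 3) ⟨by norm_num, by norm_num⟩).2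
  have h1 : (1 / 3) ^ 2 * (1 - 2 * p (2 / 3)) ^ 2
      ≤ (r.opp p i h / (1 - r.belief p h i)) ^ 2 * (1 - 2 * r.noise p h) ^ 2 := by
    have : 0 ≤ 1 - 2 * p (2 / 3) := by linarith
    gcongr
  have h2 := fun y => sqrt_mul_le (hle _ hf hfs y) (hle _ hg hgs y)
  simp only [hb] at h2
  have h3 := h2 true
  have h4 := h2 false
  rw [Fintype.sum_bool] at hfs hgs ⊢
  rw [contraction]
  linarith

lemma step_log_odds (hp : IsNoiseProfile p) (hn : 2 ≤ n) (r : SortPM n) (i : Fin n)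
    (h : List Bool) :
    step (r.obs p i) (fun h => Real.log (r.odds p i h)) h
      = Real.log (r.odds p i h) - KL (r.obs p i h) (r.rest p i h) := by
  have e : ∀ y, r.obs p i h y * Real.log (r.odds p i (y :: h))
      = r.obs p i h y * Real.log (r.odds p i h)
        - r.obs p i h y * Real.log (r.obs p i h y / r.rest p i h y) := by
    intro y
    rw [r.odds_cons hp hn, Real.log_mul (r.odds_pos hp hn i h).ne'
      (div_pos (r.rest_pos hp hn i h y) (r.obs_pos hp hn i h y)).ne',
      ← inv_div (r.obs p i h y), Real.log_inv]
    ring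
  simp only [step, e, Finset.sum_sub_distrib, ← Finset.sum_mul, r.sum_obs, one_mul, KL]

lemma step_log_odds_le (hp : IsNoiseProfile p) (hn : 2 ≤ n) (r : SortPM n) (i : Fin n)
    (h : List Bool) :
    step (r.obs p i) (fun h => Real.log (r.odds p i h)) h ≤ Real.log (r.odds p i h) := by
  rw [r.step_log_odds hp hn]
  linarith [KL_nonneg (r.obs_pos hp hn i h) (r.rest_pos hp hn i h) (r.sum_obs i h)
    (r.sum_rest hp hn i h)]

/-- A posterior above `2/3` forces the query `{i}`, so all competitors are on the other side and the
noise is `p(δ)`: the step separates opposite inputs of a single channel. -/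
lemma step_log_odds_of_belief (hp : IsNoiseProfile p) (hn : 2 ≤ n) (r : SortPM n) {i : Fin n}
    {h : List Bool} (hi : 2 / 3 < r.belief p h i) :
    step (r.obs p i) (fun h => Real.log (r.odds p i h)) h
      = Real.log (r.odds p i h) - C1 (p (1 / (n : ℝ))) := by
  have hS := (r.balanced hp hn h).eq_singleton (r.belief_pos hp hn h) (r.sum_belief hp hn h) hi
  have hn1 : r.noise p h = p (1 / (n : ℝ)) := by simp [noise, noiseLevel, hS]
  have hrest : r.rest p i h = bsc (r.noise p h) (!r.side p i h) := by
    ext y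
    have h1 : 1 - r.belief p h i ≠ 0 := by linarith [r.belief_lt_one hp hn h i]
    rw [r.rest_eq hp hn, opp_eq_of_query_eq hS, div_self h1]
    ring
  rw [r.step_log_odds hp hn, hrest, ← hn1]
  congr 1
  exact KL_bsc_not _ _

/-- Bounds the overshoot at the stopping time: one observation has likelihood ratio at most `(1 -
a)/a`, and the noise `a` is at least `p(δ)`. -/
lemma neg_log_odds_cons_le (hp : IsNoiseProfile p) (hn : 2 ≤ n) (r : SortPM n) (i : Fin n)
    (h : List Bool) (y : Bool) :
    -Real.log (r.odds p i (y :: h)) ≤ -Real.log (r.odds p i h)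
      + Real.log ((1 - p (1 / (n : ℝ))) / p (1 / (n : ℝ))) := by
  have hf := r.obs_pos hp hn i h y
  have hg := r.rest_pos hp hn i h y
  have ha := r.noise_mem hp hn h
  have hpn := (hp.mem _ (inv_nat_mem hn)).1
  rw [r.odds_cons hp hn, Real.log_mul (r.odds_pos hp hn i h).ne' (div_pos hg hf).ne',
    ← inv_div (r.obs p i h y), Real.log_inv]
  have hfa : r.obs p i h y ≤ 1 - r.noise p h := by
    rw [obs, bsc]; split_ifs <;> linarith [ha.2]
  have hb : ∀ s, r.noise p h ≤ bsc (r.noise p h) s y := by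
    intro s; rw [bsc]; split_ifs <;> linarith [ha.2]
  have hga : r.noise p h ≤ r.rest p i h y := by
    rw [r.rest_eq hp hn]
    have hw := r.weight_mem hp hn i h
    have h1 := mul_le_mul_of_nonneg_left (hb (r.side p i h)) (by linarith [hw.2] :
      0 ≤ 1 - r.opp p i h / (1 - r.belief p h i))
    have h2 := mul_le_mul_of_nonneg_left (hb (!r.side p i h)) (by linarith [hw.1] :
      0 ≤ r.opp p i h / (1 - r.belief p h i))
    linarith
  have h1 : Real.log (r.obs p i h y / r.rest p i h y)
      ≤ Real.log ((1 - r.noise p h) / r.noise p h) :=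
    Real.log_le_log (div_pos hf hg) (div_le_div₀ (by linarith [ha.2]) hfa ha.1 hga)
  have h2 := log_odds_anti hpn (r.le_noise hp hn h) (by linarith [ha.2])
  linarith

lemma step_neg_log_belief (hp : IsNoiseProfile p) (hn : 2 ≤ n) (r : SortPM n) (i : Fin n)
    (h : List Bool) :
    step (r.obs p i) (fun h => -Real.log (r.belief p h i)) h
      = -Real.log (r.belief p h i) - KL (r.obs p i h) (r.mixture p h) := by
  have e : ∀ y, r.obs p i h y * -Real.log (r.belief p (y :: h) i)
      = r.obs p i h y * -Real.log (r.belief p h i)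
        - r.obs p i h y * Real.log (r.obs p i h y / r.mixture p h y) := by
    intro y
    rw [belief_cons, mul_div_assoc, Real.log_mul (r.belief_pos hp hn h i).ne'
      (div_pos (r.obs_pos hp hn i h y) (r.mixture_pos hp hn h y)).ne']
    ring
  simp only [step, e, Finset.sum_sub_distrib, ← Finset.sum_mul, r.sum_obs, one_mul, KL]

/-- If the query mass is within `κ/2` of `1/2`, each outcome has posterior probability at most `(1 +
κ)/2`. Replacing the mixture by a fair coin therefore changes the divergence by at most `log (1 + κ)
≤ κ`. -/
lemma le_KL_mixture (hp : IsNoiseProfile p) (hn : 2 ≤ n) (r : SortPM n) (i : Fin n)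
    (h : List Bool) {κ : ℝ} (hκ : 0 ≤ κ)
    (hm : |r.mass p h - 1 / 2| ≤ κ / 2) :
    infoBSC (1 / 2) (r.noise p h) - κ ≤ KL (r.obs p i h) (r.mixture p h) := by
  have ha := r.noise_mem hp hn h
  rw [← KL_bsc_coin ha.1 (r.noise_lt_one hp hn h) (r.side p i h)]
  have hop : |r.opp p i h - 1 / 2| ≤ κ / 2 := by
    rw [opp]; split_ifs
    · rw [show 1 - r.mass p h - 1 / 2 = -(r.mass p h - 1 / 2) by ring, abs_neg]; exact hm
    · exact hm
  have hmix : ∀ y, r.mixture p h y ≤ (1 + κ) / 2 := by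
    intro y
    have e : r.mixture p h y - 1 / 2
        = (r.opp p i h - 1 / 2) * (bsc (r.noise p h) (!r.side p i h) y
          - bsc (r.noise p h) (r.side p i h) y) := by
      rw [r.mixture_eq hp hn i]
      cases y <;> cases r.side p i h <;> simp [bsc] <;> ring
    have h1 : |bsc (r.noise p h) (!r.side p i h) y - bsc (r.noise p h) (r.side p i h) y| ≤ 1 := by
      rw [abs_le]
      cases y <;> cases r.side p i h <;> simp [bsc] <;> constructor <;> linarith [ha.1, ha.2]
    have h2 : |r.mixture p h y - 1 / 2| ≤ κ / 2 := by
      rw [e, abs_mul]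
      calc _ ≤ κ / 2 * 1 := mul_le_mul hop h1 (abs_nonneg _) (by linarith)
        _ = κ / 2 := mul_one _
    linarith [(abs_le.1 h2).2]
  have key : ∀ y, bsc (r.noise p h) (r.side p i h) y
        * Real.log (bsc (r.noise p h) (r.side p i h) y / (1 / 2))
      - κ * bsc (r.noise p h) (r.side p i h) y
      ≤ r.obs p i h y * Real.log (r.obs p i h y / r.mixture p h y) := by
    intro y
    have hf := r.obs_pos hp hn i h y
    have hM := r.mixture_pos hp hn h y
    have h1 : Real.log (r.obs p i h y / (1 / 2)) - κ
        ≤ Real.log (r.obs p i h y / r.mixture p h y) := by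
      rw [Real.log_div hf.ne' (by norm_num), Real.log_div hf.ne' hM.ne']
      have h2 : Real.log (r.mixture p h y) ≤ Real.log (1 / 2) + Real.log (1 + κ) := by
        rw [← Real.log_mul (by norm_num) (by linarith)]
        exact Real.log_le_log hM (by linarith [hmix y])
      have h3 := Real.log_le_sub_one_of_pos (by linarith : 0 < 1 + κ)
      linarith
    have h4 := mul_le_mul_of_nonneg_left h1 hf.le
    rw [obs] at h4 ⊢
    linarith
  have h5 := Finset.sum_le_sum fun y (_ : y ∈ Finset.univ) => key y
  rw [Finset.sum_sub_distrib, ← Finset.mul_sum, sum_bsc] at h5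
  simp only [KL] at h5 ⊢
  linarith

end SortPM

/-! ### Expected numbers of visits -/

namespace SortPM

lemma belief_nil (r : SortPM n) (i : Fin n) : r.belief p [] i = 1 / (n : ℝ) := rfl

lemma odds_nil (hn : 2 ≤ n) (r : SortPM n) (i : Fin n) :
    r.odds p i [] = n - 1 := by
  have hn0 : (n : ℝ) ≠ 0 := by positivity
  rw [odds, belief_nil]
  field_simp

/-- The potential is the square root of the odds: it starts below `√n`, and at each visit loses at
least `(1 - contraction p) √a` on average. -/
lemma sum_visits_ge_le (hp : IsNoiseProfile p) (hn : 2 ≤ n) (r : SortPM n) (i : Fin n) {a : ℝ}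
    (ha : 0 < a) (T : ℕ) :
    ∑ t ∈ Finset.range T, steps (r.obs p i) t (fun h => ind (a ≤ r.odds p i h)) []
      ≤ Real.sqrt (n / a) / (1 - contraction p) := by
  have hρ : 0 < 1 - contraction p := by linarith [hp.contraction_lt_one]
  have hsa := Real.sqrt_pos.2 ha
  have key := (r.isKernel_obs hp hn i).sum_steps_le_of_bound
    (V := fun h => Real.sqrt (r.odds p i h))
    (c := fun h => (1 - contraction p) * Real.sqrt a * ind (a ≤ r.odds p i h)) (m := 0)
    (fun h => by
      have h1 := r.step_sqrt_odds_le hp hn i h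
      have h2 : Real.sqrt a * ind (a ≤ r.odds p i h) ≤ Real.sqrt (r.odds p i h) := by
        by_cases hc : a ≤ r.odds p i h
        · rw [ind_of hc, mul_one]; exact Real.sqrt_le_sqrt hc
        · rw [ind_of_not hc, mul_zero]; exact Real.sqrt_nonneg _
      have h3 := mul_le_mul_of_nonneg_left h2 hρ.le
      linarith) (fun h => Real.sqrt_nonneg _) T []
  simp only [steps_const_mul, ← Finset.mul_sum, r.odds_nil hn, sub_zero] at key
  rw [le_div_iff₀ hρ, Real.sqrt_div (Nat.cast_nonneg n), le_div_iff₀ hsa]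
  have h4 : Real.sqrt ((n : ℝ) - 1) ≤ Real.sqrt n := Real.sqrt_le_sqrt (by linarith)
  linarith

/-- Truncating the square root of the odds at `√b` preserves the supermartingale property and makes
the starting value at most `√b`, so the bound does not depend on `n`. -/
lemma sum_visits_between_le (hp : IsNoiseProfile p) (hn : 2 ≤ n) (r : SortPM n) (i : Fin n)
    {a b : ℝ} (ha : 0 < a) (hb : 0 < b) (T : ℕ) :
    ∑ t ∈ Finset.range T,
        steps (r.obs p i) t (fun h => ind (a ≤ r.odds p i h ∧ r.odds p i h ≤ b)) []
      ≤ Real.sqrt (b / a) / (1 - contraction p) := by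
  have hρ : 0 < 1 - contraction p := by linarith [hp.contraction_lt_one]
  have hsa := Real.sqrt_pos.2 ha
  have hk := r.isKernel_obs hp hn i
  have key := hk.sum_steps_le_of_bound
    (V := fun h => min (Real.sqrt (r.odds p i h)) (Real.sqrt b))
    (c := fun h => (1 - contraction p) * Real.sqrt a *
      ind (a ≤ r.odds p i h ∧ r.odds p i h ≤ b)) (m := 0)
    (fun h => by
      have h1 := r.step_sqrt_odds_le hp hn i h
      have h2 : step (r.obs p i) (fun h => min (Real.sqrt (r.odds p i h)) (Real.sqrt b)) h
          ≤ step (r.obs p i) (fun h => Real.sqrt (r.odds p i h)) h :=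
        hk.step_mono (fun h => min_le_left _ _) h
      have h3 : step (r.obs p i) (fun h => min (Real.sqrt (r.odds p i h)) (Real.sqrt b)) h
          ≤ Real.sqrt b := by
        refine (hk.step_mono (fun h => min_le_right _ _) h).trans (le_of_eq ?_)
        exact congrFun (hk.steps_const 1 (Real.sqrt b)) h
      by_cases hc : a ≤ r.odds p i h ∧ r.odds p i h ≤ b
      · rw [ind_of hc, mul_one, min_eq_left (Real.sqrt_le_sqrt hc.2)]
        have h4 := mul_le_mul_of_nonneg_left (Real.sqrt_le_sqrt hc.1) hρ.le
        linarith
      · rw [ind_of_not hc, mul_zero, add_zero]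
        refine le_min (h2.trans (h1.trans ?_)) h3
        have := mul_nonneg hρ.le (Real.sqrt_nonneg (r.odds p i h))
        linarith) (fun h => le_min (Real.sqrt_nonneg _) (Real.sqrt_nonneg _)) T []
  simp only [steps_const_mul, ← Finset.mul_sum, sub_zero] at key
  rw [le_div_iff₀ hρ, Real.sqrt_div hb.le, le_div_iff₀ hsa]
  have h4 := min_le_right (Real.sqrt (r.odds p i [])) (Real.sqrt b)
  linarith

/-- While the query mass is close to `1/2`, the posterior of the target grows at the rate of the
mutual information. -/
lemma sum_informative_le (hp : IsNoiseProfile p) (hn : 2 ≤ n) (r : SortPM n) (i : Fin n) {κ I : ℝ}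
    (hκ : 0 ≤ κ) (hI : κ < I) (T : ℕ) :
    ∑ t ∈ Finset.range T, steps (r.obs p i) t
        (fun h => ind (|r.mass p h - 1 / 2| ≤ κ / 2 ∧ I ≤ infoBSC (1 / 2) (r.noise p h))) []
      ≤ Real.log n / (I - κ) := by
  have hI' : 0 < I - κ := by linarith
  -- The potential starts at `log n` and is nonnegative; its average decrease is a divergence, hence
  -- nonnegative even at uncounted steps.
  have key := (r.isKernel_obs hp hn i).sum_steps_le_of_bound
    (V := fun h => -Real.log (r.belief p h i))
    (c := fun h => (I - κ) *
      ind (|r.mass p h - 1 / 2| ≤ κ / 2 ∧ I ≤ infoBSC (1 / 2) (r.noise p h))) (m := 0)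
    (fun h => by
      rw [r.step_neg_log_belief hp hn]
      by_cases hc : |r.mass p h - 1 / 2| ≤ κ / 2 ∧ I ≤ infoBSC (1 / 2) (r.noise p h)
      · rw [ind_of hc]
        linarith [r.le_KL_mixture hp hn i h hκ hc.1]
      · rw [ind_of_not hc]
        linarith [KL_nonneg (r.obs_pos hp hn i h) (r.mixture_pos hp hn h) (r.sum_obs i h)
          (r.sum_mixture hp hn h)])
    (fun h => neg_nonneg.2 (Real.log_nonpos (r.belief_pos hp hn h i).le
      (r.belief_lt_one hp hn h i).le)) T []
  simp only [steps_const_mul, ← Finset.mul_sum, belief_nil, sub_zero] at key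
  have e : Real.log (1 / (n : ℝ)) = -Real.log n := by rw [one_div, Real.log_inv]
  rw [e, neg_neg] at key
  rw [le_div_iff₀ hI']
  linarith

lemma neg_log_odds_le_of_alive (hp : IsNoiseProfile p) (hn : 2 ≤ n) (r : SortPM n) {ε : ℝ}
    (hε : ε ∈ Set.Ioo (0 : ℝ) 1) {w : unitInterval} {h : List Bool} (i : Fin n)
    (ha : (r.strategy p ε).alive w h) :
    -Real.log (r.odds p i h) ≤ Real.log (1 / ε) := by
  have hε1 : 0 ≤ Real.log (1 / ε) := Real.log_nonneg (by rw [le_div_iff₀ hε.1]; linarith [hε.2])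
  by_cases hh : h = []
  · rw [hh, r.odds_nil hn]
    have : (2 : ℝ) ≤ n := by exact_mod_cast hn
    have := Real.log_nonneg (by linarith : (1 : ℝ) ≤ n - 1)
    linarith
  · have h1 : r.belief p h i ≤ 1 - ε := by
      by_contra hcon
      exact ha.2 ⟨hh, i, not_le.1 hcon⟩
    have hb := r.belief_pos hp hn h i
    have h2 : ε ≤ r.odds p i h := by
      rw [odds, le_div_iff₀ hb]
      nlinarith [hε.1, r.belief_lt_one hp hn h i]
    rw [one_div, Real.log_inv]
    have := Real.log_le_log hε.1 h2
    linarith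

/-- While bin `i` has most of the posterior mass, its log-odds grow at rate `C₁(p(δ))`. -/
lemma sum_confirmation_le (hp : IsNoiseProfile p) (hn : 2 ≤ n) (r : SortPM n) {ε : ℝ}
    (hε : ε ∈ Set.Ioo (0 : ℝ) 1) (w : unitInterval) (i : Fin n) {κ : ℝ} (hκ : 0 < κ)
    (hκ' : κ ≤ 1 / 3) (T : ℕ) :
    ∑ t ∈ Finset.range T, steps (r.obs p i) t
        (fun h => ind ((r.strategy p ε).alive w h ∧ 1 - κ < r.belief p h i)) []
      ≤ (Real.log (1 / ε) + Real.log ((1 - p (1 / (n : ℝ))) / p (1 / (n : ℝ))))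
        / C1 (p (1 / (n : ℝ))) := by
  classical
  have hpn := hp.mem _ (inv_nat_mem hn)
  have hC := C1_pos hpn.1 hpn.2
  have hk := r.isKernel_obs hp hn i
  have hε1 : 0 ≤ Real.log (1 / ε) := Real.log_nonneg (by rw [le_div_iff₀ hε.1]; linarith [hε.2])
  have hJ := log_odds_pos hpn.1 hpn.2
  set J := Real.log ((1 - p (1 / (n : ℝ))) / p (1 / (n : ℝ))) with hJdef
  set y₀ := Real.log ((1 - κ) / κ) with hy₀
  have hy₀' : 0 < y₀ := log_odds_pos hκ (by linarith)
  -- The floor `y₀` is the log-odds in favour of a bin of posterior `1 - κ`. A maximum with a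
  -- constant remains a submartingale, so flooring avoids paying for the initial climb or for
  -- excursions below the floor.
  set Φ : List Bool → ℝ := fun h => max (-Real.log (r.odds p i h)) y₀ with hΦ
  -- Dominates `Φ` even at the history that ends the search, where the threshold may be overshot by
  -- `J`. After the end the potential is frozen at `-M`; the total decrease is at most `M - y₀`.
  set M := Real.log (1 / ε) + y₀ + J with hM
  have hΦM : ∀ h, (r.strategy p ε).alive w h → Φ h ≤ Real.log (1 / ε) + y₀ := fun h ha =>
    max_le (by linarith [r.neg_log_odds_le_of_alive hp hn hε i ha]) (by linarith)
  have hjump : ∀ y h, Φ (y :: h) ≤ Φ h + J := by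
    intro y h
    refine max_le ?_ ?_
    · have h1 := r.neg_log_odds_cons_le hp hn i h y
      have h2 := le_max_left (-Real.log (r.odds p i h)) y₀
      simp only [hΦ]
      linarith
    · have h2 := le_max_right (-Real.log (r.odds p i h)) y₀
      simp only [hΦ]
      linarith
  have hsub1 : ∀ h, y₀ ≤ step (r.obs p i) Φ h := by
    intro h
    refine le_trans (le_of_eq ?_) (hk.step_mono (F := fun _ => y₀) (fun h => le_max_right _ _) h)
    exact (congrFun (hk.steps_const 1 y₀) h).symm
  have hsub2 : ∀ h, -step (r.obs p i) (fun h => Real.log (r.odds p i h)) h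
      ≤ step (r.obs p i) Φ h := by
    intro h
    refine le_trans (le_of_eq ?_) (hk.step_mono (F := fun h => -Real.log (r.odds p i h))
      (fun h => le_max_left _ _) h)
    simp [step]
  have key := hk.sum_steps_le_of_bound
    (V := fun h => if (r.strategy p ε).alive w h then -Φ h else -M)
    (c := fun h => C1 (p (1 / (n : ℝ))) *
      ind ((r.strategy p ε).alive w h ∧ 1 - κ < r.belief p h i)) (m := -M)
    (fun h => by
      by_cases ha : (r.strategy p ε).alive w h
      · have h1 : step (r.obs p i) (fun h => if (r.strategy p ε).alive w h then -Φ h else -M) h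
            ≤ -step (r.obs p i) Φ h := by
          rw [step, step, ← Finset.sum_neg_distrib]
          refine Finset.sum_le_sum fun y _ => ?_
          rw [← mul_neg]
          refine mul_le_mul_of_nonneg_left ?_ (hk.nonneg h y)
          split_ifs
          · exact le_rfl
          · linarith [hjump y h, hΦM h ha]
        rw [if_pos ha]
        by_cases hi : 1 - κ < r.belief p h i
        · rw [ind_of ⟨ha, hi⟩]
          have h2 := hsub2 h
          rw [r.step_log_odds_of_belief hp hn (by linarith)] at h2
          have h3 : Φ h = -Real.log (r.odds p i h) := by
            refine max_eq_left ?_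
            have hb := r.belief_pos hp hn h i
            have h4 : r.odds p i h ≤ κ / (1 - κ) := by
              rw [odds, div_le_div_iff₀ hb (by linarith)]
              nlinarith
            have h5 := Real.log_le_log (r.odds_pos hp hn i h) h4
            rw [hy₀, ← inv_div, Real.log_inv]
            linarith
          rw [h3]
          linarith
        · rw [ind_of_not fun h' => hi h'.2]
          have h2 := hsub2 h
          have h3 := r.step_log_odds_le hp hn i h
          have h4 : Φ h ≤ step (r.obs p i) Φ h := max_le (by linarith) (hsub1 h)
          linarith
      · rw [if_neg ha, ind_of_not fun h' => ha h'.1]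
        have h1 : ∀ y, ¬ (r.strategy p ε).alive w (y :: h) := fun y hy => ha hy.1
        simp only [step, h1, if_false, ← Finset.sum_mul, hk.sum_eq_one]
        linarith)
    (fun h => by
      split_ifs with ha
      · linarith [hΦM h ha]
      · exact le_rfl) T []
  have halive : (r.strategy p ε).alive w [] := ⟨trivial, fun h => h.1 rfl⟩
  simp only [steps_const_mul, ← Finset.mul_sum, halive, if_true] at key
  rw [le_div_iff₀ hC]
  have := le_max_right (-Real.log (r.odds p i [])) y₀
  simp only [hΦ, hM] at key
  linarith

/-! ### Averaging over the posterior -/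

/-- Drawing the target first and then the observations is the same as drawing the observations from
their marginal law and then the target from the posterior. One step is Bayes' rule with the
denominator cleared. -/
lemma average_eq (hp : IsNoiseProfile p) (hn : 2 ≤ n) (r : SortPM n) (t : ℕ)
    (F : Fin n → List Bool → ℝ) :
    (n : ℝ)⁻¹ * ∑ i, steps (r.obs p i) t (F i) []
      = steps (r.mixture p) t (fun h => ∑ j, r.belief p h j * F j h) [] := by
  induction t generalizing F with
  | zero => simp [belief_nil, Finset.mul_sum]
  | succ t ih =>
    simp only [steps_succ]
    rw [ih]
    congr 1
    ext h
    simp only [step, Finset.mul_sum]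
    rw [Finset.sum_comm]
    refine Finset.sum_congr rfl fun y _ => Finset.sum_congr rfl fun j _ => ?_
    rw [belief_cons]
    have := (r.mixture_pos hp hn h y).ne'
    field_simp

lemma kernel_eq (hp : IsNoiseProfile p) (hn : 2 ≤ n) (r : SortPM n) (ε : ℝ) (w : unitInterval)
    (i : Fin n) : (r.strategy p ε).kernel p w i = r.obs p i := by
  ext h y
  exact congrArg (fun a => bsc a (r.side p i h) y)
    (hp.crossover_eq (r.balanced hp hn h).nonempty (r.balanced hp hn h).ne_univ)

/-- SortPM uses no private randomness, so the seed can be fixed at `0`. -/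
lemma running_iff (r : SortPM n) (ε : ℝ) (w : unitInterval) (h : List Bool) :
    (r.strategy p ε).running w h ↔ (r.strategy p ε).running 0 h := by
  induction h with
  | nil => exact Iff.rfl
  | cons y h ih => exact and_congr ih Iff.rfl

lemma alive_iff (r : SortPM n) (ε : ℝ) (w : unitInterval) (h : List Bool) :
    (r.strategy p ε).alive w h ↔ (r.strategy p ε).alive 0 h :=
  and_congr (r.running_iff ε w h) Iff.rfl

lemma declares_iff (r : SortPM n) (ε : ℝ) (w : unitInterval) (i : Fin n) (h : List Bool) :
    (r.strategy p ε).declares w i h ↔ (r.strategy p ε).declares 0 i h :=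
  and_congr (r.running_iff ε w h) Iff.rfl

lemma mean_eq (hp : IsNoiseProfile p) (hn : 2 ≤ n) (r : SortPM n) (ε : ℝ) (t : ℕ)
    (F : Fin n → List Bool → ℝ) :
    (r.strategy p ε).mean p t (fun i _ h => F i h)
      = steps (r.mixture p) t (fun h => ∑ j, r.belief p h j * F j h) [] := by
  rw [← r.average_eq hp hn, Strategy.mean]
  simp [r.kernel_eq hp hn]

lemma mean_alive_eq (hp : IsNoiseProfile p) (hn : 2 ≤ n) (r : SortPM n) (ε : ℝ) (t : ℕ) :
    (r.strategy p ε).mean p t (fun _ w h => ind ((r.strategy p ε).alive w h))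
      = steps (r.mixture p) t (fun h => ind ((r.strategy p ε).alive 0 h)) [] := by
  simp only [r.alive_iff ε]
  rw [r.mean_eq hp hn ε t fun _ h => ind ((r.strategy p ε).alive 0 h)]
  simp only [← Finset.sum_mul, r.sum_belief hp hn, one_mul]

/-- A pointwise comparison with a cost that depends on the target bounds the expected time. -/
lemma sum_mean_alive_le_of (hp : IsNoiseProfile p) (hn : 2 ≤ n) (r : SortPM n) {ε : ℝ}
    {F : Fin n → List Bool → ℝ}
    (hF : ∀ h, ind ((r.strategy p ε).alive 0 h) ≤ ∑ j, r.belief p h j * F j h) {T : ℕ} {B : ℝ}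
    (hB : ∀ i, ∑ t ∈ Finset.range T, steps (r.obs p i) t (F i) [] ≤ B) :
    ∑ t ∈ Finset.range T,
      (r.strategy p ε).mean p t (fun _ w h => ind ((r.strategy p ε).alive w h)) ≤ B := by
  have hn0 : (0 : ℝ) < n := by positivity
  calc _ ≤ ∑ t ∈ Finset.range T, (n : ℝ)⁻¹ * ∑ i, steps (r.obs p i) t (F i) [] := by
        refine Finset.sum_le_sum fun t _ => ?_
        rw [r.mean_alive_eq hp hn, r.average_eq hp hn]
        exact (r.isKernel_mixture hp hn).steps_mono t hF []
    _ = (n : ℝ)⁻¹ * ∑ i, ∑ t ∈ Finset.range T, steps (r.obs p i) t (F i) [] := by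
        rw [← Finset.mul_sum, Finset.sum_comm]
    _ ≤ (n : ℝ)⁻¹ * ∑ _i : Fin n, B := by gcongr with i; exact hB i
    _ = B := by simp [hn0.ne']

/-- The sum of the expected costs of a linear combination. -/
lemma sum_steps_add_mul {q : List Bool → Bool → ℝ} (T : ℕ) (c : ℝ) (F G : List Bool → ℝ)
    (h : List Bool) :
    ∑ t ∈ Finset.range T, steps q t (fun h => F h + c * G h) h
      = ∑ t ∈ Finset.range T, steps q t F h + c * ∑ t ∈ Finset.range T, steps q t G h := by
  rw [Finset.mul_sum, ← Finset.sum_add_distrib]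
  refine Finset.sum_congr rfl fun t _ => ?_
  have h1 := congrFun (steps_add (q := q) t F fun h => c * G h) h
  rw [steps_const_mul] at h1
  exact h1

end SortPM

/-! ### The expected search time of sorted posterior matching -/

namespace SortPM

lemma one_le_sum_of_concentrated (hp : IsNoiseProfile p) (hn : 2 ≤ n) (r : SortPM n) {ε κ : ℝ}
    (hκ' : κ ≤ 1 / 3) {h : List Bool} (ha : (r.strategy p ε).alive 0 h) {i : Fin n}
    (hi : 1 - κ < r.belief p h i) :
    1 ≤ ∑ j, r.belief p h j *
      (1 / (1 - κ) * ind ((r.strategy p ε).alive 0 h ∧ 1 - κ < r.belief p h j)) := by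
  have hk : 0 < 1 - κ := by linarith
  have hpos := r.belief_pos hp hn h
  refine le_trans ?_ (Finset.single_le_sum (fun j _ => mul_nonneg (hpos j).le
    (mul_nonneg (by positivity) (ind_nonneg _))) (Finset.mem_univ i))
  rw [ind_of ⟨ha, hi⟩, mul_one, mul_one_div, le_div_iff₀ hk]
  linarith

/-- Used only for boundedly many `n`, where every history without a nearly certain bin may be
charged to odds at least `κ`. -/
lemma alive_le_of_small (hp : IsNoiseProfile p) (hn : 2 ≤ n) (r : SortPM n) {ε κ : ℝ}
    (hκ : 0 < κ) (hκ' : κ ≤ 1 / 3) (h : List Bool) :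
    ind ((r.strategy p ε).alive 0 h) ≤ ∑ j, r.belief p h j *
      (ind (κ ≤ r.odds p j h)
        + 1 / (1 - κ) * ind ((r.strategy p ε).alive 0 h ∧ 1 - κ < r.belief p h j)) := by
  have hpos := r.belief_pos hp hn h
  have hk : 0 < 1 - κ := by linarith
  by_cases ha : (r.strategy p ε).alive 0 h
  swap
  · rw [ind_of_not ha]
    exact Finset.sum_nonneg fun j _ => mul_nonneg (hpos j).le
      (add_nonneg (ind_nonneg _) (mul_nonneg (by positivity) (ind_nonneg _)))
  refine (ind_le_one _).trans ?_
  by_cases hc : ∃ i, 1 - κ < r.belief p h i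
  · obtain ⟨i, hi⟩ := hc
    refine (r.one_le_sum_of_concentrated hp hn hκ' ha hi).trans
      (Finset.sum_le_sum fun j _ => mul_le_mul_of_nonneg_left ?_ (hpos j).le)
    linarith [ind_nonneg (κ ≤ r.odds p j h)]
  · push Not at hc
    refine (r.sum_belief hp hn h).symm.le.trans (Finset.sum_le_sum fun j _ => ?_)
    have h1 : κ ≤ r.odds p j h := by
      rw [odds, le_div_iff₀ (hpos j)]
      nlinarith [hc j, r.belief_lt_one hp hn h j]
    rw [ind_of h1]
    have h2 : 0 ≤ 1 / (1 - κ) *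
      ind ((r.strategy p ε).alive 0 h ∧ 1 - κ < r.belief p h j) :=
      mul_nonneg (by positivity) (ind_nonneg _)
    nlinarith [hpos j]

/-- If the query set is large, then with probability at least `1/2` the odds against the target
are large. -/
lemma one_le_sum_of_large_query (hp : IsNoiseProfile p) (hn : 2 ≤ n) (r : SortPM n) {α : ℝ}
    (hα : 3 ≤ α * n)
    {h : List Bool} (hS : α * n < (r.query (r.belief p h)).card) :
    1 ≤ ∑ j, r.belief p h j * (2 * ind (α * n ≤ r.odds p j h)) := by
  have hpos := r.belief_pos hp hn h
  set S := r.query (r.belief p h) with hSdef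
  have hS2 : 2 ≤ S.card := by
    have : (3 : ℝ) < S.card := by linarith
    have : 3 < S.card := by exact_mod_cast this
    omega
  obtain ⟨m, hm, h1, h2, h3⟩ := (r.balanced hp hn h).card_sub_one_mul_le hS2
  have h4 : ∀ j ∈ (S.erase m)ᶜ, r.belief p h j ≤ r.belief p h j * (2 * ind (α * n ≤ r.odds p j h))
      - r.belief p h j := by
    intro j hj
    have h5 := h1 j (Finset.mem_compl.1 hj)
    -- Since `(|S| - 1) π m ≤ (1 - π m)/2`, the odds against any bin at most as likely as `m` are at
    -- least `2 (|S| - 1)`, which exceeds `α n` as `α n ≥ 3`.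
    have h6 : α * n ≤ r.odds p j h := by
      rw [odds, le_div_iff₀ (hpos j)]
      nlinarith [hpos j, hpos m]
    rw [ind_of h6]
    linarith
  have h5 := Finset.sum_le_sum h4
  rw [Finset.sum_sub_distrib] at h5
  have h6 := Finset.sum_add_sum_compl (S.erase m) (r.belief p h)
  rw [r.sum_belief hp hn] at h6
  have h7 : ∑ j ∈ (S.erase m)ᶜ, r.belief p h j * (2 * ind (α * n ≤ r.odds p j h))
      ≤ ∑ j, r.belief p h j * (2 * ind (α * n ≤ r.odds p j h)) :=
    Finset.sum_le_sum_of_subset_of_nonneg (Finset.subset_univ _) fun j _ _ =>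
      mul_nonneg (hpos j).le (mul_nonneg zero_le_two (ind_nonneg _))
  linarith [hpos m]

lemma alive_le_of_large (hp : IsNoiseProfile p) (hn : 2 ≤ n) (r : SortPM n) {ε κ α : ℝ}
    (hκ : 0 < κ) (hκ' : κ ≤ 1 / 3) (hα : α ∈ Set.Ioo (0 : ℝ) 1) (hαn : 3 ≤ α * n) (h : List Bool) :
    ind ((r.strategy p ε).alive 0 h) ≤ ∑ j, r.belief p h j *
      (ind (|r.mass p h - 1 / 2| ≤ κ / 2 ∧
          infoBSC (1 / 2) (p α) ≤ infoBSC (1 / 2) (r.noise p h))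
        + 2 * ind (α * n ≤ r.odds p j h)
        + 1 / κ * ind (κ ≤ r.odds p j h ∧ r.odds p j h ≤ 1 / κ)
        + 1 / (1 - κ) * ind ((r.strategy p ε).alive 0 h ∧ 1 - κ < r.belief p h j)) := by
  have hpos := r.belief_pos hp hn h
  have hk : 0 < 1 - κ := by linarith
  set a := ind (|r.mass p h - 1 / 2| ≤ κ / 2 ∧
    infoBSC (1 / 2) (p α) ≤ infoBSC (1 / 2) (r.noise p h)) with ha_def
  have e1 : 0 ≤ a := ind_nonneg _
  have e2 : ∀ j, 0 ≤ 2 * ind (α * n ≤ r.odds p j h) := fun j =>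
    mul_nonneg zero_le_two (ind_nonneg _)
  have e3 : ∀ j, 0 ≤ 1 / κ * ind (κ ≤ r.odds p j h ∧ r.odds p j h ≤ 1 / κ) := fun j =>
    mul_nonneg (by positivity) (ind_nonneg _)
  have e4 : ∀ j, 0 ≤ 1 / (1 - κ) *
      ind ((r.strategy p ε).alive 0 h ∧ 1 - κ < r.belief p h j) := fun j =>
    mul_nonneg (by positivity) (ind_nonneg _)
  have mono : ∀ f : Fin n → ℝ, 1 ≤ ∑ j, r.belief p h j * f j →
      (∀ j, f j ≤ a + 2 * ind (α * n ≤ r.odds p j h)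
        + 1 / κ * ind (κ ≤ r.odds p j h ∧ r.odds p j h ≤ 1 / κ)
        + 1 / (1 - κ) * ind ((r.strategy p ε).alive 0 h ∧ 1 - κ < r.belief p h j)) →
      1 ≤ ∑ j, r.belief p h j * (a + 2 * ind (α * n ≤ r.odds p j h)
        + 1 / κ * ind (κ ≤ r.odds p j h ∧ r.odds p j h ≤ 1 / κ)
        + 1 / (1 - κ) * ind ((r.strategy p ε).alive 0 h ∧ 1 - κ < r.belief p h j)) :=
    fun f hf hle => hf.trans
      (Finset.sum_le_sum fun j _ => mul_le_mul_of_nonneg_left (hle j) (hpos j).le)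
  by_cases ha : (r.strategy p ε).alive 0 h
  swap
  · rw [ind_of_not ha]
    exact Finset.sum_nonneg fun j _ => mul_nonneg (hpos j).le
      (by linarith [e1, e2 j, e3 j, e4 j])
  refine (ind_le_one _).trans ?_
  by_cases hc : ∃ i, 1 - κ < r.belief p h i
  · obtain ⟨i, hi⟩ := hc
    exact mono _ (r.one_le_sum_of_concentrated hp hn hκ' ha hi)
      fun j => by linarith [e1, e2 j, e3 j, e4 j]
  push Not at hc
  by_cases hc2 : ∃ i, κ < r.belief p h i
  · obtain ⟨i, hi⟩ := hc2
    -- The target is this bin with posterior probability only more than `κ`; the weight `1 / κ`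
    -- compensates.
    refine mono (fun j => 1 / κ * ind (κ ≤ r.odds p j h ∧ r.odds p j h ≤ 1 / κ)) ?_
      fun j => by linarith [e1, e2 j, e3 j, e4 j]
    refine le_trans ?_ (Finset.single_le_sum (fun j _ => mul_nonneg (hpos j).le (e3 j))
      (Finset.mem_univ i))
    have h1 : κ ≤ r.odds p i h := by
      rw [odds, le_div_iff₀ (hpos i)]
      nlinarith [hc i, r.belief_lt_one hp hn h i]
    have h2 : r.odds p i h ≤ 1 / κ := by
      rw [odds, div_le_div_iff₀ (hpos i) hκ]
      nlinarith [hpos i, r.belief_lt_one hp hn h i]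
    rw [ind_of ⟨h1, h2⟩, mul_one, mul_one_div, le_div_iff₀ hκ]
    linarith
  push Not at hc2
  rcases lt_or_ge (α * n) ((r.query (r.belief p h)).card : ℝ) with hS | hS
  · exact mono _ (r.one_le_sum_of_large_query hp hn hαn hS)
      fun j => by linarith [e1, e2 j, e3 j, e4 j]
  · refine mono (fun _ => a) ?_ fun j => by linarith [e1, e2 j, e3 j, e4 j]
    have hb := r.balanced hp hn h
    have hmem := card_div_mem hb.nonempty hb.ne_univ
    have h1 : r.noise p h ≤ p α := by
      refine hp.mono hmem hα ?_
      rw [div_le_iff₀ (by positivity)]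
      exact hS
    have h2 : infoBSC (1 / 2) (p α) ≤ infoBSC (1 / 2) (r.noise p h) :=
      infoBSC_half_anti (r.noise_mem hp hn h).1.le h1 (hp.mem α hα).2.le
    rw [← Finset.sum_mul, r.sum_belief hp hn, ha_def,
      ind_of ⟨hb.abs_mass_sub_le (by linarith) hc2, h2⟩, one_mul]

lemma log_odds_div_C1_le (hp : IsNoiseProfile p) (hn : 2 ≤ n) :
    Real.log ((1 - p (1 / (n : ℝ))) / p (1 / (n : ℝ))) / C1 (p (1 / (n : ℝ)))
      ≤ 1 / (1 - 2 * p (1 / 2)) := by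
  have hpn := hp.mem _ (inv_nat_mem hn)
  have hhalf := hp.half_mem
  have hJ := log_odds_pos hpn.1 hpn.2
  have hle : p (1 / (n : ℝ)) ≤ p (1 / 2) := by
    refine hp.mono (inv_nat_mem hn) ⟨by norm_num, by norm_num⟩ ?_
    have : (2 : ℝ) ≤ n := by exact_mod_cast hn
    gcongr
  rw [C1_eq, div_mul_cancel_right₀ hJ.ne', ← one_div]
  exact one_div_le_one_div_of_le (by linarith [hhalf.2]) (by linarith)

/-- The expected search time, up to a constant that depends only on the noise profile and on the
thresholds `κ` and `α`. -/
lemma exists_sum_mean_alive_le (hp : IsNoiseProfile p) {κ α : ℝ} (hκ : 0 < κ) (hκ' : κ ≤ 1 / 3)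
    (hα : α ∈ Set.Ioo (0 : ℝ) 1) (hI : κ < infoBSC (1 / 2) (p α)) :
    ∃ K : ℝ, 0 ≤ K ∧ ∀ (n : ℕ) (ε : ℝ), 2 ≤ n → ε ∈ Set.Ioo (0 : ℝ) 1 → ∀ (r : SortPM n) (T : ℕ),
      ∑ t ∈ Finset.range T,
        (r.strategy p ε).mean p t (fun _ w h => ind ((r.strategy p ε).alive w h))
      ≤ Real.log n / (infoBSC (1 / 2) (p α) - κ)
        + 1 / (1 - κ) * (Real.log (1 / ε) / C1 (p (1 / (n : ℝ)))) + K := by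
  have hρ : 0 < 1 - contraction p := by linarith [hp.contraction_lt_one]
  have hhalf := hp.half_mem
  have hk : 0 < 1 - κ := by linarith
  have hh : 0 < 1 - 2 * p (1 / 2) := by linarith [hhalf.2]
  have hα0 := hα.1
  set K₁ := 2 * (Real.sqrt (1 / α) / (1 - contraction p)) with hK₁
  set K₂ := 1 / κ * (Real.sqrt (1 / κ / κ) / (1 - contraction p)) with hK₂
  set K₃ := 1 / (1 - κ) * (1 / (1 - 2 * p (1 / 2))) with hK₃
  set K₄ := Real.sqrt (3 / α / κ) / (1 - contraction p) with hK₄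
  have p1 : 0 ≤ K₁ := by positivity
  have p2 : 0 ≤ K₂ := by positivity
  have p3 : 0 ≤ K₃ := by positivity
  have p4 : 0 ≤ K₄ := by positivity
  refine ⟨K₁ + K₂ + K₃ + K₄, by positivity, fun n ε hn hε r T => ?_⟩
  have hn0 : (0 : ℝ) < n := by positivity
  have hD : ∀ i, 1 / (1 - κ) * ∑ t ∈ Finset.range T, steps (r.obs p i) t
        (fun h => ind ((r.strategy p ε).alive 0 h ∧ 1 - κ < r.belief p h i)) []
      ≤ 1 / (1 - κ) * (Real.log (1 / ε) / C1 (p (1 / (n : ℝ)))) + K₃ := by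
    intro i
    rw [hK₃, ← mul_add]
    refine mul_le_mul_of_nonneg_left ?_ (by positivity)
    refine (r.sum_confirmation_le hp hn hε 0 i hκ hκ' T).trans ?_
    rw [add_div]
    linarith [log_odds_div_C1_le hp hn]
  -- For `n < 3 / α` the whole search before confirmation costs a constant.
  rcases lt_or_ge (α * n) 3 with hαn | hαn
  · refine r.sum_mean_alive_le_of hp hn (r.alive_le_of_small hp hn hκ hκ') fun i => ?_
    rw [sum_steps_add_mul]
    have h1 := r.sum_visits_ge_le hp hn i hκ T
    have h2 : Real.sqrt (n / κ) / (1 - contraction p) ≤ K₄ := by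
      refine div_le_div_of_nonneg_right (Real.sqrt_le_sqrt ?_) hρ.le
      refine div_le_div_of_nonneg_right ?_ hκ.le
      rw [le_div_iff₀ hα0]
      linarith
    have h3 : 0 ≤ Real.log n / (infoBSC (1 / 2) (p α) - κ) :=
      div_nonneg (Real.log_natCast_nonneg n) (by linarith)
    linarith [hD i]
  · refine r.sum_mean_alive_le_of hp hn (r.alive_le_of_large hp hn hκ hκ' hα hαn) fun i => ?_
    rw [sum_steps_add_mul, sum_steps_add_mul, sum_steps_add_mul]
    have h1 := r.sum_informative_le hp hn i hκ.le hI T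
    -- At the threshold `α n` the dependence on `n` cancels: the ratio of initial odds to threshold
    -- is at most `1 / α`.
    have h2 := r.sum_visits_ge_le hp hn i (mul_pos hα0 hn0) T
    have h3 := r.sum_visits_between_le hp hn i hκ (one_div_pos.2 hκ) T
    have h4 : (n : ℝ) / (α * n) = 1 / α := by field_simp
    rw [h4] at h2
    have h5 := mul_le_mul_of_nonneg_left h3 (one_div_pos.2 hκ).le
    linarith [hD i]

end SortPM

lemma IsNoiseProfile.exists_info_ge (hp : IsNoiseProfile p) {κ : ℝ} (hκ : 0 < κ) :
    ∃ α ∈ Set.Ioo (0 : ℝ) 1, infoBSC (1 / 2) (pMin p) - κ ≤ infoBSC (1 / 2) (p α) := by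
  have hc := Real.binEntropy_continuous.tendsto (pMin p)
  obtain ⟨d, hd, hball⟩ := Metric.tendsto_nhds_nhds.1 hc κ hκ
  obtain ⟨_, ⟨x, hx, rfl⟩, hlt⟩ := exists_lt_of_csInf_lt
    (s := p '' Set.Ioo 0 1) ⟨_, 1 / 2, ⟨by norm_num, by norm_num⟩, rfl⟩
    (show sInf (p '' Set.Ioo 0 1) < pMin p + d by rw [← pMin]; linarith)
  refine ⟨x, hx, ?_⟩
  have h1 := hp.pMin_le hx
  have h2 := hp.mem x hx
  rw [infoBSC_half hp.pMin_nonneg (by linarith [hp.pMin_lt]),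
    infoBSC_half h2.1.le (by linarith [h2.2])]
  have h3 := hball (x := p x) (by rw [Real.dist_eq, abs_of_nonneg (by linarith)]; linarith)
  rw [Real.dist_eq] at h3
  linarith [(abs_lt.1 h3).2]

lemma IsNoiseProfile.C1_half_le (hp : IsNoiseProfile p) (hn : 2 ≤ n) :
    C1 (p (1 / 2)) ≤ C1 (p (1 / (n : ℝ))) := by
  have hpn := hp.mem _ (inv_nat_mem hn)
  refine C1_anti hpn.1 (hp.mono (inv_nat_mem hn) ⟨by norm_num, by norm_num⟩ ?_) hp.half_mem.2
  have : (2 : ℝ) ≤ n := by exact_mod_cast hn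
  gcongr

/-- The expected search time of sorted posterior matching, up to an arbitrarily small multiple of
`log (1/(δε))` and a constant. -/
theorem IsNoiseProfile.exists_sum_mean_alive_le (hp : IsNoiseProfile p) {η : ℝ} (hη : 0 < η) :
    ∃ K : ℝ, 0 ≤ K ∧ ∀ (n : ℕ) (ε : ℝ), 2 ≤ n → ε ∈ Set.Ioo (0 : ℝ) 1 → ∀ (r : SortPM n) (T : ℕ),
      ∑ t ∈ Finset.range T,
        (r.strategy p ε).mean p t (fun _ w h => ind ((r.strategy p ε).alive w h))
      ≤ Real.log n / infoBSC (1 / 2) (pMin p) + Real.log (1 / ε) / C1 (p (1 / (n : ℝ)))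
        + η * Real.log (n / ε) + K := by
  have hI := hp.info_pMin_pos
  have hhalf := hp.half_mem
  have hc := C1_pos hhalf.1 hhalf.2
  set I := infoBSC (1 / 2) (pMin p)
  set c := C1 (p (1 / 2))
  -- One `κ` is lost by passing from `p_min` to `p(α)`, the other by the imbalance of the query.
  have t1 : Tendsto (fun κ : ℝ => 1 / (I - κ - κ)) (𝓝[>] 0) (𝓝 (1 / (I - 0 - 0))) := by
    have : ContinuousAt (fun κ : ℝ => 1 / (I - κ - κ)) 0 :=
      ContinuousAt.div (by fun_prop) (by fun_prop) (by simpa using hI.ne')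
    exact this.tendsto.mono_left nhdsWithin_le_nhds
  have t2 : Tendsto (fun κ : ℝ => 1 / (1 - κ)) (𝓝[>] 0) (𝓝 (1 / (1 - 0))) := by
    have : ContinuousAt (fun κ : ℝ => 1 / (1 - κ)) 0 :=
      ContinuousAt.div (by fun_prop) (by fun_prop) (by norm_num)
    exact this.tendsto.mono_left nhdsWithin_le_nhds
  have ev1 := t1.eventually (eventually_lt_nhds
    (show 1 / (I - 0 - 0) < 1 / I + η by rw [sub_zero, sub_zero]; linarith))
  -- The relative slack `η c` suffices because `c = C₁(p(1/2))` is at most `C₁(p(δ))`, so the excess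
  -- is at most `η log (1/ε)` uniformly in `n`.
  have ev2 := t2.eventually (eventually_lt_nhds
    (show 1 / (1 - (0 : ℝ)) < 1 + η * c by rw [sub_zero, div_one]; nlinarith))
  have ev3 : ∀ᶠ κ : ℝ in 𝓝[>] 0, κ < min (1 / 3) (I / 2) :=
    (eventually_lt_nhds (lt_min (by norm_num) (by linarith))).filter_mono nhdsWithin_le_nhds
  obtain ⟨κ, h1, h2, h3, hκ⟩ :=
    (ev1.and (ev2.and (ev3.and (self_mem_nhdsWithin : Set.Ioi (0 : ℝ) ∈ 𝓝[>] 0)))).exists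
  have hκ : 0 < κ := hκ
  have h3a := h3.trans_le (min_le_left _ _)
  have h3b := h3.trans_le (min_le_right _ _)
  obtain ⟨α, hα, hIα⟩ := hp.exists_info_ge hκ
  obtain ⟨K, hK0, hK⟩ := SortPM.exists_sum_mean_alive_le hp hκ h3a.le hα (by linarith)
  refine ⟨K, hK0, fun n ε hn hε r T => (hK n ε hn hε r T).trans ?_⟩
  have hn0 : (0 : ℝ) < n := by positivity
  have hlogn : 0 ≤ Real.log n := Real.log_natCast_nonneg n
  have hε1 : 0 ≤ Real.log (1 / ε) := Real.log_nonneg (by rw [le_div_iff₀ hε.1]; linarith [hε.2])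
  have hcn := hp.C1_half_le hn
  have hL : Real.log (n / ε) = Real.log n + Real.log (1 / ε) := by
    rw [← Real.log_mul hn0.ne' (one_div_pos.2 hε.1).ne', mul_one_div]
  have b1 : Real.log n / (infoBSC (1 / 2) (p α) - κ) ≤ Real.log n / I + η * Real.log n := by
    have e1 : Real.log n / (infoBSC (1 / 2) (p α) - κ) ≤ Real.log n / (I - κ - κ) :=
      div_le_div_of_nonneg_left hlogn (by linarith) (by linarith)
    have e2 := mul_le_mul_of_nonneg_left h1.le hlogn
    rw [mul_one_div] at e2
    refine e1.trans (e2.trans (le_of_eq ?_))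
    ring
  have b2 : 1 / (1 - κ) * (Real.log (1 / ε) / C1 (p (1 / (n : ℝ))))
      ≤ Real.log (1 / ε) / C1 (p (1 / (n : ℝ))) + η * Real.log (1 / ε) := by
    have e0 : 0 ≤ Real.log (1 / ε) / C1 (p (1 / (n : ℝ))) := div_nonneg hε1 (by linarith)
    have e1 := mul_le_mul_of_nonneg_right h2.le e0
    have e2 : Real.log (1 / ε) / C1 (p (1 / (n : ℝ))) ≤ Real.log (1 / ε) / c :=
      div_le_div_of_nonneg_left hε1 hc hcn
    have e3 : c * (Real.log (1 / ε) / c) = Real.log (1 / ε) := mul_div_cancel₀ _ hc.ne'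
    have e4 := mul_le_mul_of_nonneg_left e2 (mul_pos hη hc).le
    have e5 : η * c * (Real.log (1 / ε) / c) = η * Real.log (1 / ε) := by rw [mul_assoc, e3]
    linarith
  rw [hL]
  linarith

/-! ### Reliability of sorted posterior matching -/

/-- The bound on the expected time makes the probabilities of still searching summable, so the
search ends almost surely. At the end, the declared bin has posterior above `1 - ε`, and averaging
over the posterior gives the success probability. -/
theorem SortPM.reliable (hp : IsNoiseProfile p) (hn : 2 ≤ n) (r : SortPM n) {ε : ℝ}
    (hε : ε ∈ Set.Ioo (0 : ℝ) 1) : (r.strategy p ε).Reliable p ε := by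
  have : NeZero n := ⟨by omega⟩
  obtain ⟨K, -, hK⟩ := hp.exists_sum_mean_alive_le one_pos
  have hK := hK n ε hn hε r
  set B := Real.log n / infoBSC (1 / 2) (pMin p) + Real.log (1 / ε) / C1 (p (1 / (n : ℝ)))
        + 1 * Real.log (n / ε) + K
  have hk := r.isKernel_mixture hp hn
  set A := r.strategy p ε with hA
  simp only [hA, r.mean_alive_eq hp hn] at hK
  have hsm : Summable fun t => steps (r.mixture p) t (fun h => ind (A.alive 0 h)) [] :=
    summable_of_sum_range_le (fun t => hk.steps_nonneg t (fun _ => ind_nonneg _) []) hK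
  refine Strategy.reliable_of_sum_mean fun c hc => ?_
  obtain ⟨t, ht⟩ := (hsm.tendsto_atTop_zero.eventually
    (eventually_lt_nhds (show (0 : ℝ) < 1 - ε - c by linarith))).exists
  refine ⟨t + 1, ?_⟩
  -- With the sign reversed, the potential inequality bounds the probability of having stopped from
  -- below, by one minus that of still searching after `t` observations.
  have hV : ∀ h, step (r.mixture p) (fun h => -ind (A.running 0 h)) h
      + -ind (A.running 0 h ∧ A.halt 0 h) ≤ -ind (A.running 0 h) := by
    intro h
    have h1 : step (r.mixture p) (fun h => -ind (A.running 0 h)) h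
        = -ind (A.running 0 h ∧ ¬ A.halt 0 h) := by
      simp only [step, Strategy.running, ← Finset.sum_mul, hk.sum_eq_one, one_mul]
    rw [h1]
    by_cases hr : A.running 0 h <;> by_cases hh : A.halt 0 h <;> simp [ind, hr, hh]
  have h1 := hk.sum_steps_le hV (t + 1) []
  have e1 : ∀ s, steps (r.mixture p) s (fun h => -ind (A.running 0 h ∧ A.halt 0 h)) []
      = -steps (r.mixture p) s (fun h => ind (A.running 0 h ∧ A.halt 0 h)) [] := by
    intro s
    have := congrFun (steps_const_mul (q := r.mixture p) s (-1)
      fun h => ind (A.running 0 h ∧ A.halt 0 h)) []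
    simpa using this
  have e2 : steps (r.mixture p) (t + 1) (fun h => -ind (A.running 0 h)) []
      = -steps (r.mixture p) t (fun h => ind (A.alive 0 h)) [] := by
    have h2 := congrFun (steps_const_mul (q := r.mixture p) (t + 1) (-1)
      fun h => ind (A.running 0 h)) []
    have h3 : step (r.mixture p) (fun h => ind (A.running 0 h)) = fun h => ind (A.alive 0 h) := by
      ext h
      simp only [step, Strategy.running, ← Finset.sum_mul, hk.sum_eq_one, one_mul]
      rfl
    simp only [neg_one_mul] at h2
    rw [h2, steps_succ, h3]
  have e3 : ind (A.running 0 []) = 1 := ind_of trivial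
  simp only [e1, e2, e3, Finset.sum_neg_distrib] at h1
  have h2 : ∀ s, (1 - ε) * steps (r.mixture p) s (fun h => ind (A.running 0 h ∧ A.halt 0 h)) []
      ≤ A.mean p s fun i w h => ind (A.declares w i h) := by
    intro s
    simp only [hA, r.declares_iff ε]
    rw [r.mean_eq hp hn ε s fun i h => ind ((r.strategy p ε).declares 0 i h)]
    rw [← congrFun (steps_const_mul (q := r.mixture p) s (1 - ε)
      fun h => ind (A.running 0 h ∧ A.halt 0 h)) []]
    refine hk.steps_mono s (fun h => ?_) []
    have hnn : ∀ j ∈ Finset.univ, 0 ≤ r.belief p h j * ind (A.declares 0 j h) := fun j _ =>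
      mul_nonneg (r.belief_pos hp hn h j).le (ind_nonneg _)
    by_cases hc : A.running 0 h ∧ A.halt 0 h
    · refine le_trans ?_ (Finset.single_le_sum hnn (Finset.mem_univ (r.best (r.belief p h))))
      rw [ind_of hc, ind_of (show A.declares 0 (r.best (r.belief p h)) h from ⟨hc.1, hc.2, rfl⟩)]
      obtain ⟨-, i, hi⟩ := hc.2
      linarith [r.isBest (r.belief p h) i]
    · rw [ind_of_not hc, mul_zero]
      exact Finset.sum_nonneg hnn
  refine le_trans ?_ (Finset.sum_le_sum fun s _ => h2 s)
  rw [← Finset.mul_sum]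
  nlinarith [hε.1, hε.2]

/-! ### The asymptotic statements -/

lemma ofReal_le_ofReal_div {R L : ℝ} {E : ℝ≥0∞} (hR : 0 < R) (hL : 0 < L)
    (h : E ≤ ENNReal.ofReal (L / R)) : ENNReal.ofReal R ≤ ENNReal.ofReal L / E := by
  rw [ENNReal.le_div_iff_mul_le (Or.inr (by simpa using hL)) (Or.inr ENNReal.ofReal_ne_top)]
  calc _ ≤ ENNReal.ofReal R * ENNReal.ofReal (L / R) := by gcongr
    _ = ENNReal.ofReal L := by rw [← ENNReal.ofReal_mul hR.le, mul_div_cancel₀ _ hR.ne']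

lemma ofReal_div_le_ofReal {R L : ℝ} {E : ℝ≥0∞} (hR : 0 < R)
    (h : ENNReal.ofReal (L / R) ≤ E) : ENNReal.ofReal L / E ≤ ENNReal.ofReal R := by
  refine ENNReal.div_le_of_le_mul ?_
  calc ENNReal.ofReal L = ENNReal.ofReal R * ENNReal.ofReal (L / R) := by
        rw [← ENNReal.ofReal_mul hR.le, mul_div_cancel₀ _ hR.ne']
    _ ≤ _ := by gcongr

lemma log_div_eq {n : ℕ} {ε : ℝ} (hn : 2 ≤ n) (hε : 0 < ε) :
    Real.log (n / ε) = Real.log n + Real.log (1 / ε) := by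
  rw [← Real.log_mul (by positivity) (one_div_pos.2 hε).ne', mul_one_div]

lemma log_one_div_nonneg {ε : ℝ} (hε : ε ∈ Set.Ioo (0 : ℝ) 1) : 0 ≤ Real.log (1 / ε) :=
  Real.log_nonneg (by rw [le_div_iff₀ hε.1]; linarith [hε.2])

lemma tendsto_log_searchLimit :
    Tendsto (fun x : ℕ × ℝ => Real.log ((x.1 : ℝ) / x.2)) searchLimit atTop :=
  Real.tendsto_log_atTop.comp (tendsto_comap.mono_left inf_le_left)

lemma tendsto_log_natCast : Tendsto (fun n : ℕ => Real.log n) atTop atTop :=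
  Real.tendsto_log_atTop.comp tendsto_natCast_atTop_atTop

lemma tendsto_log_one_div : Tendsto (fun ε : ℝ => Real.log (1 / ε)) (𝓝[>] 0) atTop := by
  simp only [one_div]
  exact Real.tendsto_log_atTop.comp tendsto_inv_nhdsGT_zero

lemma eventually_mem_Ioo : ∀ᶠ ε : ℝ in 𝓝[>] 0, ε ∈ Set.Ioo (0 : ℝ) 1 :=
  Ioo_mem_nhdsGT one_pos

namespace IsNoiseProfile

theorem exists_isLittleO_bound (hp : IsNoiseProfile p) :
    ∃ g : ℕ × ℝ → ℝ, (g =o[searchLimit] fun x => Real.log ((x.1 : ℝ) / x.2)) ∧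
      ∀ (n : ℕ) (ε : ℝ), 2 ≤ n → ε ∈ Set.Ioo (0 : ℝ) 1 → ∀ r : SortPM n,
        (r.strategy p ε).expectedTime p ≤ ENNReal.ofReal (Real.log n / infoBSC (1 / 2) (pMin p)
          + Real.log (1 / ε) / C1 (p (1 / (n : ℝ))) + g (n, ε)) := by
  choose K hK0 hK using fun m : ℕ =>
    hp.exists_sum_mean_alive_le (η := 1 / ((m : ℝ) + 1)) (by positivity)
  have hL : ∀ (n : ℕ) (ε : ℝ), 2 ≤ n → ε ∈ Set.Ioo (0 : ℝ) 1 → 0 ≤ Real.log ((n : ℝ) / ε) := by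
    intro n ε hn hε
    rw [log_div_eq hn hε.1]
    exact add_nonneg (Real.log_natCast_nonneg n) (log_one_div_nonneg hε)
  have hnn : ∀ (n : ℕ) (ε : ℝ), 2 ≤ n → ε ∈ Set.Ioo (0 : ℝ) 1 → ∀ m : ℕ,
      0 ≤ 1 / ((m : ℝ) + 1) * Real.log ((n : ℝ) / ε) + K m := fun n ε hn hε m =>
    add_nonneg (mul_nonneg (by positivity) (hL n ε hn hε)) (hK0 m)
  -- The lower envelope of the bounds for `η = 1/(m + 1)`: each bound holds for all `n` and `ε`, so
  -- their infimum does, and it is eventually below any multiple of the logarithm.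
  refine ⟨fun x => ⨅ m : ℕ, (1 / ((m : ℝ) + 1) * Real.log ((x.1 : ℝ) / x.2) + K m), ?_, ?_⟩
  · refine Asymptotics.isLittleO_iff.2 fun c hc => ?_
    obtain ⟨m, hm⟩ := exists_nat_one_div_lt (half_pos hc)
    have hreg : ∀ᶠ x : ℕ × ℝ in searchLimit, 2 ≤ x.1 ∧ x.2 ∈ Set.Ioo (0 : ℝ) 1 :=
      mem_inf_of_right (mem_principal_self _)
    filter_upwards [hreg, tendsto_log_searchLimit.eventually_ge_atTop (K m / (c / 2))]
      with x hx hx2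
    have h0 := hL x.1 x.2 hx.1 hx.2
    have h1 : (⨅ m : ℕ, (1 / ((m : ℝ) + 1) * Real.log ((x.1 : ℝ) / x.2) + K m))
        ≤ 1 / ((m : ℝ) + 1) * Real.log ((x.1 : ℝ) / x.2) + K m :=
      ciInf_le ⟨0, by rintro _ ⟨m, rfl⟩; exact hnn x.1 x.2 hx.1 hx.2 m⟩ m
    rw [Real.norm_of_nonneg (Real.iInf_nonneg (hnn x.1 x.2 hx.1 hx.2)), Real.norm_of_nonneg h0]
    rw [div_le_iff₀ (half_pos hc)] at hx2
    have h2 := mul_le_mul_of_nonneg_right hm.le h0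
    linarith
  · intro n ε hn hε r
    have : NeZero n := ⟨by omega⟩
    refine Strategy.expectedTime_le p _ fun T => ?_
    rw [← sub_le_iff_le_add']
    refine le_ciInf fun m => ?_
    have := hK m n ε hn hε r T
    linarith

lemma log_div_info_le (hp : IsNoiseProfile p) {α : ℝ} (hα : α ∈ Set.Ioo (0 : ℝ) 1)
    (n : ℕ) :
    Real.log n / infoBSC (1 / 2) (pMin p) ≤ Real.log n / infoBSC (1 / 2) (p α) :=
  div_le_div_of_nonneg_left (Real.log_natCast_nonneg n)
    (infoBSC_half_pos (hp.mem α hα).1.le (hp.mem α hα).2)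
    (infoBSC_half_anti hp.pMin_nonneg (hp.pMin_le hα) (hp.mem α hα).2.le)

theorem rate_achieved (hp : IsNoiseProfile p) {ε : ℝ} (hε : ε ∈ Set.Ioo (0 : ℝ) 1) {R : ℝ}
    (hR : R < infoBSC (1 / 2) (pMin p)) :
    ∀ᶠ n : ℕ in atTop, ∀ r : SortPM n,
      ENNReal.ofReal R ≤ ENNReal.ofReal (Real.log n) / (r.strategy p ε).expectedTime p := by
  rcases le_or_gt R 0 with hR0 | hR0
  · exact Eventually.of_forall fun n r => by rw [ENNReal.ofReal_of_nonpos hR0]; exact zero_le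
  have hI := hp.info_pMin_pos
  set I := infoBSC (1 / 2) (pMin p)
  -- Half of the gap between `1/R` and `1/I` pays for the term `η log n`, the other half for the
  -- terms that stay bounded in `n`.
  have hη : 0 < (1 / R - 1 / I) / 2 := by
    have := one_div_lt_one_div_of_lt hR0 hR
    linarith
  set η := (1 / R - 1 / I) / 2 with hηdef
  obtain ⟨K, hK0, hK⟩ := hp.exists_sum_mean_alive_le hη
  have hc := C1_pos hp.half_mem.1 hp.half_mem.2
  have hε1 := log_one_div_nonneg hε
  filter_upwards [eventually_ge_atTop 2, tendsto_log_natCast.eventually_ge_atTop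
    ((Real.log (1 / ε) / C1 (p (1 / 2)) + η * Real.log (1 / ε) + K) / η)] with n hn hlarge r
  have : NeZero n := ⟨by omega⟩
  have hlog : 0 < Real.log n := Real.log_pos (by exact_mod_cast (by omega : 1 < n))
  refine ofReal_le_ofReal_div hR0 hlog (Strategy.expectedTime_le p _ fun T =>
    (hK n ε hn hε r T).trans ?_)
  rw [div_le_iff₀ hη] at hlarge
  have h1 : Real.log (1 / ε) / C1 (p (1 / (n : ℝ))) ≤ Real.log (1 / ε) / C1 (p (1 / 2)) :=
    div_le_div_of_nonneg_left hε1 hc (hp.C1_half_le hn)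
  have h2 : Real.log n / R = Real.log n / I + 2 * (Real.log n * η) := by rw [hηdef]; ring
  rw [log_div_eq hn hε.1, h2]
  linarith

theorem rate_optimal (hp : IsNoiseProfile p) {R : ℝ} (hR : infoBSC (1 / 2) (pMin p) < R) :
    ∃ ε₀ ∈ Set.Ioo (0 : ℝ) 1, ∀ᶠ n : ℕ in atTop, ∀ A : Strategy n, A.Reliable p ε₀ →
      ENNReal.ofReal (Real.log n) / A.expectedTime p ≤ ENNReal.ofReal R := by
  have hI := hp.info_pMin_pos
  have hR0 := hI.trans hR
  have hlt : infoBSC (1 / 2) (pMin p) / R < 1 := (div_lt_one hR0).2 hR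
  have hpos : 0 < infoBSC (1 / 2) (pMin p) / R := div_pos hI hR0
  -- Chosen so that `I/R = 1 - 2 ε₀`; the converse gives `(1 - ε₀) log n - 1`, which suffices once
  -- `ε₀ log n ≥ 1`.
  set ε₀ := (1 - infoBSC (1 / 2) (pMin p) / R) / 2 with hε₀
  have hε₀0 : 0 < ε₀ := by rw [hε₀]; linarith
  refine ⟨ε₀, ⟨hε₀0, by rw [hε₀]; linarith⟩, ?_⟩
  filter_upwards [eventually_ge_atTop 2, tendsto_log_natCast.eventually_ge_atTop (1 / ε₀)]
    with n hn hlarge A hA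
  refine ofReal_div_le_ofReal hR0 (le_trans (ENNReal.ofReal_le_ofReal ?_)
    (hp.rate_converse hn A hA))
  rw [div_le_iff₀ hε₀0] at hlarge
  rw [le_div_iff₀ hI]
  have h1 : Real.log n / R * infoBSC (1 / 2) (pMin p) = Real.log n * (1 - 2 * ε₀) := by
    rw [hε₀]; ring
  rw [h1]
  linarith

theorem reliability_achieved (hp : IsNoiseProfile p) {n : ℕ} (hn : 2 ≤ n) {E : ℝ}
    (hE : E < C1 (p (1 / (n : ℝ)))) :
    ∀ᶠ ε : ℝ in 𝓝[>] 0, ∀ r : SortPM n,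
      ENNReal.ofReal E ≤ ENNReal.ofReal (Real.log (1 / ε)) / (r.strategy p ε).expectedTime p := by
  rcases le_or_gt E 0 with hE0 | hE0
  · exact Eventually.of_forall fun n r => by rw [ENNReal.ofReal_of_nonpos hE0]; exact zero_le
  have : NeZero n := ⟨by omega⟩
  set C := C1 (p (1 / (n : ℝ)))
  have hη : 0 < (1 / E - 1 / C) / 2 := by
    have := one_div_lt_one_div_of_lt hE0 hE
    linarith
  set η := (1 / E - 1 / C) / 2 with hηdef
  obtain ⟨K, hK0, hK⟩ := hp.exists_sum_mean_alive_le hη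
  filter_upwards [eventually_mem_Ioo, tendsto_log_one_div.eventually_gt_atTop 0,
    tendsto_log_one_div.eventually_ge_atTop
      ((Real.log n / infoBSC (1 / 2) (pMin p) + η * Real.log n + K) / η)] with ε hε hlog hlarge r
  refine ofReal_le_ofReal_div hE0 hlog (Strategy.expectedTime_le p _ fun T =>
    (hK n ε hn hε r T).trans ?_)
  rw [div_le_iff₀ hη] at hlarge
  have h2 : Real.log (1 / ε) / E = Real.log (1 / ε) / C + 2 * (Real.log (1 / ε) * η) := by
    rw [hηdef]; ring
  rw [log_div_eq hn hε.1, h2]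
  linarith

theorem reliability_optimal (hp : IsNoiseProfile p) {n : ℕ} (hn : 2 ≤ n) {E : ℝ}
    (hE : C1 (p (1 / (n : ℝ))) < E) :
    ∀ᶠ ε : ℝ in 𝓝[>] 0, ∀ A : Strategy n, A.Reliable p ε →
      ENNReal.ofReal (Real.log (1 / ε)) / A.expectedTime p ≤ ENNReal.ofReal E := by
  have hpn := hp.mem _ (inv_nat_mem hn)
  have hC := C1_pos hpn.1 hpn.2
  have hE0 := hC.trans hE
  have hlt : C1 (p (1 / (n : ℝ))) / E < 1 := (div_lt_one hE0).2 hE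
  -- With `C₁/E = 1 - 2d`, one `d` absorbs `ε` and the other the additive `1` in the converse.
  set d := (1 - C1 (p (1 / (n : ℝ))) / E) / 2 with hd
  have hd0 : 0 < d := by rw [hd]; linarith
  have hsmall : ∀ᶠ ε : ℝ in 𝓝[>] 0, ε < d :=
    (eventually_lt_nhds hd0).filter_mono nhdsWithin_le_nhds
  filter_upwards [eventually_mem_Ioo, hsmall, tendsto_log_one_div.eventually_ge_atTop (1 / d)]
    with ε hε hεd hlarge A hA
  refine ofReal_div_le_ofReal hE0 (le_trans (ENNReal.ofReal_le_ofReal ?_)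
    (hp.reliability_converse hn A hε hA))
  rw [div_le_iff₀ hd0] at hlarge
  rw [le_div_iff₀ hC]
  have h1 : Real.log (1 / ε) / E * C1 (p (1 / (n : ℝ))) = Real.log (1 / ε) * (1 - 2 * d) := by
    rw [hd]; ring
  have h2 := mul_le_mul_of_nonneg_left hεd.le (log_one_div_nonneg hε)
  rw [h1]
  linarith

end IsNoiseProfile

end NoisySearch

end

-- Assembly of the theorem

theorem theorem1 (p : ℝ → ℝ) (hp : NoisySearch.IsNoiseProfile p) :
    -- the constant in the range of `α` is positive
    0 < NoisySearch.Ks p ∧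
    -- reliability of sortPM, and the bound on its expected search time
    (∃ g : ℕ × ℝ → ℝ,
      (g =o[NoisySearch.searchLimit] fun x => Real.log ((x.1 : ℝ) / x.2)) ∧
      ∀ (n : ℕ) (ε : ℝ), 2 ≤ n → ε ∈ Set.Ioo (0 : ℝ) 1 → ∀ r : NoisySearch.SortPM n,
        (r.strategy p ε).Reliable p ε ∧
        ∀ α : ℝ, α < 1 →
          (Real.exp 1 * Real.log ((n : ℝ) / ε)) ^ (-NoisySearch.Ks p) < α →
          (r.strategy p ε).expectedTime p ≤
            ENNReal.ofReal (Real.log n / NoisySearch.infoBSC (1 / 2) (p α)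
              + Real.log (1 / ε) / NoisySearch.C1 (p (1 / (n : ℝ))) + g (n, ε))) ∧
    -- sortPM achieves the rate `I(1/2, p_min)` ...
    (∀ ε ∈ Set.Ioo (0 : ℝ) 1, ∀ R < NoisySearch.infoBSC (1 / 2) (NoisySearch.pMin p),
      ∀ᶠ n : ℕ in atTop, ∀ r : NoisySearch.SortPM n,
        ENNReal.ofReal R ≤ ENNReal.ofReal (Real.log n) / (r.strategy p ε).expectedTime p) ∧
    -- ... and no strategy of vanishing error probability has a larger one
    (∀ R > NoisySearch.infoBSC (1 / 2) (NoisySearch.pMin p),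
      ∃ ε₀ ∈ Set.Ioo (0 : ℝ) 1, ∀ᶠ n : ℕ in atTop,
        ∀ A : NoisySearch.Strategy n, A.Reliable p ε₀ →
          ENNReal.ofReal (Real.log n) / A.expectedTime p ≤ ENNReal.ofReal R) ∧
    -- at each resolution sortPM achieves the reliability exponent `C₁(p(δ))` ...
    (∀ n : ℕ, 2 ≤ n → ∀ E < NoisySearch.C1 (p (1 / (n : ℝ))),
      ∀ᶠ ε : ℝ in 𝓝[>] 0, ∀ r : NoisySearch.SortPM n,
        ENNReal.ofReal E ≤ ENNReal.ofReal (Real.log (1 / ε)) / (r.strategy p ε).expectedTime p) ∧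
    -- ... and no strategy has a larger one
    (∀ n : ℕ, 2 ≤ n → ∀ E > NoisySearch.C1 (p (1 / (n : ℝ))),
      ∀ᶠ ε : ℝ in 𝓝[>] 0, ∀ A : NoisySearch.Strategy n, A.Reliable p ε →
        ENNReal.ofReal (Real.log (1 / ε)) / A.expectedTime p ≤ ENNReal.ofReal E) := by
  refine ⟨NoisySearch.Ks_pos hp, ?_, fun ε hε R hR => hp.rate_achieved hε hR,
    fun R hR => hp.rate_optimal hR, fun n hn E hE => hp.reliability_achieved hn hE,
    fun n hn E hE => hp.reliability_optimal hn hE⟩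
  obtain ⟨g, hg, hbound⟩ := hp.exists_isLittleO_bound
  refine ⟨g, hg, fun n ε hn hε r => ⟨r.reliable hp hn hε, fun α hα hα' => ?_⟩⟩
  have hlog : 0 ≤ Real.log ((n : ℝ) / ε) := by
    rw [NoisySearch.log_div_eq hn hε.1]
    exact add_nonneg (Real.log_natCast_nonneg n) (NoisySearch.log_one_div_nonneg hε)
  -- The lower bound on `α` places it in the domain of the profile, where `p_min ≤ p(α)`; the bound
  -- with `p_min` is then the stronger one.
  have hα0 : 0 < α :=
    (Real.rpow_nonneg (mul_nonneg (Real.exp_pos 1).le hlog) _).trans_lt hα'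
  refine (hbound n ε hn hε r).trans (ENNReal.ofReal_le_ofReal ?_)
  have := hp.log_div_info_le ⟨hα0, hα⟩ n
  linarith
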